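/- Let $n,Q\ge 1$ and $m\ge 0$ be integers, let $\Omega\subset\mathbb{R}^n$ be open, and let $\mathcal{A}_Q(\mathbb{R}^m)$ be the space of unordered $Q$-tuples $T=\sum_{i=1}^Q[\![P_i]\!]$ of points of $\mathbb{R}^m$, with the metric $\mathcal{G}(T,S)=\min_{\sigma}\big(\sum_i|P_i-S_{\sigma(i)}|^2\big)^{1/2}$ and $|T|^2=\sum_i|P_i|^2=\mathcal{G}(T,Q[\![0]\!])^2$. Let $f=\sum_i[\![f_i]\!]\in W^{1,2}(\Omega,\mathcal{A}_Q(\mathbb{R}^m))$, that is, $|f|\in L^2(\Omega)$ and there are $g_1,\dots,g_n\in L^2(\Omega)$ such that for every $T$ the function $\mathcal{G}(f,T)$ is weakly differentiable in $\Omega$ with $|\partial_j\mathcal{G}(f,T)|\le g_j$ a.e.; let $Df=\sum_i[\![Df_i]\!]$ be its approximate differential. Suppose that $f$ is Dir-stationary, that is, $$\int_\Omega\sum_i\big[\langle Df_i:D_x\psi(x,f_i)\rangle+\langle Df_i:D_u\psi(x,f_i)\cdot Df_i\rangle\big]\,dx=0$$ for all $\psi(x,u)\in C^\infty(\Omega\times\mathbb{R}^m;\mathbb{R}^m)$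 with compact support in $x$, $|D_u\psi|\le C$ and $|\psi|+|D_x\psi|\le C(1+|u|)$ for some constant $C$, and $$2\int_\Omega\sum_i\langle Df_i:Df_i\cdot D\phi\rangle\,dx-\int_\Omega|Df|^2\,\mathrm{div}\,\phi\,dx=0\qquad\text{for all }\phi\in C_c^\infty(\Omega,\mathbb{R}^n).$$ Suppose also that $f$ has zero average: $\frac1Q\sum_i f_i=0$ a.e. in $\Omega$. For $x\in\Omega$ let the vanishing order of $f$ at $x$ be $$\kappa_x=\limsup_{r\downarrow0}\frac{\log\Big(\frac{1}{|B_{2r}(x)\setminus B_r(x)|}\int_{B_{2r}(x)\setminus B_r(x)}|f|^2\,dy\Big)}{2\log r}\in[-\infty,+\infty],\qquad \log 0=-\infty.$$ Then: 1. The function $x\mapsto\kappa_x$ is upper semicontinuous on $\Omega$. 2. If moreover $\Omega$ is connected and $f$ is not a.e. equal to $Q[\![0]\!]$ in $\Omega$, then $\kappa_x$ is bounded on every compact subset of $\Omega$: for each compact $K\subset\Omega$ there is $C\in\mathbb{R}$ with $-C\le\kappa_x\le C$ for all $x\in K$. -/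

import Mathlib

namespace QValued

/-- Euclidean space `ℝⁿ`. -/
abbrev Euc (n : ℕ) : Type := EuclideanSpace ℝ (Fin n)

/-- `𝒜_Q(ℝᵐ)`: unordered `Q`-tuples of points of `ℝᵐ`, i.e. sums `∑ i, ⟦P i⟧` of `Q` Dirac
masses. -/
abbrev AQ (Q m : ℕ) : Type := Sym (Euc m) Q

/-- The point `Q⟦0⟧`. -/
def zeroQ (Q m : ℕ) : AQ Q m := Sym.replicate Q (0 : Euc m)

/-- The metric `𝒢(T, S) = min_σ (∑ i, |P i - S (σ i)|²)^(1/2)` on `𝒜_Q(ℝᵐ)`: the least value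
over all orderings `p` of `T` and `s` of `S` (a non-empty finite set of values). -/
noncomputable def dist {Q m : ℕ} (T S : AQ Q m) : ℝ :=
  sInf {d : ℝ | ∃ p s : Fin Q → Euc m,
    (T : Multiset (Euc m)) = Finset.univ.val.map p ∧
    (S : Multiset (Euc m)) = Finset.univ.val.map s ∧
    d = √(∑ i, ‖p i - s i‖ ^ 2)}

/-- `|T|² = ∑ i, |P i|²`, the square of `𝒢(T, Q⟦0⟧)`. -/
noncomputable def normSq {Q m : ℕ} (T : AQ Q m) : ℝ :=
  ((T : Multiset (Euc m)).map (fun P => ‖P‖ ^ 2)).sum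

/-- The average (centre of mass) `(1 / Q) ∑ i, P i`. -/
noncomputable def average {Q m : ℕ} (T : AQ Q m) : Euc m :=
  (Q : ℝ)⁻¹ • (T : Multiset (Euc m)).sum

/-- `v` is the weak `j`-th partial derivative of `u` on the open set `Ω`. -/
def HasWeakPartialDeriv {n : ℕ} (Ω : Set (Euc n)) (j : Fin n) (u v : Euc n → ℝ) : Prop :=
  MeasureTheory.LocallyIntegrableOn u Ω ∧
  MeasureTheory.LocallyIntegrableOn v Ω ∧
  ∀ χ : Euc n → ℝ, ContDiff ℝ (⊤ : ℕ∞) χ → HasCompactSupport χ → tsupport χ ⊆ Ω →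
    ∫ x in Ω, u x * fderiv ℝ χ x (EuclideanSpace.single j 1) = - ∫ x in Ω, v x * χ x

/-- `f ∈ W^{1,2}(Ω, 𝒜_Q(ℝᵐ))`: `|f| ∈ L²(Ω)`, and there are `g_j ∈ L²(Ω)` such that for every
`T` the function `x ↦ 𝒢(f x, T)` is weakly differentiable on `Ω` with `|∂_j 𝒢(f, T)| ≤ g_j`
almost everywhere. If `Ω` has finite measure, this is the same as asking that
`𝒢(f, T) ∈ W^{1,2}(Ω)` for all `T` with these bounds, because `𝒢(f, T) ≤ |f| + |T|`.
Measurability of `f` is contained in the measurability of all the functions `𝒢(f, T)`. -/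
def MemW12 {n m Q : ℕ} (Ω : Set (Euc n)) (f : Euc n → AQ Q m) : Prop :=
  MeasureTheory.MemLp (fun x => dist (f x) (zeroQ Q m)) 2 (MeasureTheory.volume.restrict Ω) ∧
  ∃ g : Fin n → Euc n → ℝ,
    (∀ j, MeasureTheory.MemLp (g j) 2 (MeasureTheory.volume.restrict Ω)) ∧
    ∀ (T : AQ Q m) (j : Fin n), ∃ v : Euc n → ℝ,
      HasWeakPartialDeriv Ω j (fun x => dist (f x) T) v ∧
      ∀ᵐ x ∂(MeasureTheory.volume.restrict Ω), |v x| ≤ g j x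

/-- The first-order expansion `x ↦ ∑ i, ⟦P i + L i (x - x₀)⟧` of a first-order jet
`∑ i, ⟦(P i, L i)⟧`. -/
noncomputable def expansion {n m Q : ℕ} (J : Sym (Euc m × (Euc n →L[ℝ] Euc m)) Q)
    (x₀ x : Euc n) : AQ Q m :=
  J.map (fun p => p.1 + p.2 (x - x₀))

/-- `f` is approximately differentiable at `x₀`, with `J = ∑ i, ⟦(f_i(x₀), Df_i(x₀))⟧`:
`L i = L j` whenever `P i = P j`, and on a measurable set `S ∋ x₀` of density one at `x₀`,
`𝒢(f x, ∑ i, ⟦P i + L i (x - x₀)⟧) = o(|x - x₀|)`. -/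
def HasApproxJetAt {n m Q : ℕ} (f : Euc n → AQ Q m) (x₀ : Euc n)
    (J : Sym (Euc m × (Euc n →L[ℝ] Euc m)) Q) : Prop :=
  J.map Prod.fst = f x₀ ∧
  (∀ p ∈ J, ∀ q ∈ J, p.1 = q.1 → p.2 = q.2) ∧
  ∃ S : Set (Euc n), MeasurableSet S ∧ x₀ ∈ S ∧
    Filter.Tendsto (fun r : ℝ => MeasureTheory.volume (S ∩ Metric.ball x₀ r) /
      MeasureTheory.volume (Metric.ball x₀ r)) (nhdsWithin 0 (Set.Ioi 0)) (nhds 1) ∧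
    (fun x => dist (f x) (expansion J x₀ x)) =o[nhdsWithin x₀ S] (fun x => x - x₀)

open Classical in
/-- The field of pairs `∑ i, ⟦(f_i(x), Df_i(x))⟧`, given by the approximate differential, which
is unique where it exists. The value at the other points (a null set in `Ω` if
`f ∈ W^{1,2}(Ω, 𝒜_Q)`) is immaterial. -/
noncomputable def jet {n m Q : ℕ} (f : Euc n → AQ Q m) (x : Euc n) :
    Sym (Euc m × (Euc n →L[ℝ] Euc m)) Q :=
  if h : ∃ J, HasApproxJetAt f x J then h.choose else (f x).map (fun P => (P, 0))

/-- `∑ i, F (f_i(x), Df_i(x))`. -/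
noncomputable def jetSum {n m Q : ℕ} (f : Euc n → AQ Q m) (x : Euc n)
    (F : Euc m × (Euc n →L[ℝ] Euc m) → ℝ) : ℝ :=
  ((jet f x : Multiset (Euc m × (Euc n →L[ℝ] Euc m))).map F).sum

/-- The Hilbert-Schmidt product `⟨A : B⟩`. -/
noncomputable def hs {n m : ℕ} (A B : Euc n →L[ℝ] Euc m) : ℝ :=
  ∑ j : Fin n, inner ℝ (A (EuclideanSpace.single j 1)) (B (EuclideanSpace.single j 1))

/-- The divergence of a vector field. -/
noncomputable def divergence {n : ℕ} (φ : Euc n → Euc n) (x : Euc n) : ℝ :=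
  ∑ j : Fin n, (fderiv ℝ φ x (EuclideanSpace.single j 1)) j

/-- `𝒪(f, ψ) = ∫_Ω ∑ i, ⟨Df_i : D_x ψ(x, f_i)⟩ + ⟨Df_i : D_u ψ(x, f_i) · Df_i⟩`. -/
noncomputable def outerVariation {n m Q : ℕ} (Ω : Set (Euc n)) (f : Euc n → AQ Q m)
    (ψ : Euc n × Euc m → Euc m) : ℝ :=
  ∫ x in Ω, jetSum f x (fun p =>
    hs p.2 (fderiv ℝ (fun y => ψ (y, p.1)) x) +
    hs p.2 ((fderiv ℝ (fun u => ψ (x, u)) p.1).comp p.2))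

/-- `ℐ(f, φ) = 2 ∫_Ω ∑ i, ⟨Df_i : Df_i · Dφ⟩ - ∫_Ω |Df|² div φ`. -/
noncomputable def innerVariation {n m Q : ℕ} (Ω : Set (Euc n)) (f : Euc n → AQ Q m)
    (φ : Euc n → Euc n) : ℝ :=
  2 * (∫ x in Ω, jetSum f x (fun p => hs p.2 (p.2.comp (fderiv ℝ φ x)))) -
    ∫ x in Ω, jetSum f x (fun p => hs p.2 p.2) * divergence φ x

/-- Admissible `ψ(x, u)` for outer variations in `Ω`: smooth, compactly supported in `x`, with
`|D_u ψ| ≤ C` and `|ψ| + |D_x ψ| ≤ C (1 + |u|)`. -/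
def IsOuterTest {n m : ℕ} (Ω : Set (Euc n)) (ψ : Euc n × Euc m → Euc m) : Prop :=
  ContDiff ℝ (⊤ : ℕ∞) ψ ∧
  (∃ K : Set (Euc n), IsCompact K ∧ K ⊆ Ω ∧ ∀ x, x ∉ K → ∀ u, ψ (x, u) = 0) ∧
  ∃ C : ℝ, ∀ (x : Euc n) (u : Euc m),
    ‖fderiv ℝ (fun w => ψ (x, w)) u‖ ≤ C ∧
    ‖ψ (x, u)‖ + ‖fderiv ℝ (fun y => ψ (y, u)) x‖ ≤ C * (1 + ‖u‖)

/-- `f ∈ W^{1,2}(Ω, 𝒜_Q(ℝᵐ))` is Dir-stationary in `Ω`: stationary for the Dirichlet energy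
with respect to outer and inner variations. -/
def IsDirStationary {n m Q : ℕ} (Ω : Set (Euc n)) (f : Euc n → AQ Q m) : Prop :=
  MemW12 Ω f ∧
  (∀ ψ : Euc n × Euc m → Euc m, IsOuterTest Ω ψ → outerVariation Ω f ψ = 0) ∧
  ∀ φ : Euc n → Euc n, ContDiff ℝ (⊤ : ℕ∞) φ → HasCompactSupport φ → tsupport φ ⊆ Ω →
    innerVariation Ω f φ = 0

/-- The vanishing order `κ_x = limsup_{r → 0+} log (⨍_{B_{2r}(x) \ B_r(x)} |f|²) / (2 log r)`,
with values in `[-∞, ∞]` and `log 0 = -∞` (so that `κ_x = ∞` if `f = Q⟦0⟧` near `x`). -/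
noncomputable def vanishingOrder {n m Q : ℕ} (f : Euc n → AQ Q m) (x : Euc n) : EReal :=
  Filter.limsup (fun r : ℝ =>
    ENNReal.log (MeasureTheory.laverage
      (MeasureTheory.volume.restrict (Metric.ball x (2 * r) \ Metric.ball x r))
      (fun y => ENNReal.ofReal (normSq (f y)))) / ((2 * Real.log r : ℝ) : EReal))
    (nhdsWithin 0 (Set.Ioi 0))

end QValued

/-! The proof is Almgren's frequency monotonicity. With w a smooth cutoff and W its primitive (W' =
-w, W = 0 far out), put H(x,r) = ∫ w(|y-x|²/r²)|f|² and D(x,r) = ∫ W(|y-x|²/r²)|Df|². The outer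
variation with ψ = W·u, the inner variation with φ = W·(y-x) and the weak derivative of |f|² give H'
= nH/r + rD and, after Cauchy-Schwarz, r D' H ≥ (n-2) D H + (rD)²
(`IsDirStationary.hasDerivAt_height_and_energy`). Hence N = r²D/H is nondecreasing in r, while
(log(H/rⁿ))' = N/r.

Integrating the last relation shows that H cannot vanish below a scale where it is positive, and
that log(H/rⁿ) grows like N(0+) log r. Annulus means of |f|² are comparable to H/rⁿ up to a factor 2
in scale, so the vanishing order is half the limit frequency, in the form needed here: it is at most
N(x,s)/2 for every admissible s (`vanishingOrder_le_frequency`), and at least c as soon as N ≥ 2c at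
all small scales (`le_vanishingOrder_of_le_frequency`). Where it is finite it is thus an infimum
over s of functions continuous in x, whence upper semicontinuity. It is nonnegative because N ≥ 0,
and it is infinite exactly where f vanishes near the point. The sets of finite and of infinite order
are both open, so on a connected domain the order is finite everywhere unless f vanishes; a
semicontinuous function attains its maximum on a compact set.

The longer part of the file makes the integrals meaningful. The differential Df is given only
pointwise, as an approximate jet, while the Sobolev hypothesis speaks of the weak derivatives of x ↦
𝒢(f x, T). The link is: Sobolev functions are approximately differentiable a.e.; f is Lipschitz on
countably many pieces covering almost everything, where it splits locally into Lipschitz sheets, so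
a jet exists a.e. (`MemW12.ae_exists_jet`); the gradient of 𝒢(f, T) is computed from the jet, and
conversely ∑ |Df_i·v|² is recovered as a supremum over countably many T (`MemW12.exists_gradients`).
Measurability and integrability of |Df|² and the formula ∂_j|f|² = 2∑⟨f_i, ∂_j f_i⟩ follow. -/

namespace QValued

open Filter Topology

/-! ### Unordered tuples through labellings, and the metric 𝒢 -/

/-- The unordered tuple with labelling `p`. -/
def ofLabel {α : Type*} {Q : ℕ} (p : Fin Q → α) : Sym α Q :=
  ⟨Finset.univ.val.map p, by simp⟩

@[simp] lemma coe_ofLabel {α : Type*} {Q : ℕ} (p : Fin Q → α) :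
    (ofLabel p : Multiset α) = Finset.univ.val.map p := rfl

lemma exists_ofLabel {α : Type*} {Q : ℕ} (T : Sym α Q) : ∃ p : Fin Q → α, ofLabel p = T := by
  obtain ⟨T, hT⟩ := T
  induction T using Quotient.inductionOn with
  | _ l =>
    have hl : l.length = Q := by simpa using hT
    subst hl
    refine ⟨l.get, Subtype.ext ?_⟩
    simp

lemma ofLabel_comp_perm {α : Type*} {Q : ℕ} (p : Fin Q → α) (σ : Equiv.Perm (Fin Q)) :
    ofLabel (p ∘ σ) = ofLabel p := by
  apply Subtype.ext
  change Finset.univ.val.map (p ∘ σ) = Finset.univ.val.map p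
  rw [← Multiset.map_map, Multiset.map_univ_val_equiv]

/-- Equal multisets have fibres of equal cardinality over each value; bijections between these
fibres glue to a permutation of the labels. -/
lemma exists_perm_of_ofLabel_eq {α : Type*} {Q : ℕ} {p s : Fin Q → α}
    (h : ofLabel p = ofLabel s) : ∃ σ : Equiv.Perm (Fin Q), p = s ∘ σ := by
  classical
  have hc : ∀ a, Fintype.card {i // p i = a} = Fintype.card {i // s i = a} := by
    intro a
    have h1 := congrArg (fun T : Sym α Q => Multiset.count a (T : Multiset α)) h
    simp only [coe_ofLabel, Multiset.count_map] at h1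
    rw [Fintype.card_subtype, Fintype.card_subtype]
    simpa [Finset.card, Finset.filter, eq_comm] using h1
  let e : ∀ a, {i // p i = a} ≃ {i // s i = a} := fun a => Fintype.equivOfCardEq (hc a)
  refine ⟨(Equiv.sigmaFiberEquiv p).symm.trans
    ((Equiv.sigmaCongrRight e).trans (Equiv.sigmaFiberEquiv s)), ?_⟩
  funext i
  exact ((e (p i)) ⟨i, rfl⟩).2.symm

lemma ofLabel_map {α β : Type*} {Q : ℕ} (p : Fin Q → α) (F : α → β) :
    (ofLabel p).map F = ofLabel (fun i => F (p i)) := by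
  apply Subtype.ext
  change (Finset.univ.val.map p).map F = _
  rw [Multiset.map_map]; rfl

lemma sum_map_ofLabel {α β : Type*} [AddCommMonoid β] {Q : ℕ} (p : Fin Q → α) (F : α → β) :
    ((ofLabel p : Multiset α).map F).sum = ∑ i, F (p i) := by
  rw [coe_ofLabel, Multiset.map_map]; rfl

lemma mem_ofLabel {α : Type*} {Q : ℕ} (p : Fin Q → α) (a : α) :
    a ∈ ofLabel p ↔ ∃ i, p i = a := by
  change a ∈ Finset.univ.val.map p ↔ _
  simp

variable {n m Q : ℕ}

/-- The `ℓ²` distance between labelled tuples. -/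
noncomputable def labelDist (p s : Fin Q → Euc m) : ℝ := √(∑ i, ‖p i - s i‖ ^ 2)

lemma labelDist_nonneg (p s : Fin Q → Euc m) : 0 ≤ labelDist p s := Real.sqrt_nonneg _

lemma labelDist_sq (p s : Fin Q → Euc m) : labelDist p s ^ 2 = ∑ i, ‖p i - s i‖ ^ 2 :=
  Real.sq_sqrt (Finset.sum_nonneg fun _ _ => sq_nonneg _)

lemma labelDist_eq_norm (p s : Fin Q → Euc m) :
    labelDist p s = ‖(WithLp.toLp 2 (fun i => p i - s i) : PiLp 2 (fun _ : Fin Q => Euc m))‖ := by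
  rw [PiLp.norm_eq_of_L2]; rfl

lemma labelDist_triangle (p q s : Fin Q → Euc m) :
    labelDist p s ≤ labelDist p q + labelDist q s := by
  rw [labelDist_eq_norm, labelDist_eq_norm, labelDist_eq_norm]
  refine le_trans (le_of_eq ?_) (norm_add_le _ _)
  congr 1
  ext i
  simp

lemma labelDist_comp_perm (p s : Fin Q → Euc m) (σ : Equiv.Perm (Fin Q)) :
    labelDist (p ∘ σ) (s ∘ σ) = labelDist p s := by
  unfold labelDist
  congr 1
  exact Equiv.sum_comp σ (fun i => ‖p i - s i‖ ^ 2)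

lemma norm_sub_le_labelDist (p s : Fin Q → Euc m) (i : Fin Q) :
    ‖p i - s i‖ ≤ labelDist p s := by
  apply Real.le_sqrt_of_sq_le
  exact Finset.single_le_sum (f := fun i => ‖p i - s i‖ ^ 2) (fun _ _ => sq_nonneg _)
    (Finset.mem_univ i)

lemma labelDist_le_sum (p s : Fin Q → Euc m) : labelDist p s ≤ ∑ i, ‖p i - s i‖ := by
  apply Real.sqrt_le_iff.2 ⟨Finset.sum_nonneg fun _ _ => norm_nonneg _, ?_⟩
  exact Finset.sum_sq_le_sq_sum_of_nonneg fun _ _ => norm_nonneg _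

lemma dist_set_bddBelow (T S : AQ Q m) : BddBelow {d : ℝ | ∃ p s : Fin Q → Euc m,
    (T : Multiset (Euc m)) = Finset.univ.val.map p ∧
    (S : Multiset (Euc m)) = Finset.univ.val.map s ∧
    d = √(∑ i, ‖p i - s i‖ ^ 2)} :=
  ⟨0, by rintro d ⟨p, s, -, -, rfl⟩; exact Real.sqrt_nonneg _⟩

lemma dist_ofLabel_le (p s : Fin Q → Euc m) : dist (ofLabel p) (ofLabel s) ≤ labelDist p s :=
  csInf_le (dist_set_bddBelow _ _) ⟨p, s, rfl, rfl, rfl⟩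

/-- Two orderings can be permuted simultaneously without changing the cost, so the first one may be
kept fixed. The competitors are then indexed by permutations, and the infimum over this finite set
is attained. -/
lemma exists_dist_ofLabel (p s : Fin Q → Euc m) : ∃ σ : Equiv.Perm (Fin Q),
    dist (ofLabel p) (ofLabel s) = labelDist p (s ∘ σ) := by
  have hfin : {d : ℝ | ∃ p' s' : Fin Q → Euc m,
    (ofLabel p : Multiset (Euc m)) = Finset.univ.val.map p' ∧
    (ofLabel s : Multiset (Euc m)) = Finset.univ.val.map s' ∧
    d = √(∑ i, ‖p' i - s' i‖ ^ 2)} = Set.range fun σ : Equiv.Perm (Fin Q) =>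
      labelDist p (s ∘ σ) := by
    ext d
    constructor
    · rintro ⟨p', s', hp, hs, rfl⟩
      obtain ⟨σ, rfl⟩ := exists_perm_of_ofLabel_eq (p := p) (s := p') (Subtype.ext hp)
      obtain ⟨τ, rfl⟩ := exists_perm_of_ofLabel_eq (p := s') (s := s) (Subtype.ext hs.symm)
      exact ⟨σ.trans τ, labelDist_comp_perm p' (s ∘ τ) σ⟩
    · rintro ⟨σ, rfl⟩
      exact ⟨p, s ∘ σ, rfl, congrArg Subtype.val (ofLabel_comp_perm s σ).symm, rfl⟩
  have h2 := (Set.range_nonempty fun σ : Equiv.Perm (Fin Q) => labelDist p (s ∘ σ)).csInf_mem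
    (Set.finite_range _)
  obtain ⟨σ, hσ⟩ := h2
  refine ⟨σ, Eq.trans ?_ hσ.symm⟩
  unfold dist
  rw [hfin]

lemma exists_labels_dist (T S : AQ Q m) : ∃ p s : Fin Q → Euc m,
    ofLabel p = T ∧ ofLabel s = S ∧ dist T S = labelDist p s := by
  obtain ⟨p, rfl⟩ := exists_ofLabel T
  obtain ⟨s, rfl⟩ := exists_ofLabel S
  obtain ⟨σ, hσ⟩ := exists_dist_ofLabel p s
  exact ⟨p, s ∘ σ, rfl, ofLabel_comp_perm s σ, hσ⟩

lemma dist_nonneg (T S : AQ Q m) : 0 ≤ dist T S := by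
  obtain ⟨p, s, -, -, h⟩ := exists_labels_dist T S
  rw [h]; exact labelDist_nonneg _ _

lemma dist_comm (T S : AQ Q m) : dist T S = dist S T := by
  unfold dist
  congr 1
  ext d
  constructor <;> rintro ⟨p, s, h1, h2, rfl⟩ <;>
    exact ⟨s, p, h2, h1, by simp_rw [norm_sub_rev]⟩

@[simp] lemma dist_self (T : AQ Q m) : dist T T = 0 := by
  obtain ⟨p, rfl⟩ := exists_ofLabel T
  refine le_antisymm ((dist_ofLabel_le p p).trans ?_) (dist_nonneg _ _)
  simp [labelDist]

lemma dist_triangle (T S R : AQ Q m) : dist T R ≤ dist T S + dist S R := by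
  obtain ⟨p, s, rfl, rfl, h⟩ := exists_labels_dist T S
  obtain ⟨r, rfl⟩ := exists_ofLabel R
  obtain ⟨σ, hσ⟩ := exists_dist_ofLabel s r
  rw [h, hσ, ← ofLabel_comp_perm r σ]
  exact (dist_ofLabel_le _ _).trans (labelDist_triangle _ _ _)

lemma eq_of_dist_eq_zero {T S : AQ Q m} (h : dist T S = 0) : T = S := by
  obtain ⟨p, s, rfl, rfl, h'⟩ := exists_labels_dist T S
  congr 1
  funext i
  have := norm_sub_le_labelDist p s i
  rw [← h', h] at this
  exact sub_eq_zero.1 (norm_le_zero_iff.1 this)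

lemma zeroQ_eq : zeroQ Q m = ofLabel (fun _ => (0 : Euc m)) := by
  apply Subtype.ext
  change Multiset.replicate Q (0 : Euc m) = _
  simp

lemma normSq_ofLabel (p : Fin Q → Euc m) : normSq (ofLabel p) = ∑ i, ‖p i‖ ^ 2 :=
  sum_map_ofLabel p _

lemma dist_zeroQ_ofLabel (p : Fin Q → Euc m) :
    dist (ofLabel p) (zeroQ Q m) = labelDist p (fun _ => 0) := by
  obtain ⟨σ, hσ⟩ := exists_dist_ofLabel p (fun _ => (0 : Euc m))
  rw [zeroQ_eq, hσ]; rfl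

lemma dist_zeroQ_sq (T : AQ Q m) : dist T (zeroQ Q m) ^ 2 = normSq T := by
  obtain ⟨p, rfl⟩ := exists_ofLabel T
  rw [dist_zeroQ_ofLabel, labelDist_sq, normSq_ofLabel]
  simp

lemma normSq_nonneg (T : AQ Q m) : 0 ≤ normSq T := by
  rw [← dist_zeroQ_sq]; positivity

/-- A countable family of `Q`-tuples, dense in a labelled sense. -/
noncomputable def denseLabel (m Q : ℕ) (q : Fin Q → ℕ) : Fin Q → Euc m :=
  fun i => TopologicalSpace.denseSeq (Euc m) (q i)

lemma exists_denseLabel (p : Fin Q → Euc m) {ε : ℝ} (hε : 0 < ε) :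
    ∃ q, ∀ i, ‖p i - denseLabel m Q q i‖ < ε := by
  have : ∀ i, ∃ k, ‖p i - TopologicalSpace.denseSeq (Euc m) k‖ < ε := by
    intro i
    obtain ⟨k, hk⟩ :=
      (TopologicalSpace.denseRange_denseSeq (Euc m)).exists_dist_lt (p i) hε
    exact ⟨k, by rwa [← dist_eq_norm]⟩
  choose q hq using this
  exact ⟨q, hq⟩

lemma exists_dist_denseLabel_lt (T : AQ Q m) {ε : ℝ} (hε : 0 < ε) :
    ∃ q, dist T (ofLabel (denseLabel m Q q)) < ε := by
  obtain ⟨p, rfl⟩ := exists_ofLabel T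
  obtain ⟨q, hq⟩ := exists_denseLabel p (ε := ε / (Q + 1)) (by positivity)
  refine ⟨q, ((dist_ofLabel_le _ _).trans (labelDist_le_sum _ _)).trans_lt ?_⟩
  calc ∑ i, ‖p i - denseLabel m Q q i‖ ≤ ∑ _i : Fin Q, ε / (Q + 1) :=
        Finset.sum_le_sum fun i _ => (hq i).le
    _ = Q * (ε / (Q + 1)) := by simp
    _ < ε := by
        rw [mul_div_assoc', div_lt_iff₀ (by positivity)]
        nlinarith

/-- The distance of two tuples is controlled by distances to the dense family. -/
lemma dist_le_of_forall_denseLabel {T S : AQ Q m} {c : ℝ}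
    (h : ∀ q, |dist T (ofLabel (denseLabel m Q q)) - dist S (ofLabel (denseLabel m Q q))| ≤ c) :
    dist T S ≤ c := by
  refine le_of_forall_pos_le_add fun ε hε => ?_
  obtain ⟨q, hq⟩ := exists_dist_denseLabel_lt S (half_pos hε)
  have h1 := (abs_le.1 (h q)).2
  have h2 := dist_triangle T (ofLabel (denseLabel m Q q)) S
  rw [dist_comm (ofLabel _) S] at h2
  linarith

end QValued

/-! ### Sets of density one and approximate limits -/

namespace ApproxCalc

open MeasureTheory Filter Topology Metric
open scoped ENNReal

variable {n : ℕ}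

local notation "E" => EuclideanSpace ℝ (Fin n)

lemma volume_ball_pos (x : E) {r : ℝ} (hr : 0 < r) : volume (ball x r) ≠ 0 :=
  (measure_ball_pos _ _ hr).ne'

lemma volume_ball_ne_top (x : E) (r : ℝ) : volume (ball x r) ≠ ⊤ := measure_ball_lt_top.ne

lemma volume_ball_scale (x y : E) {r c : ℝ} (hc : 0 < c) (hr : 0 < r) :
    volume (ball x (c * r)) = ENNReal.ofReal (c ^ n) * volume (ball y r) := by
  rw [Measure.addHaar_ball_of_pos _ _ (mul_pos hc hr), Measure.addHaar_ball_of_pos _ y hr, ← mul_assoc,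
    ← ENNReal.ofReal_mul (by positivity), finrank_euclideanSpace_fin, mul_pow]

/-- The filter of sets of Lebesgue density one at `x`. -/
def densityFilter (x : E) : Filter E where
  sets := {A | Tendsto (fun r : ℝ => volume (ball x r \ A) / volume (ball x r)) (𝓝[>] 0) (𝓝 0)}
  univ_sets := by simp
  sets_of_superset := by
    intro A B hA hAB
    refine tendsto_of_tendsto_of_tendsto_of_le_of_le tendsto_const_nhds hA (fun _ => zero_le) ?_
    intro r
    exact ENNReal.div_le_div_right (measure_mono (Set.sdiff_subset_sdiff_right hAB)) _
  inter_sets := by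
    intro A B hA hB
    have := Tendsto.add hA hB
    rw [add_zero] at this
    refine tendsto_of_tendsto_of_tendsto_of_le_of_le tendsto_const_nhds this (fun _ => zero_le) ?_
    intro r
    simp only
    rw [← ENNReal.add_div, Set.sdiff_inter]
    exact ENNReal.div_le_div_right (measure_union_le _ _) _

lemma mem_densityFilter {x : E} {A : Set E} : A ∈ densityFilter x ↔
    Tendsto (fun r : ℝ => volume (ball x r \ A) / volume (ball x r)) (𝓝[>] 0) (𝓝 0) := Iff.rfl

lemma densityFilter_le_nhds (x : E) : densityFilter x ≤ 𝓝 x := by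
  intro A hA
  obtain ⟨ε, hε, h⟩ := Metric.mem_nhds_iff.1 hA
  rw [mem_densityFilter]
  refine tendsto_const_nhds.congr' ?_
  filter_upwards [Ioo_mem_nhdsGT hε] with r hr
  rw [Set.sdiff_eq_empty.2 ((ball_subset_ball hr.2.le).trans h)]
  simp

lemma mem_densityFilter_of_measurableSet {x : E} {S : Set E} (hS : MeasurableSet S) :
    S ∈ densityFilter x ↔
    Tendsto (fun r : ℝ => volume (S ∩ ball x r) / volume (ball x r)) (𝓝[>] 0) (𝓝 1) := by
  have key : ∀ r : ℝ, 0 < r → volume (ball x r \ S) / volume (ball x r) =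
      1 - volume (S ∩ ball x r) / volume (ball x r) := by
    intro r hr
    have h0 := volume_ball_pos x hr
    have h1 := volume_ball_ne_top x r
    have h2 : volume (ball x r \ S) = volume (ball x r) - volume (S ∩ ball x r) := by
      rw [← Set.sdiff_inter_self_eq_sdiff, measure_sdiff Set.inter_subset_right
        (hS.inter measurableSet_ball).nullMeasurableSet
        (ne_top_of_le_ne_top h1 (measure_mono Set.inter_subset_right))]
    rw [h2, ENNReal.sub_div (fun _ _ => h0), ENNReal.div_self h0 h1]
  rw [mem_densityFilter]
  constructor
  · intro h
    have h3 : Tendsto (fun r : ℝ => 1 - volume (ball x r \ S) / volume (ball x r)) (𝓝[>] 0)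
        (𝓝 (1 - 0)) := ENNReal.Tendsto.sub tendsto_const_nhds h (Or.inl ENNReal.one_ne_top)
    rw [tsub_zero] at h3
    refine h3.congr' ?_
    filter_upwards [self_mem_nhdsWithin] with r hr
    rw [key r hr]
    refine ENNReal.sub_sub_cancel ENNReal.one_ne_top ?_
    exact ENNReal.div_le_of_le_mul (by rw [one_mul]; exact measure_mono Set.inter_subset_right)
  · intro h
    have h3 : Tendsto (fun r : ℝ => 1 - volume (S ∩ ball x r) / volume (ball x r)) (𝓝[>] 0)
        (𝓝 (1 - 1)) := ENNReal.Tendsto.sub tendsto_const_nhds h (Or.inl ENNReal.one_ne_top)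
    rw [tsub_self] at h3
    refine h3.congr' ?_
    filter_upwards [self_mem_nhdsWithin] with r hr
    rw [key r hr]

/-- Lebesgue's density theorem, passed from closed to open balls because spheres are null. -/
lemma ae_mem_densityFilter {S : Set E} (hS : MeasurableSet S) :
    ∀ᵐ x ∂(volume.restrict S), S ∈ densityFilter x := by
  filter_upwards [Besicovitch.ae_tendsto_measure_inter_div (volume : Measure E) S] with x hx
  rw [mem_densityFilter_of_measurableSet hS]
  refine hx.congr' ?_
  filter_upwards [self_mem_nhdsWithin] with r hr
  have hr' : r ≠ 0 := (ne_of_gt hr)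
  have h0 : volume (sphere x r) = 0 := Measure.addHaar_sphere_of_ne_zero _ _ hr'
  have : (closedBall x r : Set E) =ᵐ[volume] ball x r := by
    rw [← ball_union_sphere]
    exact union_ae_eq_left_of_ae_eq_empty (ae_eq_empty.2 h0)
  rw [measure_congr this, measure_congr ((ae_eq_refl S).inter this)]

/-- If c v > 0, then the inequality fails, for small ε, on an open cone about v. This cone occupies
a fixed share of every ball, which is impossible on a set of density one. The one-sided hypothesis
is enough since v may be replaced by -v. -/
lemma eq_zero_of_eventually_le {x : E} {c : E →L[ℝ] ℝ}
    (h : ∀ ε : ℝ, 0 < ε → ∀ᶠ y in densityFilter x, c (y - x) ≤ ε * ‖y - x‖) : c = 0 := by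
  have main : ∀ v, c v ≤ 0 := by
    intro v
    by_contra! hv
    have hv0 : 0 < ‖v‖ := by
      rw [norm_pos_iff]; rintro rfl; simp at hv
    set ε := c v / (2 * ‖v‖) with hε
    have hε0 : 0 < ε := by positivity
    have hopen : IsOpen {w : E | ε * ‖w‖ < c w} :=
      isOpen_lt (by fun_prop) (by fun_prop)
    have hvm : v ∈ {w : E | ε * ‖w‖ < c w} := by
      change ε * ‖v‖ < c v
      rw [hε]; field_simp; linarith
    obtain ⟨δ, hδ, hb⟩ := Metric.isOpen_iff.1 hopen v hvm
    have hA := h ε hε0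
    rw [Filter.Eventually, mem_densityFilter] at hA
    set R := ‖v‖ + δ
    have hR : 0 < R := by positivity
    set κ : ℝ≥0∞ := ENNReal.ofReal ((δ / R) ^ n)
    have hκ : 0 < κ := ENNReal.ofReal_pos.2 (by positivity)
    have hlow : ∀ r : ℝ, 0 < r → κ ≤
        volume (ball x r \ {y | c (y - x) ≤ ε * ‖y - x‖}) / volume (ball x r) := by
      intro r hr
      -- This is the ball of radius δ about v, inside the cone, scaled by r / R and moved to x. As R
      -- = ‖v‖ + δ, it stays in `ball x r`, with volume share (δ / R)ⁿ.
      have hsub : ball (x + (r / R) • v) (δ / R * r) ⊆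
          ball x r \ {y | c (y - x) ≤ ε * ‖y - x‖} := by
        intro y hy
        rw [mem_ball, dist_eq_norm] at hy
        have ht : 0 < r / R := by positivity
        set w := (r / R)⁻¹ • (y - x) with hw
        have hyx : y - x = (r / R) • w := by rw [hw, smul_inv_smul₀ ht.ne']
        have hwb : ‖w - v‖ < δ := by
          have h1 : y - (x + (r / R) • v) = (r / R) • (w - v) := by
            rw [smul_sub, ← hyx]; abel
          rw [h1, norm_smul, Real.norm_of_nonneg ht.le] at hy
          have : (r / R) * ‖w - v‖ < (r / R) * δ := by
            refine hy.trans_eq ?_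
            ring
          exact lt_of_mul_lt_mul_left this ht.le
        have hwc : ε * ‖w‖ < c w := hb (by rwa [mem_ball, dist_eq_norm])
        refine ⟨?_, ?_⟩
        · rw [mem_ball, dist_eq_norm, hyx, norm_smul, Real.norm_of_nonneg ht.le]
          have h2 : ‖w‖ < R := by
            calc ‖w‖ = ‖v + (w - v)‖ := by congr 1; abel
              _ ≤ ‖v‖ + ‖w - v‖ := norm_add_le _ _
              _ < R := by simp only [R]; linarith
          calc r / R * ‖w‖ < r / R * R := by gcongr
            _ = r := by field_simp
        · simp only [Set.mem_ofPred_eq, not_le]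
          rw [hyx, map_smul, norm_smul, Real.norm_of_nonneg ht.le, smul_eq_mul]
          calc ε * (r / R * ‖w‖) = r / R * (ε * ‖w‖) := by ring
            _ < r / R * c w := by gcongr
      have h3 := measure_mono (μ := volume) hsub
      rw [volume_ball_scale _ x (by positivity) hr] at h3
      rwa [ENNReal.le_div_iff_mul_le (Or.inl (volume_ball_pos x hr))
        (Or.inl (volume_ball_ne_top x r))]
    have : κ ≤ 0 := ge_of_tendsto hA (by
      filter_upwards [self_mem_nhdsWithin] with r hr using hlow r hr)
    exact absurd this (not_le.2 hκ)
  ext v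
  have h1 := main v
  have h2 := main (-v)
  rw [map_neg] at h2
  simp only [zero_apply]
  linarith

/-- Chebyshev's inequality on each ball: the share of {F > ε} is at most ε⁻¹ times the mean of F. -/
lemma eventually_le_of_tendsto_lintegral {x : E} {F : E → ℝ≥0∞} (hF : AEMeasurable F volume)
    (h : Tendsto (fun r : ℝ => (∫⁻ y in ball x r, F y) / volume (ball x r)) (𝓝[>] 0) (𝓝 0))
    {ε : ℝ≥0∞} (hε : ε ≠ 0) (hε' : ε ≠ ⊤) : ∀ᶠ y in densityFilter x, F y ≤ ε := by
  rw [Filter.Eventually, mem_densityFilter]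
  have h2 : Tendsto (fun r : ℝ => ε⁻¹ * ((∫⁻ y in ball x r, F y) / volume (ball x r))) (𝓝[>] 0)
      (𝓝 (ε⁻¹ * 0)) := ENNReal.Tendsto.const_mul h (Or.inr (ENNReal.inv_ne_top.2 hε))
  rw [mul_zero] at h2
  refine tendsto_of_tendsto_of_tendsto_of_le_of_le tendsto_const_nhds h2 (fun _ => zero_le) ?_
  intro r
  change _ ≤ ε⁻¹ * _
  rw [← mul_div_assoc]
  refine ENNReal.div_le_div_right ?_ _
  have h3 := mul_meas_ge_le_lintegral₀ (hF.restrict (s := ball x r)) ε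
  rw [mul_comm, ← div_eq_mul_inv, ENNReal.le_div_iff_mul_le (Or.inl hε) (Or.inl hε'), mul_comm]
  refine le_trans ?_ h3
  refine mul_le_mul_right ?_ _
  rw [Measure.restrict_apply₀' measurableSet_ball.nullMeasurableSet]
  refine measure_mono ?_
  intro y hy
  have h4 : ¬ F y ≤ ε := hy.2
  exact ⟨show ε ≤ F y from (not_le.1 h4).le, hy.1⟩

end ApproxCalc

/-! ### Increments of Sobolev functions along segments -/

namespace ApproxCalc

open MeasureTheory Filter Topology Metric
open scoped ENNReal

variable {n : ℕ}

local notation "E" => EuclideanSpace ℝ (Fin n)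

/-- The measurable function `U` on `ℝⁿ` is integrable and has integrable weak derivatives `V`. -/
structure IsW11 (U : EuclideanSpace ℝ (Fin n) → ℝ)
    (V : Fin n → EuclideanSpace ℝ (Fin n) → ℝ) : Prop where
  integrable : Integrable U
  integrable_deriv : ∀ j, Integrable (V j)
  integral_eq : ∀ j (χ : EuclideanSpace ℝ (Fin n) → ℝ), ContDiff ℝ (⊤ : ℕ∞) χ →
    HasCompactSupport χ →
    ∫ x, U x * fderiv ℝ χ x (EuclideanSpace.single j 1) = - ∫ x, V j x * χ x

lemma IsW11.congr {U U' : E → ℝ} {V V' : Fin n → E → ℝ} (h : IsW11 U V) (hU : U =ᵐ[volume] U')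
    (hV : ∀ j, V j =ᵐ[volume] V' j) : IsW11 U' V' := by
  refine ⟨h.integrable.congr hU, fun j => (h.integrable_deriv j).congr (hV j), ?_⟩
  intro j χ hχ hc
  have h1 : ∫ x, U' x * fderiv ℝ χ x (EuclideanSpace.single j 1) =
      ∫ x, U x * fderiv ℝ χ x (EuclideanSpace.single j 1) := by
    refine integral_congr_ae ?_
    filter_upwards [hU] with x hx
    rw [hx]
  have h2 : ∫ x, V' j x * χ x = ∫ x, V j x * χ x := by
    refine integral_congr_ae ?_
    filter_upwards [hV j] with x hx
    rw [hx]
  rw [h1, h2, h.integral_eq j χ hχ hc]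

lemma continuous_fderiv_apply {χ : E → ℝ} (hχ : ContDiff ℝ (⊤ : ℕ∞) χ) (v : E) :
    Continuous fun x => fderiv ℝ χ x v :=
  (hχ.continuous_fderiv (by simp)).clm_apply continuous_const

lemma hasCompactSupport_fderiv_apply {χ : E → ℝ} (hc : HasCompactSupport χ) (v : E) :
    HasCompactSupport fun x => fderiv ℝ χ x v :=
  (hc.fderiv ℝ).comp_left (g := fun L : E →L[ℝ] ℝ => L v) rfl

lemma integrable_mul_of_locallyIntegrableOn {Ω : Set E} {u ζ : E → ℝ}
    (hu : LocallyIntegrableOn u Ω) (hζ : Continuous ζ) (hc : HasCompactSupport ζ)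
    (hs : tsupport ζ ⊆ Ω) : Integrable fun x => ζ x * u x := by
  rw [← integrableOn_iff_integrable_of_support_subset (s := tsupport ζ)]
  · exact IntegrableOn.continuousOn_mul hζ.continuousOn (hu.integrableOn_compact_subset hs hc) hc
  · intro x hx
    refine subset_tsupport _ ?_
    intro h
    exact hx (by simp [h])

/-- The Leibniz rule, obtained by testing the weak derivative of u with ζχ, which is supported in Ω
for every test function χ on the whole space. -/
lemma isW11_cutoff {Ω : Set E} {u : E → ℝ} {v : Fin n → E → ℝ}
    (hw : ∀ j, QValued.HasWeakPartialDeriv Ω j u (v j)) {ζ : E → ℝ}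
    (hζ : ContDiff ℝ (⊤ : ℕ∞) ζ) (hc : HasCompactSupport ζ) (hs : tsupport ζ ⊆ Ω)
    (hu : LocallyIntegrableOn u Ω) :
    IsW11 (fun x => ζ x * u x)
      (fun j x => ζ x * v j x + fderiv ℝ ζ x (EuclideanSpace.single j 1) * u x) := by
  have hI1 : Integrable fun x => ζ x * u x :=
    integrable_mul_of_locallyIntegrableOn hu hζ.continuous hc hs
  have hI2 : ∀ j, Integrable fun x => fderiv ℝ ζ x (EuclideanSpace.single j 1) * u x := fun j =>
    integrable_mul_of_locallyIntegrableOn hu (continuous_fderiv_apply hζ _)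
      (hasCompactSupport_fderiv_apply hc _)
      ((closure_mono (by
        intro x hx h
        exact hx (by simp [h]))).trans ((tsupport_fderiv_subset ℝ).trans hs))
  have hI3 : ∀ j, Integrable fun x => ζ x * v j x := fun j =>
    integrable_mul_of_locallyIntegrableOn (hw j).2.1 hζ.continuous hc hs
  refine ⟨hI1, fun j => (hI3 j).add (hI2 j), ?_⟩
  intro j χ hχ hcχ
  set e : E := EuclideanSpace.single j 1
  have hbχ : ∃ C, ∀ x, ‖χ x‖ ≤ C := hcχ.exists_bound_of_continuous hχ.continuous
  have hbχ' : ∃ C, ∀ x, ‖fderiv ℝ χ x e‖ ≤ C :=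
    (hasCompactSupport_fderiv_apply hcχ e).exists_bound_of_continuous
      (continuous_fderiv_apply hχ e)
  obtain ⟨C, hC⟩ := hbχ
  obtain ⟨C', hC'⟩ := hbχ'
  have hJ1 : Integrable fun x => fderiv ℝ χ x e * (ζ x * u x) :=
    hI1.bdd_mul (continuous_fderiv_apply hχ e).aestronglyMeasurable (ae_of_all _ hC')
  have hJ2 : Integrable fun x => χ x * (fderiv ℝ ζ x e * u x) :=
    (hI2 j).bdd_mul hχ.continuous.aestronglyMeasurable (ae_of_all _ hC)
  have hJ3 : Integrable fun x => χ x * (ζ x * v j x) :=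
    (hI3 j).bdd_mul hχ.continuous.aestronglyMeasurable (ae_of_all _ hC)
  have hsub : tsupport (fun x => ζ x * χ x) ⊆ Ω := (tsupport_mul_subset_left).trans hs
  have hzero : ∀ x ∉ Ω, ζ x = 0 := fun x hx => image_eq_zero_of_notMem_tsupport fun h => hx (hs h)
  have hzero' : ∀ x ∉ Ω, fderiv ℝ ζ x = 0 := fun x hx =>
    image_eq_zero_of_notMem_tsupport fun h => hx (hs (tsupport_fderiv_subset ℝ h))
  have key := (hw j).2.2 (fun x => ζ x * χ x) (hζ.mul hχ) (hc.mul_right) hsub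
  have hder : ∀ x, fderiv ℝ (fun x => ζ x * χ x) x e =
      ζ x * fderiv ℝ χ x e + χ x * fderiv ℝ ζ x e := by
    intro x
    rw [fderiv_fun_mul (hζ.differentiable (by simp) x) (hχ.differentiable (by simp) x)]
    simp
  rw [setIntegral_eq_integral_of_forall_compl_eq_zero, setIntegral_eq_integral_of_forall_compl_eq_zero] at key
  · have e1 : ∫ x, u x * fderiv ℝ (fun x => ζ x * χ x) x e =
        (∫ x, fderiv ℝ χ x e * (ζ x * u x)) + ∫ x, χ x * (fderiv ℝ ζ x e * u x) := by
      rw [← integral_add hJ1 hJ2]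
      refine integral_congr_ae (ae_of_all _ fun x => ?_)
      simp only [hder]; ring
    have e2 : ∫ x, (ζ x * v j x + fderiv ℝ ζ x e * u x) * χ x =
        (∫ x, χ x * (ζ x * v j x)) + ∫ x, χ x * (fderiv ℝ ζ x e * u x) := by
      rw [← integral_add hJ3 hJ2]
      refine integral_congr_ae (ae_of_all _ fun x => ?_)
      simp only; ring
    have e3 : ∫ x, v j x * (ζ x * χ x) = ∫ x, χ x * (ζ x * v j x) := by
      refine integral_congr_ae (ae_of_all _ fun x => ?_)
      simp only; ring
    have e4 : ∫ x, ζ x * u x * fderiv ℝ χ x e = ∫ x, fderiv ℝ χ x e * (ζ x * u x) := by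
      refine integral_congr_ae (ae_of_all _ fun x => ?_)
      simp only; ring
    rw [e4, e2]
    rw [e1, e3] at key
    linarith
  · intro x hx
    simp [hzero x hx]
  · intro x hx
    rw [hder, hzero x hx, hzero' x hx]
    simp

/-- Lebesgue measure on `(0, 1]`. -/
noncomputable abbrev unitMeasure : Measure ℝ := volume.restrict (Set.Ioc 0 1)

lemma integrable_translate {V : E → ℝ} (hV : Integrable V) (hm : Measurable V) (z : E) :
    Integrable (fun p : E × ℝ => V (p.1 + p.2 • z)) (volume.prod unitMeasure) := by
  rw [integrable_prod_iff' (by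
    apply Measurable.aestronglyMeasurable
    exact hm.comp (by fun_prop))]
  refine ⟨ae_of_all _ fun t => by simpa using hV.comp_add_right (t • z), ?_⟩
  have : ∀ t : ℝ, ∫ x, ‖V (x + t • z)‖ = ∫ x, ‖V x‖ := fun t =>
    integral_add_right_eq_self (fun x => ‖V x‖) (t • z)
  simp only [this]
  exact integrable_const _

lemma fderiv_apply_eq_sum (L : E →L[ℝ] ℝ) (z : E) :
    L z = ∑ j, z j * L (EuclideanSpace.single j 1) := by
  conv_lhs => rw [← (EuclideanSpace.basisFun (Fin n) ℝ).sum_repr z]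
  simp

/-- The fundamental theorem of calculus along the fixed vector z, by duality. Paired with a test
function χ, both sides become integrals of U against translates of χ and of its derivative; Fubini
in t and the classical theorem for t ↦ χ (x - t z) then identify them. -/
lemma IsW11.ae_sub_eq {U : E → ℝ} {V : Fin n → E → ℝ} (h : IsW11 U V)
    (hV : ∀ j, Measurable (V j)) (z : E) :
    ∀ᵐ x, (∀ j, Integrable (fun t : ℝ => V j (x + t • z)) unitMeasure) ∧
      U (x + z) - U x = ∫ t, ∑ j, V j (x + t • z) * z j ∂unitMeasure := by
  have hP : ∀ j, Integrable (fun p : E × ℝ => V j (p.1 + p.2 • z)) (volume.prod unitMeasure) :=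
    fun j => integrable_translate (h.integrable_deriv j) (hV j) z
  have hS : Integrable (fun p : E × ℝ => ∑ j, V j (p.1 + p.2 • z) * z j)
      (volume.prod unitMeasure) := integrable_finsetSum _ fun j _ => (hP j).mul_const _
  have hZ : Integrable (fun x => ∫ t, ∑ j, V j (x + t • z) * z j ∂unitMeasure) :=
    hS.integral_prod_left
  have hzero : ∀ᵐ x, (U (x + z) - U x) - ∫ t, ∑ j, V j (x + t • z) * z j ∂unitMeasure = 0 := by
    apply ae_eq_zero_of_integral_contDiff_smul_eq_zero
    · exact (((h.integrable.comp_add_right z).sub h.integrable).sub hZ).locallyIntegrable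
    intro χ hχ hc
    simp only [smul_eq_mul]
    obtain ⟨C, hC⟩ := hc.exists_bound_of_continuous hχ.continuous
    obtain ⟨C', hC'⟩ := (hasCompactSupport_fderiv_apply hc z).exists_bound_of_continuous
      (continuous_fderiv_apply hχ z)
    have hI1 : Integrable fun x => χ x * U (x + z) :=
      (h.integrable.comp_add_right z).bdd_mul hχ.continuous.aestronglyMeasurable (ae_of_all _ hC)
    have hI2 : Integrable fun x => χ x * U x :=
      h.integrable.bdd_mul hχ.continuous.aestronglyMeasurable (ae_of_all _ hC)
    have hI3 : Integrable fun x => χ x * ∫ t, ∑ j, V j (x + t • z) * z j ∂unitMeasure :=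
      hZ.bdd_mul hχ.continuous.aestronglyMeasurable (ae_of_all _ hC)
    have hI4 : Integrable fun x => χ (x - z) * U x :=
      h.integrable.bdd_mul (hχ.continuous.comp (by fun_prop)).aestronglyMeasurable
        (ae_of_all _ fun x => hC _)
    have split : ∫ x, χ x * (U (x + z) - U x - ∫ t, ∑ j, V j (x + t • z) * z j ∂unitMeasure) =
        (∫ x, χ x * U (x + z)) - (∫ x, χ x * U x) -
          ∫ x, χ x * ∫ t, ∑ j, V j (x + t • z) * z j ∂unitMeasure := by
      have hI12 : Integrable fun x => χ x * U (x + z) - χ x * U x := hI1.sub hI2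
      rw [← integral_sub hI1 hI2, ← integral_sub hI12 hI3]
      congr 1; ext x; ring
    have e1 : ∫ x, χ x * U (x + z) = ∫ x, χ (x - z) * U x := by
      rw [← integral_sub_right_eq_self (fun x => χ x * U (x + z)) z]
      simp
    have e2 : ∫ x, χ x * ∫ t, ∑ j, V j (x + t • z) * z j ∂unitMeasure =
        ∫ t, (∫ x, χ x * ∑ j, V j (x + t • z) * z j) ∂unitMeasure := by
      simp_rw [← integral_const_mul]
      refine integral_integral_swap ?_
      exact hS.bdd_mul (hχ.continuous.comp continuous_fst).aestronglyMeasurable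
        (ae_of_all _ fun p => hC _)
    have e3 : ∀ t : ℝ, ∫ x, χ x * ∑ j, V j (x + t • z) * z j =
        - ∫ x, U x * fderiv ℝ χ (x - t • z) z := by
      intro t
      set χt : E → ℝ := fun x => χ (x - t • z)
      have hχt : ContDiff ℝ (⊤ : ℕ∞) χt := hχ.comp (by fun_prop)
      have hct : HasCompactSupport χt :=
        hc.comp_homeomorph (Homeomorph.subRight (t • z))
      have hfd : ∀ x, fderiv ℝ χt x = fderiv ℝ χ (x - t • z) := by
        intro x
        exact fderiv_comp_sub (t • z)
      obtain ⟨C2, hC2⟩ := hct.exists_bound_of_continuous hχt.continuous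
      have hIj : ∀ j, Integrable fun x => V j x * χt x := fun j => by
        simpa only [mul_comm] using (h.integrable_deriv j).bdd_mul
          hχt.continuous.aestronglyMeasurable (ae_of_all _ hC2)
      have hIj' : ∀ j, Integrable fun x => U x * fderiv ℝ χt x (EuclideanSpace.single j 1) := by
        intro j
        obtain ⟨C3, hC3⟩ := (hasCompactSupport_fderiv_apply hct
          (EuclideanSpace.single j 1)).exists_bound_of_continuous (continuous_fderiv_apply hχt _)
        simpa only [mul_comm] using h.integrable.bdd_mul
          (continuous_fderiv_apply hχt _).aestronglyMeasurable (ae_of_all _ hC3)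
      calc ∫ x, χ x * ∑ j, V j (x + t • z) * z j
          = ∫ x, χ (x - t • z) * ∑ j, V j x * z j := by
            rw [← integral_sub_right_eq_self (fun x => χ x * ∑ j, V j (x + t • z) * z j) (t • z)]
            simp
        _ = ∫ x, ∑ j, z j * (V j x * χt x) := by
            congr 1; ext x; rw [Finset.mul_sum]
            refine Finset.sum_congr rfl fun j _ => ?_
            simp only [χt]; ring
        _ = ∑ j, z j * ∫ x, V j x * χt x := by
            rw [integral_finsetSum _ fun j _ => (hIj j).const_mul _]
            simp_rw [integral_const_mul]
        _ = - ∑ j, z j * ∫ x, U x * fderiv ℝ χt x (EuclideanSpace.single j 1) := by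
            rw [← Finset.sum_neg_distrib]
            refine Finset.sum_congr rfl fun j _ => ?_
            rw [h.integral_eq j χt hχt hct]; ring
        _ = - ∫ x, ∑ j, z j * (U x * fderiv ℝ χt x (EuclideanSpace.single j 1)) := by
            rw [integral_finsetSum _ fun j _ => (hIj' j).const_mul _]
            simp_rw [integral_const_mul]
        _ = _ := by
            congr 2; ext x
            rw [fderiv_apply_eq_sum (fderiv ℝ χ (x - t • z)) z, Finset.mul_sum, ← hfd]
            refine Finset.sum_congr rfl fun j _ => ?_
            ring
    have e4 : ∫ t, (∫ x, U x * fderiv ℝ χ (x - t • z) z) ∂unitMeasure =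
        ∫ x, U x * ∫ t, fderiv ℝ χ (x - t • z) z ∂unitMeasure := by
      simp_rw [← integral_const_mul]
      refine (integral_integral_swap ?_).symm
      have h5 : Integrable (fun p : E × ℝ => U p.1) (volume.prod unitMeasure) :=
        h.integrable.comp_fst unitMeasure
      refine (h5.bdd_mul (f := fun p : E × ℝ => fderiv ℝ χ (p.1 - p.2 • z) z)
        (((continuous_fderiv_apply hχ z).comp (by fun_prop)).aestronglyMeasurable)
        (ae_of_all _ fun p => hC' _)).congr (ae_of_all _ fun p => ?_)
      simp only [Function.uncurry]; ring
    have e5 : ∀ x, ∫ t, fderiv ℝ χ (x - t • z) z ∂unitMeasure = χ x - χ (x - z) := by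
      intro x
      rw [← intervalIntegral.integral_of_le zero_le_one]
      have hd : ∀ t ∈ Set.uIcc (0:ℝ) 1, HasDerivAt (fun t : ℝ => - χ (x - t • z))
          (fderiv ℝ χ (x - t • z) z) t := by
        intro t _
        have h1 : HasDerivAt (fun t : ℝ => x - t • z) (-z) t := by
          simpa using ((hasDerivAt_id t).smul_const z).const_sub x
        have h2 := ((hχ.differentiable (by simp) (x - t • z)).hasFDerivAt).comp_hasDerivAt t h1
        exact h2.neg.congr_deriv (by simp)
      rw [intervalIntegral.integral_eq_sub_of_hasDerivAt hd]
      · simp; ring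
      · exact ((continuous_fderiv_apply hχ z).comp (by fun_prop)).intervalIntegrable _ _
    rw [split, e1, e2]
    simp_rw [e3]
    rw [integral_neg, e4]
    simp_rw [e5]
    have e6 : ∫ x, U x * (χ x - χ (x - z)) = (∫ x, χ x * U x) - ∫ x, χ (x - z) * U x := by
      rw [← integral_sub hI2 hI4]
      congr 1; ext x; ring
    rw [e6]; ring
  have hint : ∀ᵐ x, ∀ j, Integrable (fun t : ℝ => V j (x + t • z)) unitMeasure :=
    ae_all_iff.2 fun j => (hP j).prod_right_ae
  filter_upwards [hzero, hint] with x hx hx'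
  exact ⟨hx', sub_eq_zero.1 hx⟩

/-- Fubini exchanges the two quantifiers, so that almost every base point x admits almost every
increment z. Measurable representatives are required because the exceptional set must be measurable
in (x, z). -/
lemma IsW11.ae_ae_sub_eq {U : E → ℝ} {V : Fin n → E → ℝ} (h : IsW11 U V) (hU : Measurable U)
    (hV : ∀ j, Measurable (V j)) :
    ∀ᵐ x, ∀ᵐ z, (∀ j, Integrable (fun t : ℝ => V j (x + t • z)) unitMeasure) ∧
      U (x + z) - U x = ∫ t, ∑ j, V j (x + t • z) * z j ∂unitMeasure := by
  rw [Measure.ae_ae_comm]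
  · exact ae_of_all _ fun z => h.ae_sub_eq hV z
  refine MeasurableSet.inter (s₁ := {p : E × E | ∀ j, Integrable
    (fun t : ℝ => V j (p.1 + t • p.2)) unitMeasure}) (s₂ := {p : E × E | U (p.1 + p.2) - U p.1 =
      ∫ t, ∑ j, V j (p.1 + t • p.2) * p.2 j ∂unitMeasure}) ?_ ?_
  · have : {p : E × E | ∀ j, Integrable (fun t : ℝ => V j (p.1 + t • p.2)) unitMeasure} =
        ⋂ j, {p : E × E | Integrable (fun t : ℝ => V j (p.1 + t • p.2)) unitMeasure} := by
      ext p; simp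
    rw [this]
    refine MeasurableSet.iInter fun j => measurableSet_integrable ?_
    apply Measurable.stronglyMeasurable
    exact (hV j).comp (by fun_prop)
  · refine measurableSet_eq_fun (by fun_prop) ?_
    apply StronglyMeasurable.measurable
    apply StronglyMeasurable.integral_prod_right
    apply Measurable.stronglyMeasurable
    refine Finset.measurable_sum _ fun j _ => ?_
    exact ((hV j).comp (g := V j) (f := fun q : (E × E) × ℝ => q.1.1 + q.2 • q.1.2)
      (by fun_prop)).mul (by fun_prop)

end ApproxCalc

/-! ### Approximate differentiability of Sobolev functions -/

namespace ApproxCalc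

open MeasureTheory Filter Topology Metric
open scoped ENNReal

variable {n : ℕ}

local notation "E" => EuclideanSpace ℝ (Fin n)

lemma setLIntegral_ball_translate (F : E → ℝ≥0∞) (x : E) (r : ℝ) :
    ∫⁻ z in ball (0 : E) r, F (x + z) = ∫⁻ y in ball x r, F y := by
  rw [← lintegral_indicator measurableSet_ball, ← lintegral_indicator measurableSet_ball,
    ← lintegral_add_left_eq_self (fun y => (ball x r).indicator F y) x]
  congr 1
  ext z
  simp only [Set.indicator, mem_ball, dist_eq_norm, sub_zero, add_sub_cancel_left]

lemma setLIntegral_ball_dilate {F : E → ℝ≥0∞} (hF : Measurable F) {r t : ℝ} (ht : 0 < t) :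
    ∫⁻ z in ball (0 : E) r, F (t • z) =
      ENNReal.ofReal ((t ^ n)⁻¹) * ∫⁻ y in ball (0 : E) (t * r), F y := by
  have h1 := lintegral_map (μ := (volume : Measure E))
    (hF.indicator (measurableSet_ball (x := (0 : E)) (ε := t * r)))
    (measurable_const_smul (α := E) t)
  rw [Measure.map_addHaar_smul _ ht.ne', lintegral_smul_measure, finrank_euclideanSpace_fin,
    abs_of_pos (by positivity), lintegral_indicator measurableSet_ball, smul_eq_mul] at h1
  rw [h1, ← lintegral_indicator measurableSet_ball]
  congr 1
  ext z
  simp only [Set.indicator, mem_ball, dist_eq_norm, sub_zero, norm_smul, Real.norm_of_nonneg ht.le,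
    mul_lt_mul_iff_right₀ ht]

/-- Averages along segments issuing from `x` are controlled by the averages over balls. -/
lemma lintegral_segment_le {G : E → ℝ≥0∞} (hG : Measurable G) {x : E} {r : ℝ} {M : ℝ≥0∞}
    (hr : 0 < r) (h : ∀ ρ, 0 < ρ → ρ ≤ r → ∫⁻ y in ball x ρ, G y ≤ M * volume (ball x ρ)) :
    ∫⁻ z in ball (0 : E) r, ∫⁻ t, G (x + t • z) ∂unitMeasure ≤ M * volume (ball x r) := by
  have hm : Measurable (Function.uncurry fun (z : E) (t : ℝ) => G (x + t • z)) :=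
    hG.comp (g := G) (f := fun p : E × ℝ => x + p.2 • p.1) (by fun_prop)
  rw [lintegral_lintegral_swap hm.aemeasurable]
  calc ∫⁻ t, ∫⁻ z in ball (0 : E) r, G (x + t • z) ∂volume ∂unitMeasure
      ≤ ∫⁻ _t, M * volume (ball x r) ∂unitMeasure := by
        refine setLIntegral_mono' measurableSet_Ioc fun t ht => ?_
        rw [setLIntegral_ball_dilate (F := fun w => G (x + w)) (by fun_prop) ht.1,
          setLIntegral_ball_translate G x]
        have h1 := h (t * r) (mul_pos ht.1 hr) (by nlinarith [ht.2])
        rw [volume_ball_scale x x ht.1 hr] at h1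
        calc ENNReal.ofReal ((t ^ n)⁻¹) * ∫⁻ y in ball x (t * r), G y
            ≤ ENNReal.ofReal ((t ^ n)⁻¹) * (M * (ENNReal.ofReal (t ^ n) * volume (ball x r))) := by
              gcongr
          _ = (ENNReal.ofReal ((t ^ n)⁻¹) * ENNReal.ofReal (t ^ n)) *
                (M * volume (ball x r)) := by ring
          _ = M * volume (ball x r) := by
              rw [← ENNReal.ofReal_mul (by have := ht.1; positivity),
                inv_mul_cancel₀ (pow_pos ht.1 n).ne']
              simp
    _ = M * volume (ball x r) := by simp

lemma closedBall_ae_eq_ball (x : E) {r : ℝ} (hr : 0 < r) :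
    (closedBall x r : Set E) =ᵐ[volume] ball x r := by
  have h0 : volume (sphere x r) = 0 := Measure.addHaar_sphere_of_ne_zero _ _ hr.ne'
  rw [← ball_union_sphere]
  exact union_ae_eq_left_of_ae_eq_empty (ae_eq_empty.2 h0)

lemma ae_tendsto_lintegral_ball_div {G : E → ℝ≥0∞} (hG : AEMeasurable G volume)
    (hfin : ∫⁻ y, G y ≠ ⊤) : ∀ᵐ x : E, Tendsto
      (fun r : ℝ => (∫⁻ y in ball x r, G y) / volume (ball x r)) (𝓝[>] 0) (𝓝 (G x)) := by
  filter_upwards [(Besicovitch.vitaliFamily (volume : Measure E)).ae_tendsto_lintegral_div hG hfin]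
    with x hx
  refine (hx.comp (Besicovitch.tendsto_filterAt volume x)).congr' ?_
  filter_upwards [self_mem_nhdsWithin] with r hr
  simp only [Function.comp]
  rw [measure_congr (closedBall_ae_eq_ball x hr), setLIntegral_congr (closedBall_ae_eq_ball x hr)]

lemma ae_tendsto_lintegral_ball_sub_div {f : E → ℝ} (hf : Integrable f) : ∀ᵐ x : E, Tendsto
      (fun r : ℝ => (∫⁻ y in ball x r, ‖f y - f x‖ₑ) / volume (ball x r)) (𝓝[>] 0) (𝓝 0) := by
  filter_upwards [(Besicovitch.vitaliFamily (volume : Measure E)).ae_tendsto_lintegral_enorm_sub_div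
    hf.locallyIntegrable] with x hx
  refine (hx.comp (Besicovitch.tendsto_filterAt volume x)).congr' ?_
  filter_upwards [self_mem_nhdsWithin] with r hr
  simp only [Function.comp]
  rw [measure_congr (closedBall_ae_eq_ball x hr), setLIntegral_congr (closedBall_ae_eq_ball x hr)]

/-- `a` is the approximate gradient of `u` at `x`. -/
def HasApproxGradAt (u : EuclideanSpace ℝ (Fin n) → ℝ) (a : Fin n → ℝ)
    (x : EuclideanSpace ℝ (Fin n)) : Prop :=
  ∀ ε : ℝ, 0 < ε → ∀ᶠ y in densityFilter x, |u y - u x - ∑ j, a j * (y - x) j| ≤ ε * ‖y - x‖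

lemma enorm_integral_segment_le {V : Fin n → E → ℝ} (a : Fin n → ℝ) (x z : E)
    (hi : ∀ j, Integrable (fun t : ℝ => V j (x + t • z)) unitMeasure) :
    ‖(∫ t, ∑ j, V j (x + t • z) * z j ∂unitMeasure) - ∑ j, a j * z j‖ₑ ≤
      (∫⁻ t, ∑ j, ‖V j (x + t • z) - a j‖ₑ ∂unitMeasure) * ‖z‖ₑ := by
  have h1 : (∫ t, ∑ j, V j (x + t • z) * z j ∂unitMeasure) - ∑ j, a j * z j =
      ∫ t, ∑ j, (V j (x + t • z) - a j) * z j ∂unitMeasure := by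
    have h2 : ∑ j, a j * z j = ∫ _t, ∑ j, a j * z j ∂unitMeasure := by simp
    rw [h2, ← integral_sub (integrable_finsetSum _ fun j _ => (hi j).mul_const _)
      (integrable_const _)]
    simp_rw [← Finset.sum_sub_distrib, sub_mul]
  rw [h1]
  refine (enorm_integral_le_lintegral_enorm _).trans ?_
  rw [← lintegral_mul_const' _ _ enorm_ne_top]
  refine lintegral_mono fun t => ?_
  refine (enorm_sum_le _ _).trans ?_
  rw [Finset.sum_mul]
  refine Finset.sum_le_sum fun j _ => ?_
  rw [enorm_mul]
  gcongr
  rw [← ofReal_norm, ← ofReal_norm]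
  exact ENNReal.ofReal_le_ofReal (PiLp.norm_apply_le z j)

/-- At a Lebesgue point of the weak gradient, the error quotient at x + z is at most the average of
|V - V(x)| along the segment. Averaged over a ball, segment averages are controlled by ball
averages, which tend to zero; Chebyshev turns this into an approximate limit. -/
lemma IsW11.ae_hasApproxGradAt {U : E → ℝ} {V : Fin n → E → ℝ} (h : IsW11 U V)
    (hU : Measurable U) (hV : ∀ j, Measurable (V j)) :
    ∀ᵐ x, HasApproxGradAt U (fun j => V j x) x := by
  filter_upwards [h.ae_ae_sub_eq hU hV,
    ae_all_iff.2 fun j => ae_tendsto_lintegral_ball_sub_div (h.integrable_deriv j)] with x hx hL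
  set a : Fin n → ℝ := fun j => V j x with ha
  set G : E → ℝ≥0∞ := fun y => ∑ j, ‖V j y - a j‖ₑ with hGdef
  have hG : Measurable G := Finset.measurable_sum _ fun j _ => ((hV j).sub_const _).enorm
  have hGlim : Tendsto (fun r : ℝ => (∫⁻ y in ball x r, G y) / volume (ball x r)) (𝓝[>] 0)
      (𝓝 0) := by
    have h1 := tendsto_finsetSum Finset.univ fun j _ => hL j
    simp only [Finset.sum_const_zero] at h1
    refine h1.congr fun r => ?_
    simp only [hGdef]
    rw [lintegral_finsetSum _ fun j _ => ((hV j).sub_const _).enorm]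
    simp only [div_eq_mul_inv, Finset.sum_mul]
    rfl
  set F : E → ℝ≥0∞ := fun y => ‖U y - U x - ∑ j, a j * (y - x) j‖ₑ / ‖y - x‖ₑ with hFdef
  have hF : Measurable F := by
    refine Measurable.div ?_ (by fun_prop)
    refine Measurable.enorm ?_
    refine (hU.sub_const _).sub ?_
    fun_prop
  -- At z = 0 the quotient is 0 / 0, which is harmless since zero denominators satisfy the division
  -- bound used here.
  have hFz : ∀ᵐ z : E, F (x + z) ≤ ∫⁻ t, G (x + t • z) ∂unitMeasure := by
    filter_upwards [hx] with z hz
    refine ENNReal.div_le_of_le_mul ?_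
    simp only [add_sub_cancel_left]
    rw [hz.2]
    exact enorm_integral_segment_le a x z hz.1
  have hFlim : Tendsto (fun r : ℝ => (∫⁻ y in ball x r, F y) / volume (ball x r)) (𝓝[>] 0)
      (𝓝 0) := by
    rw [ENNReal.tendsto_nhds_zero] at hGlim ⊢
    intro η hη
    have h1 := hGlim η hη
    rw [eventually_nhdsWithin_iff, Metric.eventually_nhds_iff] at h1
    obtain ⟨δ, hδ, h1⟩ := h1
    filter_upwards [Ioo_mem_nhdsGT hδ] with r hr
    refine ENNReal.div_le_of_le_mul ?_
    rw [← setLIntegral_ball_translate]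
    refine (lintegral_mono_ae (ae_restrict_of_ae hFz)).trans ?_
    refine lintegral_segment_le hG hr.1 fun ρ hρ hρr => ?_
    have h2 := h1 (y := ρ) (by
      rw [Real.dist_eq, sub_zero, abs_of_pos hρ]; exact hρr.trans_lt hr.2) hρ
    rwa [ENNReal.div_le_iff (volume_ball_pos x hρ) (volume_ball_ne_top x ρ)] at h2
  intro ε hε
  have h3 := eventually_le_of_tendsto_lintegral hF.aemeasurable hFlim
    (ε := ENNReal.ofReal ε) (by simpa using hε) ENNReal.ofReal_ne_top
  filter_upwards [h3] with y hy
  by_cases hyx : y = x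
  · subst hyx; simp
  have h4 : ‖y - x‖ₑ ≠ 0 := by simpa [sub_eq_zero] using hyx
  simp only [hFdef] at hy
  rw [ENNReal.div_le_iff h4 enorm_ne_top, ← ofReal_norm, ← ofReal_norm,
    ← ENNReal.ofReal_mul hε.le, ENNReal.ofReal_le_ofReal_iff (by positivity)] at hy
  exact hy

lemma eventually_densityFilter_of_ae_restrict {B : Set E} (hB : IsOpen B) {x : E} (hx : x ∈ B)
    {p : E → Prop} (h : ∀ᵐ y ∂(volume.restrict B), p y) : ∀ᶠ y in densityFilter x, p y := by
  have h1 : volume (B \ {y | p y}) = 0 := by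
    rw [ae_restrict_iff' hB.measurableSet, ae_iff] at h
    refine measure_mono_null ?_ h
    intro y hy
    have h2 := hy.2
    exact fun h3 => h2 (h3 hy.1)
  obtain ⟨ε, hε, hb⟩ := Metric.isOpen_iff.1 hB x hx
  rw [Filter.Eventually, mem_densityFilter]
  refine tendsto_const_nhds.congr' ?_
  filter_upwards [Ioo_mem_nhdsGT hε] with r hr
  have : volume (ball x r \ {y | p y}) = 0 :=
    measure_mono_null (Set.sdiff_subset_sdiff_left ((ball_subset_ball hr.2.le).trans hb)) h1
  rw [this]; simp

lemma HasApproxGradAt.congr {u U : E → ℝ} {a : Fin n → ℝ} {x : E} (h : HasApproxGradAt U a x)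
    (hx : U x = u x) (he : ∀ᶠ y in densityFilter x, U y = u y) : HasApproxGradAt u a x := by
  intro ε hε
  filter_upwards [h ε hε, he] with y h1 h2
  rwa [← h2, ← hx]

/-- Near a point of `Ω`, a weakly differentiable function agrees with a measurable function of
class `W^{1,1}(ℝⁿ)`. -/
lemma exists_isW11_local {Ω : Set E} {u : E → ℝ} {v : Fin n → E → ℝ}
    (hw : ∀ j, QValued.HasWeakPartialDeriv Ω j u (v j)) (hu : LocallyIntegrableOn u Ω)
    {x₁ : E} {R : ℝ} (hR : 0 < R) (hB : closedBall x₁ (3 * R) ⊆ Ω) :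
    ∃ (U : E → ℝ) (V : Fin n → E → ℝ), IsW11 U V ∧ Measurable U ∧ (∀ j, Measurable (V j)) ∧
      (∀ᵐ x ∂(volume.restrict (ball x₁ (2 * R))), U x = u x ∧ ∀ j, V j x = v j x) := by
  -- The cutoff is 1 on the ball of radius 2R, which contains every segment of length less than R
  -- issuing from the ball of radius R.
  let ζ : ContDiffBump x₁ := ⟨2 * R, 3 * R, by positivity, by linarith⟩
  have hs : tsupport ζ ⊆ Ω := by rw [ζ.tsupport_eq]; exact hB
  have h := isW11_cutoff hw ζ.contDiff ζ.hasCompactSupport hs hu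
  set U := h.integrable.1.mk _
  set V := fun j => (h.integrable_deriv j).1.mk _
  have hUm : Measurable U := (h.integrable.1.stronglyMeasurable_mk).measurable
  have hVm : ∀ j, Measurable (V j) := fun j =>
    ((h.integrable_deriv j).1.stronglyMeasurable_mk).measurable
  have hU := h.integrable.1.ae_eq_mk
  have hV := fun j => (h.integrable_deriv j).1.ae_eq_mk
  refine ⟨U, V, h.congr hU hV, hUm, hVm, ?_⟩
  rw [ae_restrict_iff' measurableSet_ball]
  filter_upwards [hU, ae_all_iff.2 hV] with x h1 h2 hx
  have hz1 : ζ x = 1 := ζ.one_of_mem_closedBall (ball_subset_closedBall hx)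
  have hz2 : fderiv ℝ ζ x = 0 := by
    have : (ζ : E → ℝ) =ᶠ[𝓝 x] fun _ => 1 := by
      filter_upwards [isOpen_ball.mem_nhds hx] with y hy
      exact ζ.one_of_mem_closedBall (ball_subset_closedBall hy)
    rw [this.fderiv_eq]; simp
  refine ⟨h1.symm.trans (by simp [hz1]), fun j => (h2 j).symm.trans (by simp [hz1, hz2])⟩

lemma ae_restrict_of_locally {Ω : Set E} (hΩ : IsOpen Ω) {p : E → Prop}
    (h : ∀ x₁ R, 0 < R → closedBall x₁ (3 * R) ⊆ Ω → ∀ᵐ x ∂(volume.restrict (ball x₁ R)), p x) :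
    ∀ᵐ x ∂(volume.restrict Ω), p x := by
  rw [ae_restrict_iff' hΩ.measurableSet, ae_iff]
  refine measure_null_of_locally_null _ fun x₁ hx₁ => ?_
  have hx : x₁ ∈ Ω := by
    by_contra h'
    exact hx₁ fun h2 => absurd h2 h'
  obtain ⟨ε, hε, hb⟩ := Metric.isOpen_iff.1 hΩ x₁ hx
  have h1 := h x₁ (ε / 4) (by positivity)
    ((closedBall_subset_ball (by linarith)).trans hb)
  rw [ae_restrict_iff' measurableSet_ball, ae_iff] at h1
  refine ⟨_, inter_mem_nhdsWithin _ (ball_mem_nhds x₁ (by positivity : 0 < ε / 4)), ?_⟩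
  refine measure_mono_null ?_ h1
  rintro y ⟨hy1, hy2⟩
  exact fun h3 => hy1 fun _ => h3 hy2

theorem ae_hasApproxGradAt {Ω : Set E} (hΩ : IsOpen Ω) {u : E → ℝ} {v : Fin n → E → ℝ}
    (hw : ∀ j, QValued.HasWeakPartialDeriv Ω j u (v j)) (hu : LocallyIntegrableOn u Ω) :
    ∀ᵐ x ∂(volume.restrict Ω), HasApproxGradAt u (fun j => v j x) x := by
  refine ae_restrict_of_locally hΩ fun x₁ R hR hB => ?_
  obtain ⟨U, V, hUV, hUm, hVm, he⟩ := exists_isW11_local hw hu hR hB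
  have he' := ae_restrict_of_ae_restrict_of_subset
    (ball_subset_ball (by linarith : R ≤ 2 * R)) he
  filter_upwards [ae_restrict_of_ae (hUV.ae_hasApproxGradAt hUm hVm), he',
    ae_restrict_mem measurableSet_ball] with x h1 h2 h3
  simp only [h2.2] at h1
  refine h1.congr h2.1 ?_
  exact eventually_densityFilter_of_ae_restrict isOpen_ball
    (ball_subset_ball (by linarith : R ≤ 2 * R) h3) (he.mono fun y hy => hy.1)

end ApproxCalc

/-! ### Lipschitz pieces covering almost everything -/

namespace ApproxCalc

open MeasureTheory Filter Topology Metric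
open scoped ENNReal

variable {n : ℕ}

local notation "E" => EuclideanSpace ℝ (Fin n)

/-- Increments of a countable family of Sobolev functions with a common bound on the gradients. -/
lemma exists_segment_bound {Ω : Set E} {ι : Type*} [Countable ι] {u : ι → E → ℝ}
    {v : ι → Fin n → E → ℝ} {g : Fin n → E → ℝ}
    (hw : ∀ i j, QValued.HasWeakPartialDeriv Ω j (u i) (v i j))
    (hu : ∀ i, LocallyIntegrableOn (u i) Ω)
    (hg : ∀ j, LocallyIntegrableOn (g j) Ω)
    (hvg : ∀ i j, ∀ᵐ x ∂(volume.restrict Ω), |v i j x| ≤ g j x)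
    {x₁ : E} {R : ℝ} (hR : 0 < R) (hB : closedBall x₁ (3 * R) ⊆ Ω) :
    ∃ G : E → ℝ≥0∞, Measurable G ∧ ∫⁻ y, G y ≠ ⊤ ∧
      ∀ᵐ x ∂(volume.restrict (ball x₁ R)), ∀ᵐ z ∂(volume.restrict (ball (0 : E) R)), ∀ i,
        ‖u i (x + z) - u i x‖ₑ ≤ (∫⁻ t, G (x + t • z) ∂unitMeasure) * ‖z‖ₑ := by
  choose U V hUV hUm hVm he using fun i => exists_isW11_local (hw i) (hu i) hR hB
  -- A single integrable function controls the whole family: the supremum is measurable because the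
  -- index set is countable, and it is integrable on the ball because all gradients share the bounds
  -- g.
  set G₀ : E → ℝ≥0∞ := fun y => ⨆ i, ∑ j, ‖V i j y‖ₑ with hG₀
  have hG₀m : Measurable G₀ := .iSup fun i => Finset.measurable_sum _ fun j _ => (hVm i j).enorm
  have hsub2 : ball x₁ (2 * R) ⊆ Ω :=
    (ball_subset_closedBall.trans (closedBall_subset_closedBall (by linarith))).trans hB
  have hG₀le : ∀ᵐ y ∂(volume.restrict (ball x₁ (2 * R))), G₀ y ≤ ∑ j, ‖g j y‖ₑ := by
    have h1 : ∀ᵐ y ∂(volume.restrict (ball x₁ (2 * R))), ∀ i j, |v i j y| ≤ g j y :=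
      ae_all_iff.2 fun i => ae_all_iff.2 fun j =>
        ae_restrict_of_ae_restrict_of_subset hsub2 (hvg i j)
    filter_upwards [ae_all_iff.2 he, h1] with y h2 h3
    refine iSup_le fun i => Finset.sum_le_sum fun j _ => ?_
    rw [(h2 i).2 j, ← ofReal_norm, ← ofReal_norm]
    exact ENNReal.ofReal_le_ofReal ((h3 i j).trans (le_abs_self _))
  refine ⟨(ball x₁ (2 * R)).indicator G₀, hG₀m.indicator measurableSet_ball, ?_, ?_⟩
  · rw [lintegral_indicator measurableSet_ball]
    refine ne_top_of_le_ne_top ?_ (lintegral_mono_ae hG₀le)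
    have hgi : ∀ j, IntegrableOn (g j) (ball x₁ (2 * R)) := fun j =>
      ((hg j).integrableOn_compact_subset hB (isCompact_closedBall _ _)).mono_set
        (ball_subset_closedBall.trans (closedBall_subset_closedBall (by linarith)))
    rw [lintegral_finsetSum' _ fun j _ => (hgi j).1.aemeasurable.enorm]
    exact (ENNReal.sum_lt_top.2 fun j _ => (hgi j).2).ne
  · have hae : ∀ᵐ x, ∀ i, ∀ᵐ z, _ := ae_all_iff.2 fun i => (hUV i).ae_ae_sub_eq (hUm i) (hVm i)
    have he1 := ae_all_iff.2 he
    have he2 := ae_restrict_of_ae_restrict_of_subset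
      (ball_subset_ball (by linarith : R ≤ 2 * R)) he1
    filter_upwards [ae_restrict_of_ae hae, he2, ae_restrict_mem measurableSet_ball] with x h1 h2 h3
    have hxz : ∀ᵐ z, x + z ∈ ball x₁ (2 * R) → ∀ i, U i (x + z) = u i (x + z) ∧
        ∀ j, V i j (x + z) = v i j (x + z) := by
      rw [ae_restrict_iff' measurableSet_ball] at he1
      exact (measurePreserving_add_left volume x).quasiMeasurePreserving.ae he1
    filter_upwards [ae_restrict_of_ae (ae_all_iff.2 h1), ae_restrict_of_ae hxz,
      ae_restrict_mem measurableSet_ball] with z h4 h5 h6 i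
    have hmem : ∀ t : ℝ, t ∈ Set.Icc (0:ℝ) 1 → x + t • z ∈ ball x₁ (2 * R) := by
      intro t ht
      rw [mem_ball, dist_eq_norm] at h3 h6 ⊢
      rw [sub_zero] at h6
      calc ‖x + t • z - x₁‖ = ‖(x - x₁) + t • z‖ := by congr 1; abel
        _ ≤ ‖x - x₁‖ + ‖t • z‖ := norm_add_le _ _
        _ ≤ ‖x - x₁‖ + ‖z‖ := by
            rw [norm_smul, Real.norm_of_nonneg ht.1]
            gcongr
            nlinarith [norm_nonneg z, ht.2]
        _ < 2 * R := by linarith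
    have h7 := h5 (by simpa using hmem 1 (by simp))
    rw [← (h7 i).1, ← (h2 i).1, (h4 i).2]
    have h8 := enorm_integral_segment_le (fun _ => 0) x z (h4 i).1
    simp only [zero_mul, Finset.sum_const_zero, sub_zero] at h8
    refine h8.trans ?_
    refine mul_le_mul_left ?_ _
    refine setLIntegral_mono' measurableSet_Ioc fun t ht => ?_
    rw [Set.indicator_of_mem (hmem t ⟨ht.1.le, ht.2⟩)]
    exact le_iSup (fun i => ∑ j, ‖V i j (x + t • z)‖ₑ) i

/-- A pseudo-distance whose increments are bounded by averages of an integrable function along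
segments is Lipschitz on countably many measurable pieces which cover almost everything. -/
lemma exists_lipschitz_pieces {d : E → E → ℝ} (hsymm : ∀ x y, d x y = d y x)
    (htri : ∀ x y z, d x z ≤ d x y + d y z) (hself : ∀ x, d x x = 0)
    {G : E → ℝ≥0∞} (hG : Measurable G) (hfin : ∫⁻ y, G y ≠ ⊤)
    {x₁ : E} {R : ℝ} (hR : 0 < R)
    (h : ∀ᵐ x ∂(volume.restrict (ball x₁ R)), ∀ᵐ z ∂(volume.restrict (ball (0 : E) R)),
      ENNReal.ofReal (d (x + z) x) ≤ (∫⁻ t, G (x + t • z) ∂unitMeasure) * ‖z‖ₑ) :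
    ∃ A : ℕ → Set E, (∀ k, MeasurableSet (A k)) ∧
      (∀ᵐ x ∂(volume.restrict (ball x₁ R)), ∃ k, x ∈ A k) ∧
      ∀ k, ∃ C δ : ℝ, 0 ≤ C ∧ 0 < δ ∧ ∀ x ∈ A k, ∀ y ∈ A k, ‖x - y‖ < δ →
        d x y ≤ C * ‖x - y‖ := by
  rw [ae_iff] at h
  obtain ⟨N, hN, hNm, hN0⟩ := exists_measurable_superset_of_null h
  have hgood : ∀ x, x ∉ N → ∀ᵐ z ∂(volume.restrict (ball (0 : E) R)),
      ENNReal.ofReal (d (x + z) x) ≤ (∫⁻ t, G (x + t • z) ∂unitMeasure) * ‖z‖ₑ := by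
    intro x hx
    by_contra hcon
    exact hx (hN hcon)
  -- Rational radii keep the intersection countable, hence measurable. Real radii below 1 / (k + 1)
  -- are recovered later by a rational between ρ and 2ρ, at the cost of a factor 2ⁿ; this is why the
  -- condition extends to 2 / (k + 1).
  set A : ℕ → Set E := fun k => Nᶜ ∩ ⋂ q : ℚ, {x | 0 < (q : ℝ) → (q : ℝ) < 2 / (k + 1) →
    ∫⁻ y in ball x q, G y ≤ k * volume (ball (0 : E) q)}
  refine ⟨A, ?_, ?_, ?_⟩
  · intro k
    refine hNm.compl.inter (MeasurableSet.iInter fun q => ?_)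
    by_cases hq : 0 < (q : ℝ) ∧ (q : ℝ) < 2 / (k + 1)
    · have hm : Measurable fun x : E => ∫⁻ y in ball x q, G y := by
        have : (fun x : E => ∫⁻ y in ball x q, G y) =
            fun x => ∫⁻ y, {p : E × E | ‖p.2 - p.1‖ < q}.indicator (fun p => G p.2) (x, y) := by
          ext x
          rw [← lintegral_indicator measurableSet_ball]
          congr 1
        rw [this]
        refine Measurable.lintegral_prod_right' ?_
        refine Measurable.indicator (by fun_prop) ?_
        exact measurableSet_lt (by fun_prop) (by fun_prop)
      have : {x : E | 0 < (q : ℝ) → (q : ℝ) < 2 / (k + 1) →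
          ∫⁻ y in ball x q, G y ≤ k * volume (ball (0 : E) q)} =
          {x | ∫⁻ y in ball x q, G y ≤ k * volume (ball (0 : E) q)} := by
        ext x; simp only [Set.mem_ofPred_eq]; exact ⟨fun h => h hq.1 hq.2, fun h _ _ => h⟩
      rw [this]
      exact measurableSet_le hm measurable_const
    · have : {x : E | 0 < (q : ℝ) → (q : ℝ) < 2 / (k + 1) →
          ∫⁻ y in ball x q, G y ≤ k * volume (ball (0 : E) q)} = Set.univ := by
        ext x; simp only [Set.mem_ofPred_eq, Set.mem_univ, iff_true]
        exact fun h1 h2 => absurd ⟨h1, h2⟩ hq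
      rw [this]; exact MeasurableSet.univ
  · have hN' : ∀ᵐ x ∂(volume.restrict (ball x₁ R)), x ∉ N := by
      rw [ae_iff]; simpa using hN0
    have hft : ∀ᵐ x : E, G x < ⊤ := ae_lt_top hG hfin
    filter_upwards [hN', ae_restrict_of_ae (ae_tendsto_lintegral_ball_div hG.aemeasurable hfin),
      ae_restrict_of_ae hft] with x hx hlim hlt
    have h1 := hlim.eventually (gt_mem_nhds (ENNReal.lt_add_right hlt.ne one_ne_zero))
    rw [eventually_nhdsWithin_iff, Metric.eventually_nhds_iff] at h1
    obtain ⟨δ, hδ, h1⟩ := h1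
    -- The index k₁ bounds the ball averages of G near x, and k₂ forces radii below 2 / (k + 1) to
    -- be less than δ.
    obtain ⟨k₁, hk₁⟩ := ENNReal.exists_nat_gt (ENNReal.add_ne_top.2 ⟨hlt.ne, ENNReal.one_ne_top⟩)
    obtain ⟨k₂, hk₂⟩ := exists_nat_gt (2 / δ)
    refine ⟨max k₁ k₂, hx, ?_⟩
    simp only [Set.mem_iInter, Set.mem_ofPred_eq]
    intro q hq hq2
    have hq3 : (q : ℝ) < δ := by
      refine hq2.trans ?_
      rw [div_lt_iff₀ (by positivity)]
      rw [div_lt_iff₀ hδ] at hk₂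
      have : (k₂ : ℝ) ≤ ((max k₁ k₂ : ℕ) : ℝ) := by exact_mod_cast le_max_right _ _
      nlinarith
    have h2 := h1 (y := (q : ℝ)) (by rwa [Real.dist_eq, sub_zero, abs_of_pos hq]) hq
    have h3 := (ENNReal.div_le_iff (volume_ball_pos x hq) (volume_ball_ne_top x q)).1 h2.le
    refine h3.trans ?_
    have hv : volume (ball x (q : ℝ)) = volume (ball (0 : E) q) := by
      rw [Measure.addHaar_ball_center]
    rw [hv]
    refine mul_le_mul_left ?_ _
    refine hk₁.le.trans ?_
    exact_mod_cast le_max_left _ _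
  · intro k
    set M : ℝ≥0∞ := k * ENNReal.ofReal (2 ^ n)
    have hM : M ≠ ⊤ := ENNReal.mul_ne_top (ENNReal.natCast_ne_top k) ENNReal.ofReal_ne_top
    have hAb : ∀ x ∈ A k, ∀ ρ : ℝ, 0 < ρ → ρ < 1 / (k + 1) →
        ∫⁻ y in ball x ρ, G y ≤ M * volume (ball x ρ) := by
      intro x hx ρ hρ hρ2
      obtain ⟨q, hq1, hq2⟩ := exists_rat_btwn (show ρ < 2 * ρ by linarith)
      have h1 := Set.mem_iInter.1 hx.2 q
      simp only [Set.mem_ofPred_eq] at h1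
      have h2 := h1 (hρ.trans hq1) (hq2.trans (by
        calc 2 * ρ < 2 * (1 / (k + 1)) := by linarith
          _ = 2 / (k + 1) := by ring))
      calc ∫⁻ y in ball x ρ, G y ≤ ∫⁻ y in ball x q, G y :=
            lintegral_mono_set (ball_subset_ball hq1.le)
        _ ≤ k * volume (ball (0 : E) q) := h2
        _ ≤ k * volume (ball (0 : E) (2 * ρ)) := by
            gcongr
        _ = M * volume (ball x ρ) := by
            rw [volume_ball_scale _ x two_pos hρ, ← mul_assoc]
    -- By Chebyshev, endpoints with segment average at least Λ fill at most the share M / Λ ≤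
    -- 2⁻⁽ⁿ⁺²⁾ of a ball; the summand 1 keeps Λ nonzero.
    set Λ : ℝ≥0∞ := (M + 1) * ENNReal.ofReal (2 ^ (n + 2)) with hΛ
    have hΛt : Λ ≠ ⊤ := ENNReal.mul_ne_top (ENNReal.add_ne_top.2 ⟨hM, ENNReal.one_ne_top⟩)
      ENNReal.ofReal_ne_top
    have hΛ0 : Λ ≠ 0 := by
      refine mul_ne_zero (by simp) ?_
      simp
    set lam : ℝ := Λ.toReal
    refine ⟨2 * lam, min R (1 / (k + 1)), by positivity, lt_min hR (by positivity), ?_⟩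
    intro x hx y hy hxy
    set r := ‖x - y‖ with hr
    rcases eq_or_ne x y with rfl | hne
    · rw [hself]; positivity
    have hr0 : 0 < r := norm_pos_iff.2 (sub_ne_zero.2 hne)
    -- the set of bad endpoints around a point of the piece
    have hbad : ∀ w ∈ A k, volume {p ∈ ball w r | ¬ d p w ≤ lam * r} ≤
        ENNReal.ofReal ((2 ^ (n + 2))⁻¹) * volume (ball w r) := by
      intro w hw
      have hFm : Measurable fun z : E => ∫⁻ t, G (w + t • z) ∂unitMeasure := by
        refine Measurable.lintegral_prod_right' (f := fun p : E × ℝ => G (w + p.2 • p.1)) ?_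
        exact hG.comp (by fun_prop)
      have h1 := mul_meas_ge_le_lintegral (μ := volume.restrict (ball (0 : E) r)) hFm Λ
      have h2 := lintegral_segment_le hG hr0 fun ρ hρ hρr =>
        hAb w hw ρ hρ (hρr.trans_lt (hxy.trans_le (min_le_right _ _)))
      have h3 : volume.restrict (ball (0 : E) r) {z | Λ ≤ ∫⁻ t, G (w + t • z) ∂unitMeasure} ≤
          ENNReal.ofReal ((2 ^ (n + 2))⁻¹) * volume (ball w r) := by
        have h4 := h1.trans h2
        rw [mul_comm, ← ENNReal.le_div_iff_mul_le (Or.inl hΛ0) (Or.inl hΛt)] at h4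
        refine h4.trans ?_
        rw [ENNReal.div_le_iff hΛ0 hΛt]
        calc M * volume (ball w r) ≤ (M + 1) * volume (ball w r) := by gcongr; simp
          _ = (ENNReal.ofReal ((2 ^ (n + 2))⁻¹) * ENNReal.ofReal (2 ^ (n + 2))) *
              ((M + 1) * volume (ball w r)) := by
              rw [← ENNReal.ofReal_mul (by positivity), inv_mul_cancel₀ (by positivity)]; simp
          _ = _ := by rw [hΛ]; ring
      refine le_trans ?_ h3
      have h5 := ae_restrict_of_ae_restrict_of_subset
        (ball_subset_ball (hxy.le.trans (min_le_left _ _))) (hgood w hw.1)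
      have h6 : volume {p ∈ ball w r | ¬ d p w ≤ lam * r} =
          volume {z ∈ ball (0 : E) r | ¬ d (w + z) w ≤ lam * r} := by
        rw [← measure_preimage_add volume w {p ∈ ball w r | ¬ d p w ≤ lam * r}]
        congr 1
        ext z
        simp [mem_ball, dist_eq_norm]
      rw [h6]
      have h7 : {z ∈ ball (0 : E) r | ¬ d (w + z) w ≤ lam * r} =
          {z | ¬ d (w + z) w ≤ lam * r} ∩ ball (0 : E) r := by
        ext z; exact and_comm
      rw [h7, ← Measure.restrict_apply₀' measurableSet_ball.nullMeasurableSet]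
      refine measure_mono_ae ?_
      filter_upwards [h5, ae_restrict_mem measurableSet_ball] with z h8 h9 h10
      change Λ ≤ _
      by_contra hlt
      apply h10
      rw [mem_ball, dist_eq_norm, sub_zero] at h9
      have h11 : ENNReal.ofReal (d (w + z) w) ≤ ENNReal.ofReal (lam * r) := by
        refine h8.trans ?_
        rw [ENNReal.ofReal_mul (by positivity), ENNReal.ofReal_toReal hΛt, ← ofReal_norm]
        gcongr
        exact (not_le.1 hlt).le
      exact (ENNReal.ofReal_le_ofReal_iff (by positivity)).1 h11
    -- a common good endpoint
    set mid : E := x + (2:ℝ)⁻¹ • (y - x) with hmid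
    have hsx : ball mid (2⁻¹ * r) ⊆ ball x r := by
      refine ball_subset_ball' ?_
      rw [dist_eq_norm, hmid, add_sub_cancel_left, norm_smul, norm_sub_rev y x, ← hr]
      norm_num; linarith
    have hsy : ball mid (2⁻¹ * r) ⊆ ball y r := by
      refine ball_subset_ball' ?_
      have : mid - y = (2:ℝ)⁻¹ • (x - y) := by
        rw [hmid]; module
      rw [dist_eq_norm, this, norm_smul, ← hr]
      norm_num; linarith
    -- The ball of radius r / 2 about the midpoint lies in both balls and has share 2⁻ⁿ = 4 ·
    -- 2⁻⁽ⁿ⁺²⁾, whereas the two bad sets together have share at most 2 · 2⁻⁽ⁿ⁺²⁾.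
    obtain ⟨p, hp, hpx, hpy⟩ : ∃ p ∈ ball mid (2⁻¹ * r), d p x ≤ lam * r ∧ d p y ≤ lam * r := by
      by_contra! hcon
      have hsub : ball mid (2⁻¹ * r) ⊆ {p ∈ ball x r | ¬ d p x ≤ lam * r} ∪
          {p ∈ ball y r | ¬ d p y ≤ lam * r} := by
        intro p hp
        by_cases hpx : d p x ≤ lam * r
        · exact Or.inr ⟨hsy hp, not_le.2 (hcon p hp hpx)⟩
        · exact Or.inl ⟨hsx hp, hpx⟩
      have h1 := (measure_mono (μ := volume) hsub).trans
        ((measure_union_le _ _).trans (add_le_add (hbad x hx) (hbad y hy)))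
      rw [volume_ball_scale mid x (by norm_num) hr0, Measure.addHaar_ball_center volume y,
        ← Measure.addHaar_ball_center volume x, ← add_mul,
        ENNReal.mul_le_mul_iff_left (volume_ball_pos x hr0) (volume_ball_ne_top x r),
        ← ENNReal.ofReal_add (by positivity) (by positivity),
        ENNReal.ofReal_le_ofReal_iff (by positivity)] at h1
      have h2 : (2⁻¹ : ℝ) ^ n = 4 * (2 ^ (n + 2))⁻¹ := by
        rw [pow_add, inv_pow]; field_simp; norm_num
      have h3 : (0:ℝ) < (2 ^ (n + 2))⁻¹ := by positivity
      linarith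
    calc d x y ≤ d x p + d p y := htri _ _ _
      _ = d p x + d p y := by rw [hsymm x p]
      _ ≤ 2 * lam * r := by linarith

end ApproxCalc

/-! ### Existence of approximate jets of Q-valued functions -/

namespace QValued

open MeasureTheory Filter Topology Metric ApproxCalc
open scoped ENNReal

variable {n m Q : ℕ}

/-- Half of the labels that are close to each other coincide: a separation constant. -/
lemma exists_separation (p : Fin Q → Euc m) :
    ∃ δ : ℝ, 0 < δ ∧ ∀ i j, p i ≠ p j → 4 * δ ≤ ‖p i - p j‖ := by
  have h : ∀ ij : Fin Q × Fin Q, ∃ δ : ℝ, 0 < δ ∧ (p ij.1 ≠ p ij.2 → 4 * δ ≤ ‖p ij.1 - p ij.2‖) := by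
    intro ij
    by_cases hij : p ij.1 = p ij.2
    · exact ⟨1, one_pos, fun h => absurd hij h⟩
    · have : 0 < ‖p ij.1 - p ij.2‖ := norm_pos_iff.2 (sub_ne_zero.2 hij)
      exact ⟨‖p ij.1 - p ij.2‖ / 4, by positivity, fun _ => by linarith⟩
  choose δ hδ h using h
  by_cases hne : (Finset.univ : Finset (Fin Q × Fin Q)).Nonempty
  · obtain ⟨ij, -, hmin⟩ := Finset.exists_min_image Finset.univ δ hne
    refine ⟨δ ij, hδ ij, fun i j hij => (h (i, j) hij).trans' ?_⟩
    have := hmin (i, j) (Finset.mem_univ _)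
    linarith
  · exact ⟨1, one_pos, fun i j => absurd ⟨(i, j), Finset.mem_univ _⟩ hne⟩

/-- The number of distinct points of a tuple. -/
noncomputable def numPoints (T : AQ Q m) : ℕ := Nat.card {a // a ∈ T}

lemma numPoints_ofLabel (p : Fin Q → Euc m) : numPoints (ofLabel p) = Nat.card (Set.range p) := by
  unfold numPoints
  congr 1
  simp only [mem_ofLabel]
  rfl

/-- A tuple close to `∑ ⟦p i⟧` has at least as many distinct points; in the case of equality,
it has a labelling with the same coincidences as `p`. -/
lemma exists_label_near {p : Fin Q → Euc m} {δ : ℝ}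
    (hδ : ∀ i j, p i ≠ p j → 4 * δ ≤ ‖p i - p j‖) {S : AQ Q m}
    (hS : dist (ofLabel p) S < δ) :
    numPoints (ofLabel p) ≤ numPoints S ∧
    (numPoints S = numPoints (ofLabel p) → ∃ s : Fin Q → Euc m, ofLabel s = S ∧
      (∀ i, ‖p i - s i‖ < δ) ∧ ∀ i j, p i = p j → s i = s j) := by
  obtain ⟨s₀, rfl⟩ := exists_ofLabel S
  obtain ⟨σ, hσ⟩ := exists_dist_ofLabel p s₀
  rw [← ofLabel_comp_perm s₀ σ] at hS ⊢
  rw [ofLabel_comp_perm s₀ σ, hσ] at hS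
  set s := s₀ ∘ σ
  have hδ0 : 0 < δ := (labelDist_nonneg _ _).trans_lt hS
  have hnear : ∀ i, ‖p i - s i‖ < δ := fun i => (norm_sub_le_labelDist p s i).trans_lt hS
  have hinj : ∀ i j, s i = s j → p i = p j := by
    intro i j hij
    by_contra hne
    have h1 := hδ i j hne
    have h2 : ‖p i - p j‖ ≤ ‖p i - s i‖ + ‖p j - s j‖ := by
      calc ‖p i - p j‖ = ‖(p i - s i) - (p j - s j)‖ := by rw [hij]; congr 1; abel
        _ ≤ _ := norm_sub_le _ _
    linarith [hnear i, hnear j]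
  rw [numPoints_ofLabel, numPoints_ofLabel]
  -- Sending s i to p i is well defined because labels that coincide in s come from the same value
  -- of p. The map is surjective, hence bijective when the cardinalities agree, and injectivity of
  -- its inverse is the transfer of coincidences from p to s.
  let φ : Set.range s → Set.range p := fun a => ⟨p a.2.choose, ⟨_, rfl⟩⟩
  have hφ : ∀ i, φ ⟨s i, ⟨i, rfl⟩⟩ = ⟨p i, ⟨i, rfl⟩⟩ := by
    intro i
    apply Subtype.ext
    exact hinj _ _ (⟨i, rfl⟩ : s i ∈ Set.range s).choose_spec
  have hsurj : Function.Surjective φ := by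
    rintro ⟨_, ⟨i, rfl⟩⟩
    exact ⟨_, hφ i⟩
  refine ⟨Nat.card_le_card_of_surjective φ hsurj, fun hc => ⟨s, rfl, hnear, ?_⟩⟩
  have hbij := hsurj.bijective_of_nat_card_le hc.le
  intro i j hij
  have : φ ⟨s i, ⟨i, rfl⟩⟩ = φ ⟨s j, ⟨j, rfl⟩⟩ := by
    rw [hφ, hφ]; exact Subtype.ext hij
  exact congrArg Subtype.val (hbij.1 this)

/-- On a set where `f` splits into differentiable sheets with constant coincidences, `f` is
approximately differentiable at the points of density one. -/
lemma hasApproxJetAt_of_sheets {f : Euc n → AQ Q m} {S : Set (Euc n)} (hS : MeasurableSet S)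
    {q : Euc n → Fin Q → Euc m} {p : Fin Q → Euc m} (hq : ∀ x ∈ S, ofLabel (q x) = f x)
    (hqp : ∀ x ∈ S, ∀ i j, q x i = q x j ↔ p i = p j) {x₀ : Euc n} (hx₀ : x₀ ∈ S)
    (hd : S ∈ densityFilter x₀)
    (hdiff : ∀ i, DifferentiableWithinAt ℝ (fun x => q x i) S x₀) :
    ∃ J, HasApproxJetAt f x₀ J := by
  set L : Fin Q → (Euc n →L[ℝ] Euc m) := fun i => fderivWithin ℝ (fun x => q x i) S x₀
  refine ⟨ofLabel fun i => (q x₀ i, L i), ?_, ?_, S, hS, hx₀, ?_, ?_⟩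
  · rw [ofLabel_map]; exact hq x₀ hx₀
  · intro a ha b hb hab
    obtain ⟨i, rfl⟩ := (mem_ofLabel _ _).1 ha
    obtain ⟨j, rfl⟩ := (mem_ofLabel _ _).1 hb
    -- Sheets that meet at x₀ coincide on all of S, so their derivatives within S agree.
    have hij : p i = p j := (hqp x₀ hx₀ i j).1 hab
    exact fderivWithin_congr (fun x hx => (hqp x hx i j).2 hij) hab
  · exact (mem_densityFilter_of_measurableSet hS).1 hd
  · have h1 : (fun x => ∑ i, ‖q x i - q x₀ i - L i (x - x₀)‖) =o[𝓝[S] x₀] (fun x => x - x₀) := by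
      refine Asymptotics.IsLittleO.fun_sum
        (A := fun i x => ‖q x i - q x₀ i - L i (x - x₀)‖) fun i _ => ?_
      exact ((hdiff i).hasFDerivWithinAt.isLittleO).norm_left
    refine Asymptotics.IsBigO.trans_isLittleO (g := fun x => ∑ i, ‖q x i - q x₀ i - L i (x - x₀)‖)
      ?_ h1
    refine Asymptotics.IsBigO.of_bound 1 ?_
    filter_upwards [self_mem_nhdsWithin] with x hx
    rw [one_mul, Real.norm_of_nonneg (dist_nonneg _ _), Real.norm_of_nonneg
      (Finset.sum_nonneg fun _ _ => norm_nonneg _), ← hq x hx, expansion, ofLabel_map]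
    refine (dist_ofLabel_le _ _).trans ((labelDist_le_sum _ _).trans (le_of_eq ?_))
    refine Finset.sum_congr rfl fun i _ => ?_
    congr 1; abel

/-- A locally Lipschitz `Q`-valued function on a measurable set is approximately differentiable
at almost every point. -/
theorem ae_exists_jet_of_lipschitz {f : Euc n → AQ Q m} {A : Set (Euc n)} (hA : MeasurableSet A)
    {C δ₀ : ℝ} (hC : 0 ≤ C) (hδ₀ : 0 < δ₀)
    (hLip : ∀ x ∈ A, ∀ y ∈ A, ‖x - y‖ < δ₀ → dist (f x) (f y) ≤ C * ‖x - y‖) :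
    ∀ᵐ x ∂(volume.restrict A), ∃ J, HasApproxJetAt f x J := by
  have hnear : ∀ x ∈ A, ∀ ε : ℝ, 0 < ε → ∃ ρ : ℝ, 0 < ρ ∧ ρ ≤ δ₀ / 2 ∧ ∀ y ∈ A, y ∈ ball x ρ →
      dist (f x) (f y) < ε := by
    intro x hx ε hε
    refine ⟨min (δ₀ / 2) (ε / (C + 1)), by positivity, min_le_left _ _, fun y hy hyx => ?_⟩
    rw [mem_ball, dist_eq_norm, norm_sub_rev] at hyx
    have h1 := hyx.trans_le (min_le_left _ _)
    have h2 := hyx.trans_le (min_le_right _ _)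
    rw [lt_div_iff₀ (by positivity)] at h2
    have h3 := hLip x hx y hy (by linarith)
    nlinarith [norm_nonneg (x - y)]
  -- Nearby tuples have at least as many distinct points, so these sets are relatively open in A.
  -- This gives measurability without assuming it for f.
  have hge : ∀ k, MeasurableSet {x ∈ A | k ≤ numPoints (f x)} := by
    intro k
    have h1 : ∀ x ∈ {x ∈ A | k ≤ numPoints (f x)}, ∃ ρ : ℝ, 0 < ρ ∧ ∀ y ∈ A, y ∈ ball x ρ →
        k ≤ numPoints (f y) := by
      rintro x ⟨hxA, hxk⟩
      obtain ⟨p, hp⟩ := exists_ofLabel (f x)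
      obtain ⟨δ, hδ0, hδ⟩ := exists_separation p
      obtain ⟨ρ, hρ, -, h⟩ := hnear x hxA δ hδ0
      refine ⟨ρ, hρ, fun y hy hyx => hxk.trans ?_⟩
      have := h y hy hyx
      rw [← hp] at this ⊢
      exact (exists_label_near hδ this).1
    choose! ρ hρ h1 using h1
    have : {x ∈ A | k ≤ numPoints (f x)} =
        A ∩ ⋃ x ∈ {x ∈ A | k ≤ numPoints (f x)}, ball x (ρ x) := by
      ext y
      constructor
      · intro hy
        exact ⟨hy.1, Set.mem_biUnion hy (mem_ball_self (hρ y hy))⟩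
      · rintro ⟨hyA, hy⟩
        obtain ⟨x, hx, hyx⟩ := Set.mem_iUnion₂.1 hy
        exact ⟨hyA, h1 x hx y hyA hyx⟩
    rw [this]
    exact hA.inter (isOpen_biUnion fun x _ => isOpen_ball).measurableSet
  have heq : ∀ k, MeasurableSet {x ∈ A | numPoints (f x) = k} := by
    intro k
    have : {x ∈ A | numPoints (f x) = k} =
        {x ∈ A | k ≤ numPoints (f x)} \ {x ∈ A | k + 1 ≤ numPoints (f x)} := by
      ext x
      constructor
      · rintro ⟨h1, h2⟩
        refine ⟨⟨h1, h2.ge⟩, fun h3 => ?_⟩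
        have := h3.2
        omega
      · rintro ⟨⟨h1, h2⟩, h3⟩
        refine ⟨h1, le_antisymm ?_ h2⟩
        by_contra h4
        exact h3 ⟨h1, by omega⟩
    rw [this]
    exact (hge k).diff (hge (k + 1))
  -- near `x₁`, we treat each number of distinct points separately
  have hloc : ∀ x₂ ∈ A, ∃ ρ : ℝ, 0 < ρ ∧ volume {x ∈ A | x ∈ ball x₂ ρ ∧
      numPoints (f x) = numPoints (f x₂) ∧ ¬ ∃ J, HasApproxJetAt f x J} = 0 := by
    intro x₂ hx₂
    obtain ⟨p, hp⟩ := exists_ofLabel (f x₂)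
    obtain ⟨δ, hδ0, hδ⟩ := exists_separation p
    obtain ⟨ρ, hρ, hρ2, hd⟩ := hnear x₂ hx₂ δ hδ0
    refine ⟨ρ, hρ, ?_⟩
    set S := {x ∈ A | numPoints (f x) = numPoints (f x₂)} ∩ ball x₂ ρ with hSdef
    have hS : MeasurableSet S := (heq _).inter measurableSet_ball
    -- Fixing the number of distinct points freezes the pattern of coincidences to that of p, which
    -- makes the labelling by sheets consistent over S.
    have hsheet : ∀ x ∈ S, ∃ s : Fin Q → Euc m, ofLabel s = f x ∧
      (∀ i, ‖p i - s i‖ < δ) ∧ ∀ i j, p i = p j → s i = s j := by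
      intro x hx
      have h1 := hd x hx.1.1 hx.2
      rw [← hp] at h1
      refine (exists_label_near hδ h1).2 ?_
      rw [hp]; exact hx.1.2
    choose! q hq hqd hqe using hsheet
    have hqp : ∀ x ∈ S, ∀ i j, q x i = q x j ↔ p i = p j := by
      intro x hx i j
      refine ⟨fun h => ?_, hqe x hx i j⟩
      by_contra hne
      have h1 := hδ i j hne
      have h2 : ‖p i - p j‖ ≤ ‖p i - q x i‖ + ‖p j - q x j‖ := by
        calc ‖p i - p j‖ = ‖(p i - q x i) - (p j - q x j)‖ := by rw [h]; congr 1; abel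
          _ ≤ _ := norm_sub_le _ _
      linarith [hqd x hx i, hqd x hx j]
    have hqL : ∀ i, LipschitzOnWith C.toNNReal (fun x => q x i) S := by
      intro i
      refine LipschitzOnWith.of_dist_le_mul fun x hx y hy => ?_
      rw [dist_eq_norm, dist_eq_norm, Real.coe_toNNReal _ hC]
      have hxy : ‖x - y‖ < δ₀ := by
        have h1 := hx.2
        have h2 := hy.2
        rw [mem_ball, dist_eq_norm] at h1 h2
        calc ‖x - y‖ = ‖(x - x₂) - (y - x₂)‖ := by congr 1; abel
          _ ≤ ‖x - x₂‖ + ‖y - x₂‖ := norm_sub_le _ _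
          _ < δ₀ := by linarith
      refine le_trans ?_ (hLip x hx.1.1 y hy.1.1 hxy)
      rw [← hq x hx, ← hq y hy]
      obtain ⟨σ, hσ⟩ := exists_dist_ofLabel (q x) (q y)
      rw [hσ]
      refine le_trans ?_ (norm_sub_le_labelDist _ _ i)
      simp only [Function.comp]
      -- If the optimal matching pairs i with a label of a different value of p, that pair costs
      -- more than 4δ - 2δ = 2δ, while ‖q x i - q y i‖ < 2δ. Otherwise the two labels carry the same
      -- sheet.
      by_cases hpi : p i = p (σ i)
      · rw [hqe y hy i (σ i) hpi]
      · have h1 := hδ i (σ i) hpi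
        have h2 : ‖p i - p (σ i)‖ ≤ ‖p i - q x i‖ + ‖q x i - q y (σ i)‖ +
            ‖p (σ i) - q y (σ i)‖ := by
          calc ‖p i - p (σ i)‖ = ‖(p i - q x i) + (q x i - q y (σ i)) -
                (p (σ i) - q y (σ i))‖ := by congr 1; abel
            _ ≤ _ := (norm_sub_le _ _).trans (by gcongr; exact norm_add_le _ _)
        have h3 : ‖q x i - q y i‖ ≤ ‖p i - q x i‖ + ‖p i - q y i‖ := by
          calc ‖q x i - q y i‖ = ‖(p i - q y i) - (p i - q x i)‖ := by congr 1; abel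
            _ ≤ ‖p i - q y i‖ + ‖p i - q x i‖ := norm_sub_le _ _
            _ = _ := add_comm _ _
        linarith [hqd x hx i, hqd x hx (σ i), hqd y hy i, hqd y hy (σ i)]
    -- Rademacher's theorem for each Lipschitz sheet, combined with density of S at almost all of
    -- its points.
    have hae : ∀ᵐ x ∂(volume.restrict S), ∃ J, HasApproxJetAt f x J := by
      filter_upwards [ae_restrict_of_ae (ae_all_iff.2 fun i =>
          (hqL i).ae_differentiableWithinAt_of_mem (μ := volume)),
        ae_mem_densityFilter hS, ae_restrict_mem hS] with x h1 h2 h3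
      exact hasApproxJetAt_of_sheets hS hq hqp h3 h2 fun i => h1 i h3
    rw [ae_restrict_iff' hS, ae_iff] at hae
    refine measure_mono_null ?_ hae
    rintro x ⟨hxA, hxb, hxn, hxJ⟩
    exact fun h => hxJ (h ⟨⟨hxA, hxn⟩, hxb⟩)
  have hk : ∀ k, volume {x ∈ A | numPoints (f x) = k ∧ ¬ ∃ J, HasApproxJetAt f x J} = 0 := by
    intro k
    refine measure_null_of_locally_null _ fun x₂ hx₂ => ?_
    obtain ⟨ρ, hρ, h0⟩ := hloc x₂ hx₂.1
    refine ⟨_, inter_mem_nhdsWithin _ (ball_mem_nhds x₂ hρ), measure_mono_null ?_ h0⟩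
    rintro x ⟨⟨h1, h2, h3⟩, h4⟩
    exact ⟨h1, h4, h2.trans hx₂.2.1.symm, h3⟩
  rw [ae_restrict_iff' hA, ae_iff]
  refine measure_mono_null ?_ (measure_iUnion_null hk)
  intro x hx
  have hxA : x ∈ A := by
    by_contra h'
    exact hx fun h2 => absurd h2 h'
  exact Set.mem_iUnion.2 ⟨numPoints (f x), hxA, rfl, fun h => hx fun _ => h⟩

/-- A Sobolev `Q`-valued function is approximately differentiable almost everywhere. -/
theorem MemW12.ae_exists_jet {Ω : Set (Euc n)} (hn : 0 < n) (hΩ : IsOpen Ω) {f : Euc n → AQ Q m}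
    (hf : MemW12 Ω f) : ∀ᵐ x ∂(volume.restrict Ω), ∃ J, HasApproxJetAt f x J := by
  obtain ⟨-, g, hg, hv⟩ := hf
  refine ae_restrict_of_locally hΩ fun x₁ R hR hB => ?_
  choose v hw hvg using fun q => hv (ofLabel (denseLabel m Q q))
  obtain ⟨G, hG, hfin, hae⟩ := exists_segment_bound hw (fun q => (hw q ⟨0, hn⟩).1)
    (fun j => locallyIntegrableOn_of_locallyIntegrable_restrict
      ((hg j).locallyIntegrable (by norm_num))) hvg hR hB
  obtain ⟨A, hA, hcov, hL⟩ := exists_lipschitz_pieces (d := fun x y => dist (f x) (f y))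
    (fun _ _ => dist_comm _ _) (fun _ _ _ => dist_triangle _ _ _) (fun _ => dist_self _) hG hfin hR
    (by
      filter_upwards [hae] with x hx
      filter_upwards [hx] with z hz
      set I := (∫⁻ t, G (x + t • z) ∂unitMeasure) * ‖z‖ₑ
      by_cases hI : I = ⊤
      · rw [hI]; exact le_top
      rw [ENNReal.ofReal_le_iff_le_toReal hI]
      -- The increment of f in 𝒢 is recovered from the increments of the countably many functions
      -- 𝒢(f, T), which share the segment bound.
      refine dist_le_of_forall_denseLabel fun q => ?_
      rw [← Real.norm_eq_abs, ← ENNReal.ofReal_le_iff_le_toReal hI, ofReal_norm]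
      exact hz q)
  have h1 : ∀ k, ∀ᵐ x, x ∈ A k → ∃ J, HasApproxJetAt f x J := by
    intro k
    obtain ⟨C, δ, hC, hδ, h⟩ := hL k
    exact (ae_restrict_iff' (hA k)).1 (ae_exists_jet_of_lipschitz (hA k) hC hδ h)
  filter_upwards [hcov, ae_restrict_of_ae (ae_all_iff.2 h1)] with x ⟨k, hk⟩ h2
  exact h2 k hk

end QValued

/-! ### The jet and the gradients of the functions 𝒢(f, T) -/

namespace QValued

open MeasureTheory Filter Topology Metric ApproxCalc
open scoped ENNReal

variable {n m Q : ℕ}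

/-- `∑ i, |Df_i(x) · v|²`. -/
noncomputable def dirEnergy (f : Euc n → AQ Q m) (x v : Euc n) : ℝ :=
  jetSum f x fun p => ‖p.2 v‖ ^ 2

/-- `∑ i, ⟨f_i(x), Df_i(x) · v⟩`. -/
noncomputable def dirPairing (f : Euc n → AQ Q m) (x v : Euc n) : ℝ :=
  jetSum f x fun p => inner ℝ p.1 (p.2 v)

/-- The linear form with coefficients `a`. -/
noncomputable def coeffForm (a : Fin n → ℝ) : Euc n →L[ℝ] ℝ :=
  ∑ j, a j • (EuclideanSpace.proj j : Euc n →L[ℝ] ℝ)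

lemma coeffForm_apply (a : Fin n → ℝ) (v : Euc n) : coeffForm a v = ∑ j, a j * v j := by
  simp [coeffForm]

lemma exists_norm_le_of_finite (L : Fin Q → (Euc n →L[ℝ] Euc m)) :
    ∃ K : ℝ, 0 ≤ K ∧ ∀ h, ∑ i, ‖L i h‖ ^ 2 ≤ K * ‖h‖ ^ 2 := by
  refine ⟨∑ i, ‖L i‖ ^ 2, Finset.sum_nonneg fun _ _ => sq_nonneg _, fun h => ?_⟩
  rw [Finset.sum_mul]
  refine Finset.sum_le_sum fun i _ => ?_
  rw [← mul_pow]
  gcongr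
  exact (L i).le_opNorm h

/-- The approximate gradient of `𝒢(f, T)` in terms of the jet of `f` and an optimal labelling. -/
lemma dist_mul_grad_eq {f : Euc n → AQ Q m} {x₀ : Euc n} {P : Fin Q → Euc m}
    {L : Fin Q → (Euc n →L[ℝ] Euc m)} (hJ : HasApproxJetAt f x₀ (ofLabel fun i => (P i, L i)))
    {s : Fin Q → Euc m} (hs : dist (f x₀) (ofLabel s) = labelDist P s) {a : Fin n → ℝ}
    (ha : HasApproxGradAt (fun x => dist (f x) (ofLabel s)) a x₀) (v : Euc n) :
    dist (f x₀) (ofLabel s) * ∑ j, a j * v j = ∑ i, inner ℝ (P i - s i) (L i v) := by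
  obtain ⟨hP, -, S, hSm, hxS, hSd, hSo⟩ := hJ
  set u₀ := dist (f x₀) (ofLabel s) with hu₀
  rcases (dist_nonneg (f x₀) (ofLabel s)).eq_or_lt with h0 | h0
  · rw [← hu₀] at h0
    have : ∀ i, P i - s i = 0 := by
      intro i
      have h1 := norm_sub_le_labelDist P s i
      rw [← hs, ← h0] at h1
      exact norm_le_zero_iff.1 h1
    simp [this, ← h0]
  rw [← hu₀] at h0
  set β : Euc n →L[ℝ] ℝ := ∑ i, (innerSL ℝ (P i - s i)).comp (L i) with hβ
  have hβv : ∀ h, β h = ∑ i, inner ℝ (P i - s i) (L i h) := by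
    intro h; simp [hβ, inner_sub_left]
  obtain ⟨K, hK, hKL⟩ := exists_norm_le_of_finite L
  have hSF : S ∈ densityFilter x₀ := (mem_densityFilter_of_measurableSet hSm).2 hSd
  -- Only an upper bound along y is needed, by `eq_zero_of_eventually_le`. The labelling optimal at
  -- x₀ is therefore just a competitor at y, and no optimality at y enters.
  have hzero : coeffForm a - u₀⁻¹ • β = 0 := by
    refine eq_zero_of_eventually_le (x := x₀) fun ε hε => ?_
    have e1 := ha (ε / 3) (by positivity)
    have e2 : ∀ᶠ y in densityFilter x₀, dist (f y) (expansion (ofLabel fun i => (P i, L i)) x₀ y) ≤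
        ε / 3 * ‖y - x₀‖ := by
      have h1 := hSo.bound (c := ε / 3) (by positivity)
      rw [eventually_nhdsWithin_iff] at h1
      filter_upwards [densityFilter_le_nhds x₀ h1, hSF] with y h2 h3
      have := h2 h3
      rwa [Real.norm_of_nonneg (dist_nonneg _ _)] at this
    -- The radius at which the quadratic remainder K‖h‖² / (2u₀) is at most ε/3 · ‖h‖; K + 1
    -- replaces K to avoid dividing by zero.
    have e3 : ∀ᶠ y in densityFilter x₀, ‖y - x₀‖ ≤ ε * (2 * u₀) / (3 * (K + 1)) := by
      refine densityFilter_le_nhds x₀ ?_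
      have hpos : 0 < ε * (2 * u₀) / (3 * (K + 1)) := by positivity
      filter_upwards [Metric.closedBall_mem_nhds x₀ hpos] with y hy
      rwa [mem_closedBall, dist_eq_norm] at hy
    filter_upwards [e1, e2, e3] with y h1 h2 h3
    set h := y - x₀
    have h4 : dist (expansion (ofLabel fun i => (P i, L i)) x₀ y) (ofLabel s) ≤
        u₀ + u₀⁻¹ * β h + K * ‖h‖ ^ 2 / (2 * u₀) := by
      rw [expansion, ofLabel_map]
      refine (dist_ofLabel_le _ _).trans ?_
      have hsq : labelDist (fun i => P i + L i h) s ^ 2 ≤ u₀ ^ 2 + 2 * β h + K * ‖h‖ ^ 2 := by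
        rw [labelDist_sq, hs, labelDist_sq, hβv, Finset.mul_sum]
        refine le_trans (le_of_eq ?_) (add_le_add_right (hKL h) _)
        rw [← Finset.sum_add_distrib, ← Finset.sum_add_distrib]
        refine Finset.sum_congr rfl fun i _ => ?_
        rw [add_sub_right_comm, norm_add_sq_real]
      have hℓ := labelDist_nonneg (fun i => P i + L i h) s
      set ℓ := labelDist (fun i => P i + L i h) s
      -- This linearises the square root through 2u₀ℓ ≤ u₀² + ℓ².
      have : 2 * u₀ * ℓ ≤ 2 * u₀ * (u₀ + u₀⁻¹ * β h + K * ‖h‖ ^ 2 / (2 * u₀)) := by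
        have h5 : 2 * u₀ * (u₀ + u₀⁻¹ * β h + K * ‖h‖ ^ 2 / (2 * u₀)) =
            2 * u₀ ^ 2 + 2 * β h + K * ‖h‖ ^ 2 := by
          field_simp
        rw [h5]
        nlinarith [sq_nonneg (ℓ - u₀)]
      exact le_of_mul_le_mul_left this (by positivity)
    have h5 := dist_triangle (f y) (expansion (ofLabel fun i => (P i, L i)) x₀ y) (ofLabel s)
    have h6 := (abs_le.1 h1).1
    have h7 : K * ‖h‖ ^ 2 / (2 * u₀) ≤ ε / 3 * ‖h‖ := by
      rw [le_div_iff₀ (by positivity)] at h3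
      rw [div_le_iff₀ (by positivity)]
      nlinarith [norm_nonneg h, mul_nonneg hK (norm_nonneg h)]
    rw [sub_apply, coeffForm_apply, smul_apply, smul_eq_mul]
    linarith
  have h1 := congrArg (fun c : Euc n →L[ℝ] ℝ => u₀ * c v) hzero
  simp only [sub_apply, coeffForm_apply, smul_apply, smul_eq_mul, zero_apply, mul_zero,
    mul_sub, mul_inv_cancel_left₀ h0.ne'] at h1
  rw [← hβv]
  linarith

/-- At a minimum point of `𝒢(f, T)`, its approximate gradient vanishes. -/
lemma grad_eq_zero_of_dist_eq_zero {f : Euc n → AQ Q m} {x₀ : Euc n} {T : AQ Q m}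
    (h0 : dist (f x₀) T = 0) {a : Fin n → ℝ}
    (ha : HasApproxGradAt (fun x => dist (f x) T) a x₀) (v : Euc n) : ∑ j, a j * v j = 0 := by
  have h1 : -coeffForm a = 0 := by
    refine eq_zero_of_eventually_le (x := x₀) fun ε hε => ?_
    filter_upwards [ha ε hε] with y hy
    have h2 := (abs_le.1 hy).2
    have h3 := dist_nonneg (f y) T
    rw [neg_apply, coeffForm_apply]
    linarith
  rw [← coeffForm_apply, neg_eq_zero.1 h1, zero_apply]

lemma sum_inner_le {P R : Fin Q → Euc m} : |∑ i, inner ℝ (P i) (R i)| ≤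
    √(∑ i, ‖P i‖ ^ 2) * √(∑ i, ‖R i‖ ^ 2) := by
  calc |∑ i, inner ℝ (P i) (R i)| ≤ ∑ i, |inner ℝ (P i) (R i)| := Finset.abs_sum_le_sum_abs _ _
    _ ≤ ∑ i, ‖P i‖ * ‖R i‖ := Finset.sum_le_sum fun i _ => abs_real_inner_le_norm _ _
    _ ≤ _ := Real.sum_mul_le_sqrt_mul_sqrt _ _ _

/-- Cauchy-Schwarz in `dist_mul_grad_eq`, divided by the distance. Where the distance vanishes it
has a minimum, and its approximate gradient is zero. -/
lemma abs_grad_le {f : Euc n → AQ Q m} {x₀ : Euc n} {P : Fin Q → Euc m}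
    {L : Fin Q → (Euc n →L[ℝ] Euc m)} (hJ : HasApproxJetAt f x₀ (ofLabel fun i => (P i, L i)))
    {T : AQ Q m} {a : Fin n → ℝ} (ha : HasApproxGradAt (fun x => dist (f x) T) a x₀) (v : Euc n) :
    |∑ j, a j * v j| ≤ √(∑ i, ‖L i v‖ ^ 2) := by
  rcases (dist_nonneg (f x₀) T).eq_or_lt with h0 | h0
  · rw [grad_eq_zero_of_dist_eq_zero h0.symm ha v, abs_zero]
    exact Real.sqrt_nonneg _
  obtain ⟨s₀, rfl⟩ := exists_ofLabel T
  have hP : ofLabel P = f x₀ := by rw [← hJ.1, ofLabel_map]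
  obtain ⟨σ, hσ⟩ := exists_dist_ofLabel P s₀
  rw [hP, ← ofLabel_comp_perm s₀ σ] at hσ
  rw [← ofLabel_comp_perm s₀ σ] at ha h0
  have h1 := dist_mul_grad_eq hJ hσ ha v
  have h2 := sum_inner_le (P := fun i => P i - (s₀ ∘ σ) i) (R := fun i => L i v)
  rw [← h1, abs_mul, abs_of_pos h0] at h2
  refine le_of_mul_le_mul_left (h2.trans_eq ?_) h0
  rw [hσ]; rfl

/-- The bound of `abs_grad_le` is saturated: for T = ∑ ⟦P i - t L i v⟧ the differences P i - T i are
parallel to L i v, so Cauchy-Schwarz is an equality. Such T are approximated from the dense family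
with error η, and η tends to zero at fixed t. -/
lemma sqrt_energy_le {f : Euc n → AQ Q m} {x₀ : Euc n} {P : Fin Q → Euc m}
    {L : Fin Q → (Euc n →L[ℝ] Euc m)} (hJ : HasApproxJetAt f x₀ (ofLabel fun i => (P i, L i)))
    {a : (Fin Q → ℕ) → Fin n → ℝ}
    (ha : ∀ q, HasApproxGradAt (fun x => dist (f x) (ofLabel (denseLabel m Q q))) (a q) x₀)
    {v : Euc n} {C : ℝ} (hC : ∀ q, |∑ j, a q j * v j| ≤ C) : √(∑ i, ‖L i v‖ ^ 2) ≤ C := by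
  have hP : ofLabel P = f x₀ := by rw [← hJ.1, ofLabel_map]
  have hC0 : 0 ≤ C := (abs_nonneg _).trans (hC fun _ => 0)
  obtain ⟨δ, hδ0, hδ⟩ := exists_separation P
  set w := √(∑ i, ‖L i v‖ ^ 2) with hw
  have hw2 : w ^ 2 = ∑ i, ‖L i v‖ ^ 2 := Real.sq_sqrt (Finset.sum_nonneg fun _ _ => sq_nonneg _)
  have hw0 : 0 ≤ w := Real.sqrt_nonneg _
  have hLw : ∀ i, ‖L i v‖ ≤ w := fun i => Real.le_sqrt_of_sq_le
    (Finset.single_le_sum (f := fun i => ‖L i v‖ ^ 2) (fun _ _ => sq_nonneg _) (Finset.mem_univ i))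
  -- Small enough that each T i is within tw + η ≤ 2δ of P i, half the separation of distinct
  -- values, so the identity matching between P and T is optimal.
  set t := δ / (w + 1) with ht
  have ht0 : 0 < t := by positivity
  have htw : t * w ≤ δ := by
    rw [ht, div_mul_eq_mul_div, div_le_iff₀ (by positivity)]
    nlinarith
  set B := Q * C + Q * w with hB
  have key : ∀ η : ℝ, 0 < η → η < δ → t * w ^ 2 ≤ t * w * C + η * B := by
    intro η hη hηδ
    obtain ⟨q, hq⟩ := exists_denseLabel (fun i => P i - t • L i v) hη
    set T := denseLabel m Q q
    have hPT : ∀ i, ‖P i - T i‖ ≤ 2 * δ := by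
      intro i
      calc ‖P i - T i‖ = ‖t • L i v + (P i - t • L i v - T i)‖ := by congr 1; abel
        _ ≤ ‖t • L i v‖ + ‖P i - t • L i v - T i‖ := norm_add_le _ _
        _ ≤ t * w + η := by
            rw [norm_smul, Real.norm_of_nonneg ht0.le]
            have := hLw i
            have := (hq i).le
            gcongr
        _ ≤ 2 * δ := by linarith
    have hopt : dist (f x₀) (ofLabel T) = labelDist P T := by
      rw [← hP]
      refine le_antisymm (dist_ofLabel_le _ _) ?_
      obtain ⟨σ, hσ⟩ := exists_dist_ofLabel P T
      rw [hσ, ← labelDist_comp_perm P T σ]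
      refine Real.sqrt_le_sqrt (Finset.sum_le_sum fun i _ => ?_)
      simp only [Function.comp]
      by_cases hi : P i = P (σ i)
      · rw [hi]
      · have h1 := hδ i (σ i) hi
        have h2 : ‖P i - P (σ i)‖ ≤ ‖P i - T (σ i)‖ + ‖P (σ i) - T (σ i)‖ := by
          calc ‖P i - P (σ i)‖ = ‖(P i - T (σ i)) - (P (σ i) - T (σ i))‖ := by congr 1; abel
            _ ≤ _ := norm_sub_le _ _
        have h3 := hPT (σ i)
        gcongr
        linarith
    have h1 := dist_mul_grad_eq hJ hopt (ha q) v
    have h2 : labelDist P T ≤ t * w + Q * η := by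
      have h3 := labelDist_triangle P (fun i => P i - t • L i v) T
      have h4 : labelDist P (fun i => P i - t • L i v) = t * w := by
        rw [labelDist, hw]
        simp only [sub_sub_cancel, norm_smul, Real.norm_of_nonneg ht0.le, mul_pow]
        rw [← Finset.mul_sum, Real.sqrt_mul (by positivity), Real.sqrt_sq ht0.le]
      have h5 : labelDist (fun i => P i - t • L i v) T ≤ Q * η := by
        refine (labelDist_le_sum _ _).trans ?_
        calc ∑ i, ‖P i - t • L i v - T i‖ ≤ ∑ _i : Fin Q, η :=
              Finset.sum_le_sum fun i _ => (hq i).le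
          _ = Q * η := by simp
      linarith
    have h6 : t * w ^ 2 - η * (Q * w) ≤ ∑ i, inner ℝ (P i - T i) (L i v) := by
      have h7 : ∀ i, t * ‖L i v‖ ^ 2 - η * w ≤ inner ℝ (P i - T i) (L i v) := by
        intro i
        have h8 : P i - T i = t • L i v + (P i - t • L i v - T i) := by abel
        rw [h8, inner_add_left, real_inner_smul_left, real_inner_self_eq_norm_sq]
        have h9 := (abs_le.1 (abs_real_inner_le_norm (P i - t • L i v - T i) (L i v))).1
        have h10 : ‖P i - t • L i v - T i‖ * ‖L i v‖ ≤ η * w :=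
          mul_le_mul (hq i).le (hLw i) (norm_nonneg _) hη.le
        linarith
      calc t * w ^ 2 - η * (Q * w) = ∑ i, (t * ‖L i v‖ ^ 2 - η * w) := by
            rw [Finset.sum_sub_distrib, ← Finset.mul_sum, hw2]; simp; ring
        _ ≤ _ := Finset.sum_le_sum fun i _ => h7 i
    have h11 : dist (f x₀) (ofLabel T) * ∑ j, a q j * v j ≤ (t * w + Q * η) * C := by
      rw [hopt]
      calc labelDist P T * ∑ j, a q j * v j ≤ labelDist P T * C :=
            mul_le_mul_of_nonneg_left ((le_abs_self _).trans (hC q)) (labelDist_nonneg _ _)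
        _ ≤ _ := by gcongr
    rw [hB]
    nlinarith
  have h1 : t * w ^ 2 ≤ t * w * C := by
    refine le_of_forall_pos_le_add fun ε hε => ?_
    have hB0 : 0 ≤ B := by positivity
    have hη : 0 < min (δ / 2) (ε / (B + 1)) := by positivity
    have h2 := key _ hη ((min_le_left _ _).trans_lt (by linarith))
    have h3 : min (δ / 2) (ε / (B + 1)) * B ≤ ε := by
      have h4 : min (δ / 2) (ε / (B + 1)) * (B + 1) ≤ ε := by
        rw [← le_div_iff₀ (by positivity)]; exact min_le_right _ _
      nlinarith
    linarith
  by_contra! hlt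
  have hwpos : 0 < w := hC0.trans_lt hlt
  have : t * w * C < t * w * w := by gcongr
  nlinarith

lemma jet_spec {f : Euc n → AQ Q m} {x : Euc n} (h : ∃ J, HasApproxJetAt f x J) :
    HasApproxJetAt f x (jet f x) := by
  unfold jet
  rw [dif_pos h]
  exact h.choose_spec

lemma jetSum_ofLabel {f : Euc n → AQ Q m} {x : Euc n} {p : Fin Q → Euc m × (Euc n →L[ℝ] Euc m)}
    (h : ofLabel p = jet f x) (F : Euc m × (Euc n →L[ℝ] Euc m) → ℝ) :
    jetSum f x F = ∑ i, F (p i) := by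
  unfold jetSum
  rw [← h]
  exact sum_map_ofLabel p F

/-- Description of the energy density of a Sobolev `Q`-valued function by the weak gradients
of the functions `𝒢(f, T)`. -/
theorem MemW12.exists_gradients {Ω : Set (Euc n)} (hn : 0 < n) (hΩ : IsOpen Ω)
    {f : Euc n → AQ Q m} (hf : MemW12 Ω f) :
    ∃ (v : (Fin Q → ℕ) → Fin n → Euc n → ℝ) (v₀ g : Fin n → Euc n → ℝ),
      (∀ q j, AEStronglyMeasurable (v q j) (volume.restrict Ω)) ∧
      (∀ j, MemLp (g j) 2 (volume.restrict Ω)) ∧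
      (∀ j, HasWeakPartialDeriv Ω j (fun x => dist (f x) (zeroQ Q m)) (v₀ j)) ∧
      (∀ j, MemLp (v₀ j) 2 (volume.restrict Ω)) ∧
      ∀ᵐ x ∂(volume.restrict Ω),
        (∀ w : Euc n, IsLUB (Set.range fun q => |∑ j, v q j x * w j|) √(dirEnergy f x w)) ∧
        (∀ w : Euc n, dirPairing f x w = dist (f x) (zeroQ Q m) * ∑ j, v₀ j x * w j) ∧
        ∀ j, dirEnergy f x (EuclideanSpace.single j 1) ≤ g j x ^ 2 := by
  have hjet := hf.ae_exists_jet hn hΩ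
  obtain ⟨-, g, hg, hv⟩ := hf
  choose v hw hvg using fun q => hv (ofLabel (denseLabel m Q q))
  choose v₀ hw₀ hvg₀ using hv (zeroQ Q m)
  have hmeas : ∀ {u : Euc n → ℝ}, LocallyIntegrableOn u Ω → AEStronglyMeasurable u
      (volume.restrict Ω) := fun h => h.aestronglyMeasurable
  refine ⟨v, v₀, g, fun q j => hmeas (hw q j).2.1, hg, hw₀, fun j => ?_, ?_⟩
  · exact (hg j).mono (hmeas (hw₀ j).2.1) ((hvg₀ j).mono fun x hx => hx.trans (le_abs_self _))
  have h1 := ae_all_iff.2 fun q => ae_hasApproxGradAt hΩ (hw q) (hw q ⟨0, hn⟩).1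
  have h2 := ae_hasApproxGradAt hΩ hw₀ (hw₀ ⟨0, hn⟩).1
  have h3 := ae_all_iff.2 fun q => ae_all_iff.2 fun j => hvg q j
  filter_upwards [hjet, h1, h2, h3] with x hJ h1 h2 h3
  have hJ := jet_spec hJ
  obtain ⟨p, hp⟩ := exists_ofLabel (jet f x)
  have hJ' : HasApproxJetAt f x (ofLabel fun i => ((p i).1, (p i).2)) := by rwa [hp]
  have hE : ∀ w, dirEnergy f x w = ∑ i, ‖(p i).2 w‖ ^ 2 := fun w => jetSum_ofLabel hp _
  refine ⟨fun w => ⟨?_, ?_⟩, fun w => ?_, fun j => ?_⟩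
  · rintro _ ⟨q, rfl⟩
    rw [hE]
    exact abs_grad_le hJ' (h1 q) w
  · intro C hC
    rw [hE]
    exact sqrt_energy_le hJ' h1 fun q => hC ⟨q, rfl⟩
  · have hP : ofLabel (fun i => (p i).1) = f x := by rw [← hJ.1, ← hp, ofLabel_map]
    have hs : dist (f x) (ofLabel fun _ => 0) = labelDist (fun i => (p i).1) fun _ => 0 := by
      rw [← zeroQ_eq, ← hP, dist_zeroQ_ofLabel]
    rw [zeroQ_eq] at h2 ⊢
    rw [dist_mul_grad_eq hJ' hs h2 w, dirPairing, jetSum_ofLabel hp]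
    simp
  · have h4 : √(∑ i, ‖(p i).2 (EuclideanSpace.single j 1)‖ ^ 2) ≤ g j x := by
      refine sqrt_energy_le hJ' h1 fun q => ?_
      simpa using h3 q j
    rw [hE]
    exact (Real.sqrt_le_left ((Real.sqrt_nonneg _).trans h4)).1 h4

end QValued

/-! ### The weak derivative of a square -/

namespace ApproxCalc

open MeasureTheory Filter Topology Metric
open scoped ENNReal

variable {n : ℕ}

local notation "E" => EuclideanSpace ℝ (Fin n)

lemma measurePreserving_translate (z : E) :
    MeasurePreserving (fun x : E => x + z) volume volume := measurePreserving_add_right volume z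

/-- Correlations of square integrable functions are continuous. -/
lemma continuous_integral_mul_translate {a b : E → ℝ} (ha : MemLp a 2) (hb : MemLp b 2) (e : E) :
    Continuous fun s : ℝ => ∫ x, a x * b (x + s • e) := by
  let g : C(ℝ, C(E, E)) := ContinuousMap.curry ⟨fun p : ℝ × E => p.2 + p.1 • e, by fun_prop⟩
  have hg : ∀ s, MeasurePreserving (g s) volume volume := fun s =>
    measurePreserving_translate (s • e)
  have h1 : Continuous fun s : ℝ => Lp.compMeasurePreserving (g s) (hg s) (hb.toLp b) :=
    -- Translations act continuously on L².
    continuous_const.compMeasurePreservingLp g.continuous hg (by norm_num)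
  have h2 : Continuous fun s : ℝ =>
      inner ℝ (Lp.compMeasurePreserving (g s) (hg s) (hb.toLp b)) (ha.toLp a) :=
    h1.inner continuous_const
  refine h2.congr fun s => ?_
  rw [L2.inner_def]
  refine integral_congr_ae ?_
  have h3 := Lp.coeFn_compMeasurePreserving (hb.toLp b) (hg s)
  have h4 : (hb.toLp b) ∘ (g s) =ᵐ[volume] b ∘ (g s) :=
    (hg s).quasiMeasurePreserving.ae_eq_comp hb.coeFn_toLp
  filter_upwards [h3, h4, ha.coeFn_toLp] with x h5 h6 h7
  rw [h5, h6, h7]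
  rfl

lemma MemLp.comp_translate {b : E → ℝ} (hb : MemLp b 2) (z : E) :
    MemLp (fun x => b (x + z)) 2 := hb.comp_measurePreserving (measurePreserving_translate z)

/-- The increment formula, tested against a square integrable function. -/
lemma IsW11.integral_mul_sub_eq {U : E → ℝ} {V : Fin n → E → ℝ} (h : IsW11 U V)
    (hV : ∀ j, Measurable (V j)) (j : Fin n) (hU2 : MemLp U 2) (hV2 : MemLp (V j) 2)
    {a : E → ℝ} (ha : MemLp a 2) (ham : Measurable a) (s : ℝ) :
    (∫ x, a x * U (x + s • EuclideanSpace.single j 1)) - ∫ x, a x * U x =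
      s * ∫ t, (∫ x, a x * V j (x + (t * s) • EuclideanSpace.single j 1)) ∂unitMeasure := by
  set e : E := EuclideanSpace.single j 1
  have hI : Integrable (fun p : E × ℝ => a p.1 * V j (p.1 + (p.2 * s) • e))
      (volume.prod unitMeasure) := by
    rw [integrable_prod_iff' (by
      apply Measurable.aestronglyMeasurable
      exact (ham.comp measurable_fst).mul ((hV j).comp (by fun_prop)))]
    refine ⟨ae_of_all _ fun t =>
      ha.integrable_mul (MemLp.comp_translate hV2 ((t * s) • e)), ?_⟩
    have hc : Continuous fun t : ℝ => ∫ x, ‖a x‖ * ‖V j (x + (t * s) • e)‖ :=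
      (continuous_integral_mul_translate ha.norm hV2.norm e).comp (continuous_mul_const s)
    simp only [norm_mul]
    exact (hc.intervalIntegrable 0 1).1
  have h1 : ∀ᵐ x, U (x + s • e) - U x = s * ∫ t, V j (x + (t * s) • e) ∂unitMeasure := by
    filter_upwards [h.ae_sub_eq hV (s • e)] with x hx
    rw [hx.2, ← integral_const_mul]
    congr 1
    ext t
    rw [Finset.sum_eq_single j]
    · simp [e, smul_smul, mul_comm]
    · intro k _ hk
      simp [e, hk]
    · simp
  have i1 : Integrable fun x => a x * U (x + s • e) :=
    ha.integrable_mul (MemLp.comp_translate hU2 (s • e))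
  have i2 : Integrable fun x => a x * U x := ha.integrable_mul hU2
  rw [← integral_sub i1 i2]
  rw [← integral_integral_swap (f := fun x t => a x * V j (x + (t * s) • e)) hI,
    ← integral_const_mul]
  refine integral_congr_ae ?_
  filter_upwards [h1] with x hx
  rw [← mul_sub, hx, integral_const_mul]
  ring

lemma tendsto_integral_unit {c : ℝ → ℝ} (hc : Continuous c) :
    Tendsto (fun s => ∫ t, c (t * s) ∂unitMeasure) (𝓝 0) (𝓝 (c 0)) := by
  have h1 : Continuous fun s => ∫ t in (0:ℝ)..1, c (t * s) :=
    intervalIntegral.continuous_parametric_intervalIntegral_of_continuous' (f := fun s t => c (t * s))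
      (hc.comp (g := c) (f := fun p : ℝ × ℝ => p.2 * p.1) (by fun_prop)) 0 1
  have h2 := h1.tendsto 0
  simp only [mul_zero, intervalIntegral.integral_const, sub_zero, one_smul] at h2
  refine h2.congr fun s => ?_
  rw [intervalIntegral.integral_of_le zero_le_one]

/-- By the increment formula the difference quotient is the mean over t in (0, 1] of the correlation
of a with the translate of V by ts, and this correlation is continuous in the shift. -/
lemma IsW11.hasDerivAt_correlation {U : E → ℝ} {V : Fin n → E → ℝ} (h : IsW11 U V)
    (hV : ∀ j, Measurable (V j)) (j : Fin n) (hU2 : MemLp U 2) (hV2 : MemLp (V j) 2)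
    {a : E → ℝ} (ha : MemLp a 2) (ham : Measurable a) :
    HasDerivAt (fun s : ℝ => ∫ x, a x * U (x + s • EuclideanSpace.single j 1))
      (∫ x, a x * V j x) 0 := by
  rw [hasDerivAt_iff_tendsto_slope]
  have h1 := tendsto_integral_unit
    (continuous_integral_mul_translate ha hV2 (EuclideanSpace.single j 1))
  simp only [zero_smul, add_zero] at h1
  refine (h1.mono_left nhdsWithin_le_nhds).congr' ?_
  filter_upwards [self_mem_nhdsWithin] with s hs
  have hs : s ≠ 0 := hs
  rw [slope_def_field, sub_zero, zero_smul]
  simp only [add_zero]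
  rw [h.integral_mul_sub_eq hV j hU2 hV2 ha ham s, mul_div_cancel_left₀ _ hs]

lemma MemLp.continuous_mul {χ b : E → ℝ} (hχ : Continuous χ) (hc : HasCompactSupport χ)
    (hb : MemLp b 2) : MemLp (fun x => χ x * b x) 2 := by
  obtain ⟨C, hC⟩ := hc.exists_bound_of_continuous hχ
  refine hb.of_le_mul (c := C) (hχ.aestronglyMeasurable.mul hb.1) (ae_of_all _ fun x => ?_)
  rw [norm_mul]
  exact mul_le_mul_of_nonneg_right (hC x) (norm_nonneg _)

/-- The weak derivative of the square of a function. -/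
lemma IsW11.integral_sq_mul_fderiv {U : E → ℝ} {V : Fin n → E → ℝ} (h : IsW11 U V)
    (hU : Measurable U) (hV : ∀ j, Measurable (V j)) (j : Fin n) (hU2 : MemLp U 2)
    (hV2 : MemLp (V j) 2) {χ : E → ℝ} (hχ : ContDiff ℝ (⊤ : ℕ∞) χ) (hc : HasCompactSupport χ) :
    ∫ x, U x ^ 2 * fderiv ℝ χ x (EuclideanSpace.single j 1) = - ∫ x, 2 * U x * V j x * χ x := by
  set e : E := EuclideanSpace.single j 1 with he
  have hw : ∀ j, QValued.HasWeakPartialDeriv Set.univ j U (V j) := fun j =>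
    ⟨h.integrable.locallyIntegrable.locallyIntegrableOn _,
      (h.integrable_deriv j).locallyIntegrable.locallyIntegrableOn _,
      fun χ h1 h2 _ => by simpa using h.integral_eq j χ h1 h2⟩
  have hW := isW11_cutoff hw hχ hc (Set.subset_univ _)
    (h.integrable.locallyIntegrable.locallyIntegrableOn _)
  have hχU2 : MemLp (fun x => χ x * U x) 2 := MemLp.continuous_mul hχ.continuous hc hU2
  have hd1 := h.hasDerivAt_correlation hV j hU2 hV2 hχU2 (hχ.continuous.measurable.mul hU)
  have hA : MemLp (fun x => χ x * V j x) 2 := MemLp.continuous_mul hχ.continuous hc hV2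
  have hB : MemLp (fun x => fderiv ℝ χ x e * U x) 2 :=
    MemLp.continuous_mul (continuous_fderiv_apply hχ _) (hasCompactSupport_fderiv_apply hc _) hU2
  have hd2 := hW.hasDerivAt_correlation (fun j => ((hχ.continuous.measurable.mul (hV j)).add
    ((continuous_fderiv_apply hχ _).measurable.mul hU))) j hχU2 (hA.add hB) hU2 hU
  -- Translation invariance moves the shift to the other factor with opposite sign. Differentiating
  -- both forms at 0 gives ∫ χUV = -∫ U(χV + U∂χ), which is the claim; no mollification or chain
  -- rule is needed.
  have heq : (fun s : ℝ => ∫ x, χ x * U x * U (x + s • e)) =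
      fun s => ∫ x, U x * (χ (x + (-s) • e) * U (x + (-s) • e)) := by
    ext s
    rw [← integral_sub_right_eq_self (fun x => χ x * U x * U (x + s • e)) (s • e)]
    congr 1
    ext x
    simp only [sub_add_cancel, neg_smul, ← sub_eq_add_neg]
    ring
  have hd3 : HasDerivAt (fun s : ℝ => ∫ x, U x * (χ (x + (-s) • e) * U (x + (-s) • e)))
      ((∫ x, U x * (χ x * V j x + fderiv ℝ χ x e * U x)) * (-1)) 0 :=
    HasDerivAt.comp (h₂ := fun s : ℝ => ∫ x, U x * (χ (x + s • e) * U (x + s • e))) 0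
      (by rw [neg_zero]; exact hd2) (hasDerivAt_neg 0)
  rw [heq] at hd1
  have key := hd1.unique hd3
  have e1 : ∫ x, U x * (χ x * V j x + fderiv ℝ χ x e * U x) =
      (∫ x, χ x * U x * V j x) + ∫ x, U x ^ 2 * fderiv ℝ χ x e := by
    have i1 : Integrable fun x => χ x * U x * V j x := hχU2.integrable_mul hV2
    have i2 : Integrable fun x => U x ^ 2 * fderiv ℝ χ x e := by
      refine (hU2.integrable_mul hB).congr (ae_of_all _ fun x => ?_)
      simp only [Pi.mul_apply]; ring
    rw [← integral_add i1 i2]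
    congr 1; ext x; ring
  have e2 : ∫ x, 2 * U x * V j x * χ x = 2 * ∫ x, χ x * U x * V j x := by
    rw [← integral_const_mul]
    congr 1; ext x; ring
  rw [e1] at key
  rw [e2]
  linarith

lemma exists_cutoff {Ω K : Set E} (hΩ : IsOpen Ω) (hK : IsCompact K) (hKΩ : K ⊆ Ω) :
    ∃ ζ : E → ℝ, ContDiff ℝ (⊤ : ℕ∞) ζ ∧ HasCompactSupport ζ ∧ tsupport ζ ⊆ Ω ∧
      ∀ x ∈ K, ζ x = 1 := by
  obtain ⟨K', hK', hKK', hK'Ω⟩ := exists_compact_between hK hΩ hKΩ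
  obtain ⟨ζ, h0, h1, -⟩ := exists_contMDiffMap_zero_one_of_isClosed (n := (⊤ : ℕ∞))
    (modelWithCornersSelf ℝ E) (s := (interior K')ᶜ) (t := K) isOpen_interior.isClosed_compl
    hK.isClosed (Set.disjoint_compl_left_iff_subset.2 hKK')
  have hts : tsupport ζ ⊆ K' := by
    refine closure_minimal ?_ hK'.isClosed
    intro x hx
    by_contra hcon
    exact hx (h0 fun h => hcon (interior_subset h))
  exact ⟨ζ, ζ.contMDiff.contDiff, hK'.of_isClosed_subset (isClosed_tsupport _) hts,
    hts.trans hK'Ω, fun x hx => h1 hx⟩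

/-- The weak derivative of the square of a function on an open set. -/
theorem setIntegral_sq_mul_fderiv {Ω : Set E} (hΩ : IsOpen Ω) {u : E → ℝ} {v : Fin n → E → ℝ}
    (hw : ∀ j, QValued.HasWeakPartialDeriv Ω j u (v j)) (hu2 : MemLp u 2 (volume.restrict Ω))
    (hv2 : ∀ j, MemLp (v j) 2 (volume.restrict Ω)) (j : Fin n) {χ : E → ℝ}
    (hχ : ContDiff ℝ (⊤ : ℕ∞) χ) (hc : HasCompactSupport χ) (hs : tsupport χ ⊆ Ω) :
    ∫ x in Ω, u x ^ 2 * fderiv ℝ χ x (EuclideanSpace.single j 1) =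
      - ∫ x in Ω, 2 * u x * v j x * χ x := by
  obtain ⟨ζ, hζ, hζc, hζs, hζ1⟩ := exists_cutoff hΩ hc hs
  have h := isW11_cutoff hw hζ hζc hζs (hw j).1
  have hmem : ∀ {θ b : E → ℝ}, Continuous θ → HasCompactSupport θ → (∀ x ∉ Ω, θ x = 0) →
      MemLp b 2 (volume.restrict Ω) → MemLp (fun x => θ x * b x) 2 := by
    intro θ b hθ hθc hθ0 hb
    have h1 := MemLp.continuous_mul hθ hθc ((memLp_indicator_iff_restrict hΩ.measurableSet).2 hb)
    refine h1.ae_eq (ae_of_all _ fun x => ?_)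
    by_cases hx : x ∈ Ω
    · simp [hx]
    · simp [hx, hθ0 x hx]
  have hzero : ∀ x ∉ Ω, ζ x = 0 := fun x hx =>
    image_eq_zero_of_notMem_tsupport fun h => hx (hζs h)
  have hzero' : ∀ x ∉ Ω, fderiv ℝ ζ x = 0 := fun x hx =>
    image_eq_zero_of_notMem_tsupport fun h => hx (hζs (tsupport_fderiv_subset ℝ h))
  have hU2 := hmem hζ.continuous hζc hzero hu2
  have hV2 : ∀ j, MemLp (fun x => ζ x * v j x + fderiv ℝ ζ x (EuclideanSpace.single j 1) * u x) 2 :=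
    fun j => (hmem hζ.continuous hζc hzero (hv2 j)).add (hmem (continuous_fderiv_apply hζ _)
      (hasCompactSupport_fderiv_apply hζc _) (fun x hx => by simp [hzero' x hx]) hu2)
  have hUm := h.integrable.1.stronglyMeasurable_mk.measurable
  have hVm := fun j => (h.integrable_deriv j).1.stronglyMeasurable_mk.measurable
  have heU := h.integrable.1.ae_eq_mk
  have heV := fun j => (h.integrable_deriv j).1.ae_eq_mk
  have key := (h.congr heU heV).integral_sq_mul_fderiv hUm hVm j (hU2.ae_eq heU)
    ((hV2 j).ae_eq (heV j)) hχ hc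
  have hd0 : ∀ x ∉ tsupport χ, fderiv ℝ χ x = 0 := fun x hx =>
    image_eq_zero_of_notMem_tsupport fun h => hx (tsupport_fderiv_subset ℝ h)
  have hdζ : ∀ x, χ x ≠ 0 → fderiv ℝ ζ x = 0 := by
    intro x hx
    have : ζ =ᶠ[𝓝 x] fun _ => 1 := by
      filter_upwards [(hχ.continuous.isOpen_support).mem_nhds hx] with y hy
      exact hζ1 y (subset_tsupport _ hy)
    rw [this.fderiv_eq]; simp
  rw [setIntegral_eq_integral_of_forall_compl_eq_zero,
    setIntegral_eq_integral_of_forall_compl_eq_zero]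
  · refine Eq.trans (integral_congr_ae ?_) (key.trans (congrArg _ (integral_congr_ae ?_)))
    · filter_upwards [heU] with x hx
      rw [← hx]
      by_cases hxs : x ∈ tsupport χ
      · rw [hζ1 x hxs, one_mul]
      · simp [hd0 x hxs]
    · filter_upwards [heU, heV j] with x hx hx'
      rw [← hx, ← hx']
      by_cases hxs : χ x = 0
      · simp [hxs]
      · simp [hζ1 x (subset_tsupport _ hxs), hdζ x hxs]
  · intro x hx
    simp [image_eq_zero_of_notMem_tsupport fun h => hx (hs h)]
  · intro x hx
    simp [hd0 x fun h => hx (hs h)]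

end ApproxCalc

/-! ### Energy density: pointwise bounds, measurability, integrability -/

namespace QValued

open MeasureTheory Filter Topology Metric ApproxCalc
open scoped ENNReal

variable {n m Q : ℕ}

/-- The Dirichlet energy density `|Df|²`. -/
noncomputable def energyDensity (f : Euc n → AQ Q m) (x : Euc n) : ℝ :=
  jetSum f x fun p => hs p.2 p.2

lemma map_eq_sum_single (L : Euc n →L[ℝ] Euc m) (z : Euc n) :
    L z = ∑ j, z j • L (EuclideanSpace.single j 1) := by
  conv_lhs => rw [← (EuclideanSpace.basisFun (Fin n) ℝ).sum_repr z]
  simp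

lemma hs_self (L : Euc n →L[ℝ] Euc m) : hs L L = ∑ j, ‖L (EuclideanSpace.single j 1)‖ ^ 2 := by
  simp [hs]

lemma hs_self_nonneg (L : Euc n →L[ℝ] Euc m) : 0 ≤ hs L L := by
  rw [hs_self]; exact Finset.sum_nonneg fun _ _ => sq_nonneg _

lemma norm_sq_apply_le_hs (L : Euc n →L[ℝ] Euc m) (z : Euc n) :
    ‖L z‖ ^ 2 ≤ hs L L * ‖z‖ ^ 2 := by
  have h1 : ‖L z‖ ≤ ∑ j, ‖z j‖ * ‖L (EuclideanSpace.single j 1)‖ := by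
    rw [map_eq_sum_single L z]
    refine (norm_sum_le _ _).trans (le_of_eq ?_)
    simp only [norm_smul]
  calc ‖L z‖ ^ 2 ≤ (∑ j, ‖z j‖ * ‖L (EuclideanSpace.single j 1)‖) ^ 2 := by gcongr
    _ ≤ (∑ j, ‖z j‖ ^ 2) * ∑ j, ‖L (EuclideanSpace.single j 1)‖ ^ 2 :=
        Finset.sum_mul_sq_le_sq_mul_sq _ _ _
    _ = hs L L * ‖z‖ ^ 2 := by rw [EuclideanSpace.norm_sq_eq, hs_self, mul_comm]

section Pointwise

variable (f : Euc n → AQ Q m) (x : Euc n)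

lemma energyDensity_nonneg : 0 ≤ energyDensity f x := by
  obtain ⟨p, hp⟩ := exists_ofLabel (jet f x)
  rw [energyDensity, jetSum_ofLabel hp]
  exact Finset.sum_nonneg fun i _ => hs_self_nonneg _

lemma dirEnergy_nonneg (w : Euc n) : 0 ≤ dirEnergy f x w := by
  obtain ⟨p, hp⟩ := exists_ofLabel (jet f x)
  rw [dirEnergy, jetSum_ofLabel hp]
  exact Finset.sum_nonneg fun i _ => sq_nonneg _

lemma dirEnergy_le (w : Euc n) : dirEnergy f x w ≤ energyDensity f x * ‖w‖ ^ 2 := by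
  obtain ⟨p, hp⟩ := exists_ofLabel (jet f x)
  rw [dirEnergy, energyDensity, jetSum_ofLabel hp, jetSum_ofLabel hp, Finset.sum_mul]
  exact Finset.sum_le_sum fun i _ => norm_sq_apply_le_hs _ _

lemma energyDensity_eq_sum :
    energyDensity f x = ∑ j, dirEnergy f x (EuclideanSpace.single j 1) := by
  obtain ⟨p, hp⟩ := exists_ofLabel (jet f x)
  simp only [dirEnergy, energyDensity, jetSum_ofLabel hp, hs_self]
  exact Finset.sum_comm

lemma normSq_eq_jetSum : normSq (f x) = jetSum f x fun p => ‖p.1‖ ^ 2 := by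
  have hfst : (jet f x).map Prod.fst = f x := by
    by_cases h : ∃ J, HasApproxJetAt f x J
    · exact (jet_spec h).1
    -- The default jet carries the points of f with zero differentials, so the identity holds at
    -- every x.
    · unfold jet
      rw [dif_neg h, Sym.map_map]
      exact Sym.map_id _
  obtain ⟨p, hp⟩ := exists_ofLabel (jet f x)
  rw [jetSum_ofLabel hp, ← hfst, ← hp, ofLabel_map, normSq_ofLabel]

lemma dirPairing_sq_le (w : Euc n) :
    dirPairing f x w ^ 2 ≤ normSq (f x) * dirEnergy f x w := by
  rw [normSq_eq_jetSum]
  obtain ⟨p, hp⟩ := exists_ofLabel (jet f x)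
  rw [dirPairing, dirEnergy, jetSum_ofLabel hp, jetSum_ofLabel hp, jetSum_ofLabel hp]
  have h1 := sum_inner_le (P := fun i => (p i).1) (R := fun i => (p i).2 w)
  calc (∑ i, inner ℝ (p i).1 ((p i).2 w)) ^ 2 = |∑ i, inner ℝ (p i).1 ((p i).2 w)| ^ 2 :=
        (sq_abs _).symm
    _ ≤ (√(∑ i, ‖(p i).1‖ ^ 2) * √(∑ i, ‖(p i).2 w‖ ^ 2)) ^ 2 := by gcongr
    _ = _ := by
        rw [mul_pow, Real.sq_sqrt (Finset.sum_nonneg fun _ _ => sq_nonneg _),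
          Real.sq_sqrt (Finset.sum_nonneg fun _ _ => sq_nonneg _)]

end Pointwise

section Integrability

variable {Ω : Set (Euc n)} {f : Euc n → AQ Q m}

lemma MemW12.integrableOn_normSq (hf : MemW12 Ω f) : IntegrableOn (fun x => normSq (f x)) Ω := by
  have := hf.1.integrable_sq
  simp only [dist_zeroQ_sq] at this
  exact this

/-- The jet is chosen pointwise, so measurability is not evident from the definition. It comes from
writing the square root of the energy a.e. as a countable supremum of measurable functions. -/
lemma MemW12.aestronglyMeasurable_dirEnergy (hn : 0 < n) (hΩ : IsOpen Ω) (hf : MemW12 Ω f)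
    {X : Euc n → Euc n} (hX : Measurable X) :
    AEStronglyMeasurable (fun x => dirEnergy f x (X x)) (volume.restrict Ω) := by
  obtain ⟨v, v₀, g, hv, -, -, -, hae⟩ := hf.exists_gradients hn hΩ
  have h1 : AEMeasurable (fun x => √(dirEnergy f x (X x))) (volume.restrict Ω) := by
    refine AEMeasurable.isLUB (f := fun q x => |∑ j, v q j x * X x j|) (fun q => ?_) ?_
    · apply AEStronglyMeasurable.aemeasurable
      have h2 : AEStronglyMeasurable (fun x => ∑ j, v q j x * X x j) (volume.restrict Ω) :=
        Finset.aestronglyMeasurable_fun_sum _ fun j _ => (hv q j).mul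
          (Measurable.aestronglyMeasurable (by fun_prop))
      exact h2.norm
    · filter_upwards [hae] with x hx
      exact hx.1 (X x)
  have h3 := (h1.pow_const 2).aestronglyMeasurable
  refine h3.congr (ae_of_all _ fun x => ?_)
  exact Real.sq_sqrt (dirEnergy_nonneg f x _)

lemma MemW12.aestronglyMeasurable_dirPairing (hn : 0 < n) (hΩ : IsOpen Ω) (hf : MemW12 Ω f)
    {X : Euc n → Euc n} (hX : Measurable X) :
    AEStronglyMeasurable (fun x => dirPairing f x (X x)) (volume.restrict Ω) := by
  obtain ⟨v, v₀, g, -, -, -, hv₀, hae⟩ := hf.exists_gradients hn hΩ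
  have h2 : AEStronglyMeasurable
      (fun x => dist (f x) (zeroQ Q m) * ∑ j, v₀ j x * X x j) (volume.restrict Ω) :=
    hf.1.1.mul (Finset.aestronglyMeasurable_fun_sum _ fun j _ => (hv₀ j).1.mul
          (Measurable.aestronglyMeasurable (by fun_prop)))
  refine h2.congr ?_
  filter_upwards [hae] with x hx
  exact (hx.2.1 (X x)).symm

/-- The density is dominated by ∑ g_j², where g_j are the bounds in the definition of the Sobolev
space. -/
lemma MemW12.integrableOn_energyDensity (hn : 0 < n) (hΩ : IsOpen Ω) (hf : MemW12 Ω f) :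
    IntegrableOn (energyDensity f) Ω := by
  have hm : AEStronglyMeasurable (energyDensity f) (volume.restrict Ω) := by
    have : energyDensity f = fun x => ∑ j, dirEnergy f x (EuclideanSpace.single j 1) :=
      funext fun x => energyDensity_eq_sum f x
    rw [this]
    exact Finset.aestronglyMeasurable_fun_sum _ fun j _ =>
      hf.aestronglyMeasurable_dirEnergy hn hΩ (X := fun _ => EuclideanSpace.single j 1)
        measurable_const
  obtain ⟨v, v₀, g, -, hg, -, -, hae⟩ := hf.exists_gradients hn hΩ
  have hgi : Integrable (fun x => ∑ j, g j x ^ 2) (volume.restrict Ω) :=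
    integrable_finsetSum _ fun j _ => (hg j).integrable_sq
  refine Integrable.mono' hgi hm ?_
  filter_upwards [hae] with x hx
  rw [Real.norm_of_nonneg (energyDensity_nonneg f x), energyDensity_eq_sum]
  exact Finset.sum_le_sum fun j _ => hx.2.2 j

/-- The weak derivative of `|f|²`. -/
lemma MemW12.integral_normSq_mul_fderiv (hn : 0 < n) (hΩ : IsOpen Ω) (hf : MemW12 Ω f) (j : Fin n)
    {χ : Euc n → ℝ} (hχ : ContDiff ℝ (⊤ : ℕ∞) χ) (hc : HasCompactSupport χ)
    (hs : tsupport χ ⊆ Ω) :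
    ∫ x in Ω, normSq (f x) * fderiv ℝ χ x (EuclideanSpace.single j 1) =
      - ∫ x in Ω, 2 * χ x * dirPairing f x (EuclideanSpace.single j 1) := by
  obtain ⟨v, v₀, g, -, -, hw, hv₀, hae⟩ := hf.exists_gradients hn hΩ
  have key := setIntegral_sq_mul_fderiv hΩ hw hf.1 hv₀ j hχ hc hs
  simp only [dist_zeroQ_sq] at key
  rw [key]
  congr 1
  refine integral_congr_ae ?_
  filter_upwards [hae] with x hx
  rw [hx.2.1]
  simp
  ring

lemma integrable_mul_of_bounded {b χ : Euc n → ℝ} (hb : IntegrableOn b Ω) (hχ : Continuous χ)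
    {C : ℝ} (hC : ∀ x, |χ x| ≤ C) : IntegrableOn (fun x => χ x * b x) Ω :=
  Integrable.bdd_mul hb hχ.aestronglyMeasurable (ae_of_all _ hC)

lemma MemW12.integrableOn_mul_dirEnergy (hn : 0 < n) (hΩ : IsOpen Ω) (hf : MemW12 Ω f)
    {X : Euc n → Euc n} (hX : Measurable X) {χ : Euc n → ℝ} (hχ : Continuous χ) {C : ℝ}
    (hC : ∀ x, |χ x| * ‖X x‖ ^ 2 ≤ C) :
    IntegrableOn (fun x => χ x * dirEnergy f x (X x)) Ω := by
  refine Integrable.mono' ((hf.integrableOn_energyDensity hn hΩ).const_mul C)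
    (hχ.aestronglyMeasurable.mul (hf.aestronglyMeasurable_dirEnergy hn hΩ hX))
    (ae_of_all _ fun x => ?_)
  rw [norm_mul, Real.norm_eq_abs, Real.norm_of_nonneg (dirEnergy_nonneg f x _)]
  calc |χ x| * dirEnergy f x (X x) ≤ |χ x| * (energyDensity f x * ‖X x‖ ^ 2) := by
        gcongr; exact dirEnergy_le f x _
    _ = (|χ x| * ‖X x‖ ^ 2) * energyDensity f x := by ring
    _ ≤ C * energyDensity f x := by
        gcongr
        · exact energyDensity_nonneg f x
        · exact hC x

lemma MemW12.integrableOn_mul_dirPairing (hn : 0 < n) (hΩ : IsOpen Ω) (hf : MemW12 Ω f)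
    {X : Euc n → Euc n} (hX : Measurable X) {χ : Euc n → ℝ} (hχ : Continuous χ) {C C' : ℝ}
    (hC : ∀ x, |χ x| * ‖X x‖ ^ 2 ≤ C) (hC' : ∀ x, |χ x| ≤ C') :
    IntegrableOn (fun x => χ x * dirPairing f x (X x)) Ω := by
  have h1 := hf.integrableOn_mul_dirEnergy hn hΩ hX hχ hC
  have h2 := integrable_mul_of_bounded hf.integrableOn_normSq hχ hC'
  refine Integrable.mono (h1.norm.add h2.norm)
    (hχ.aestronglyMeasurable.mul (hf.aestronglyMeasurable_dirPairing hn hΩ hX))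
    (ae_of_all _ fun x => ?_)
  have h3 := dirPairing_sq_le f x (X x)
  have h4 := dirEnergy_nonneg f x (X x)
  have h5 := normSq_nonneg (f x)
  have h6 : |dirPairing f x (X x)| ≤ dirEnergy f x (X x) + normSq (f x) := by
    refine abs_le_of_sq_le_sq ?_ (by positivity)
    nlinarith
  simp only [Pi.add_apply, norm_mul, Real.norm_eq_abs]
  rw [abs_of_nonneg h4, abs_of_nonneg h5, ← mul_add]
  refine le_trans ?_ (le_abs_self _)
  gcongr

end Integrability

end QValued

/-! ### Variation identities for radial test functions -/

namespace QValued

open MeasureTheory Filter Topology Metric ApproxCalc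
open scoped ENNReal

variable {n m Q : ℕ}

/-- A smooth function with compact support in `Ω` whose gradient at `y` is `c y • (y - x₁)`. -/
structure IsRadialTest (Ω : Set (Euc n)) (x₁ : Euc n) (η c : Euc n → ℝ) : Prop where
  contDiff : ContDiff ℝ (⊤ : ℕ∞) η
  hasCompactSupport : HasCompactSupport η
  tsupport_subset : tsupport η ⊆ Ω
  continuous : Continuous c
  bounded : ∃ C, ∀ y, |c y| ≤ C
  fderiv_eq : ∀ y z, fderiv ℝ η y z = c y * inner ℝ (y - x₁) z

namespace IsRadialTest

variable {Ω : Set (Euc n)} {x₁ : Euc n} {η c : Euc n → ℝ}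

lemma exists_bound (h : IsRadialTest Ω x₁ η c) : ∃ C, ∀ y, |η y| ≤ C :=
  h.hasCompactSupport.exists_bound_of_continuous h.contDiff.continuous

lemma exists_bound_deriv (h : IsRadialTest Ω x₁ η c) : ∃ C, ∀ y, |c y| * ‖y - x₁‖ ^ 2 ≤ C := by
  have h1 : Continuous fun y => fderiv ℝ η y (y - x₁) :=
    (h.contDiff.continuous_fderiv (by simp)).clm_apply (by fun_prop)
  have h2 : HasCompactSupport fun y => fderiv ℝ η y (y - x₁) := by
    refine (h.hasCompactSupport.fderiv ℝ).mono fun y hy => ?_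
    intro h0
    exact hy (by simp [h0])
  obtain ⟨C, hC⟩ := h2.exists_bound_of_continuous h1
  refine ⟨C, fun y => ?_⟩
  have := hC y
  rwa [h.fderiv_eq, real_inner_self_eq_norm_sq, norm_mul, Real.norm_eq_abs, Real.norm_eq_abs,
    abs_of_nonneg (sq_nonneg ‖y - x₁‖)] at this

lemma exists_bound_mul (h : IsRadialTest Ω x₁ η c) : ∃ C, ∀ y, |η y| * ‖y - x₁‖ ^ 2 ≤ C := by
  obtain ⟨C, hC⟩ := (h.hasCompactSupport.mul_right
    (f' := fun y => ‖y - x₁‖ ^ 2)).exists_bound_of_continuous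
    (h.contDiff.continuous.mul (by fun_prop))
  refine ⟨C, fun y => ?_⟩
  have := hC y
  rwa [Pi.mul_apply, norm_mul, Real.norm_eq_abs, Real.norm_eq_abs,
    abs_of_nonneg (sq_nonneg ‖y - x₁‖)] at this

end IsRadialTest

lemma jetSum_add (f : Euc n → AQ Q m) (x : Euc n) (F G : Euc m × (Euc n →L[ℝ] Euc m) → ℝ) :
    jetSum f x (fun p => F p + G p) = jetSum f x F + jetSum f x G := by
  unfold jetSum; exact Multiset.sum_map_add

lemma jetSum_const_mul (f : Euc n → AQ Q m) (x : Euc n) (a : ℝ)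
    (F : Euc m × (Euc n →L[ℝ] Euc m) → ℝ) :
    jetSum f x (fun p => a * F p) = a * jetSum f x F := by
  unfold jetSum; exact Multiset.sum_map_mul_left

lemma sum_mul_inner_single (L : Euc n →L[ℝ] Euc m) (z : Euc n) (w : Euc m) :
    ∑ j, z j * inner ℝ (L (EuclideanSpace.single j 1)) w = inner ℝ w (L z) := by
  rw [map_eq_sum_single L z, inner_sum]
  refine Finset.sum_congr rfl fun j _ => ?_
  rw [real_inner_smul_right, real_inner_comm]

lemma inner_single_right (z : Euc n) (j : Fin n) :
    inner ℝ z (EuclideanSpace.single j (1 : ℝ)) = z j := by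
  simp [EuclideanSpace.inner_single_right]

variable {Ω : Set (Euc n)} {f : Euc n → AQ Q m} {x₁ : Euc n} {η c : Euc n → ℝ}

/-- As ψ is linear in u, the growth conditions reduce to bounds on η and its gradient. -/
lemma IsRadialTest.isOuterTest (h : IsRadialTest Ω x₁ η c) :
    IsOuterTest Ω (fun p : Euc n × Euc m => η p.1 • p.2) := by
  obtain ⟨C₁, hC₁⟩ := h.exists_bound
  obtain ⟨C₂, hC₂⟩ := (h.hasCompactSupport.fderiv ℝ).exists_bound_of_continuous
    (h.contDiff.continuous_fderiv (by simp))
  have hC₁0 : 0 ≤ C₁ := (abs_nonneg _).trans (hC₁ 0)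
  have hC₂0 : 0 ≤ C₂ := (norm_nonneg _).trans (hC₂ 0)
  refine ⟨(h.contDiff.comp contDiff_fst).smul contDiff_snd, ⟨tsupport η, h.hasCompactSupport,
    h.tsupport_subset, fun x hx u => ?_⟩, C₁ + C₂, fun x u => ⟨?_, ?_⟩⟩
  · simp [image_eq_zero_of_notMem_tsupport hx]
  · have h1 : fderiv ℝ (fun w : Euc m => η x • w) u = η x • ContinuousLinearMap.id ℝ (Euc m) :=
      (η x • ContinuousLinearMap.id ℝ (Euc m)).hasFDerivAt.fderiv
    change ‖fderiv ℝ (fun w : Euc m => η x • w) u‖ ≤ _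
    rw [h1, norm_smul]
    calc ‖η x‖ * ‖ContinuousLinearMap.id ℝ (Euc m)‖ ≤ C₁ * 1 := by
          gcongr
          · exact hC₁ x
          · exact ContinuousLinearMap.norm_id_le
      _ ≤ C₁ + C₂ := by linarith
  · have h1 : fderiv ℝ (fun y : Euc n => η y • u) x = (fderiv ℝ η x).smulRight u :=
      ((h.contDiff.differentiable (by simp) x).hasFDerivAt.smul_const u).fderiv
    change ‖η x • u‖ + ‖fderiv ℝ (fun y : Euc n => η y • u) x‖ ≤ _
    rw [h1, norm_smul, ContinuousLinearMap.norm_smulRight_apply]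
    have h2 : ‖η x‖ * ‖u‖ ≤ C₁ * ‖u‖ := by gcongr; exact hC₁ x
    have h3 : ‖fderiv ℝ η x‖ * ‖u‖ ≤ C₂ * ‖u‖ := by gcongr; exact hC₂ x
    nlinarith [norm_nonneg u]

/-- The outer variation with `ψ(x, u) = η(x) u`. -/
lemma IsDirStationary.outer_identity (hn : 0 < n) (hΩ : IsOpen Ω) (hf : IsDirStationary Ω f)
    (h : IsRadialTest Ω x₁ η c) :
    ∫ y in Ω, η y * energyDensity f y = - ∫ y in Ω, c y * dirPairing f y (y - x₁) := by
  have key := hf.2.1 _ h.isOuterTest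
  rw [outerVariation] at key
  have hpt : ∀ x, jetSum f x (fun p =>
      hs p.2 (fderiv ℝ (fun y => (fun p : Euc n × Euc m => η p.1 • p.2) (y, p.1)) x) +
      hs p.2 ((fderiv ℝ (fun u => (fun p : Euc n × Euc m => η p.1 • p.2) (x, u)) p.1).comp p.2)) =
      c x * dirPairing f x (x - x₁) + η x * energyDensity f x := by
    intro x
    rw [jetSum_add, dirPairing, energyDensity, ← jetSum_const_mul, ← jetSum_const_mul]
    congr 1
    · congr 1
      ext p
      have h1 : fderiv ℝ (fun y : Euc n => η y • p.1) x = (fderiv ℝ η x).smulRight p.1 :=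
        ((h.contDiff.differentiable (by simp) x).hasFDerivAt.smul_const p.1).fderiv
      change hs p.2 (fderiv ℝ (fun y : Euc n => η y • p.1) x) = _
      rw [h1, hs, ← sum_mul_inner_single, Finset.mul_sum]
      refine Finset.sum_congr rfl fun j _ => ?_
      rw [ContinuousLinearMap.smulRight_apply, real_inner_smul_right, h.fderiv_eq,
        inner_single_right]
      ring
    · congr 1
      ext p
      have h1 : fderiv ℝ (fun w : Euc m => η x • w) p.1 = η x • ContinuousLinearMap.id ℝ (Euc m) :=
        (η x • ContinuousLinearMap.id ℝ (Euc m)).hasFDerivAt.fderiv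
      change hs p.2 ((fderiv ℝ (fun w : Euc m => η x • w) p.1).comp p.2) = _
      rw [h1, hs, hs, Finset.mul_sum]
      refine Finset.sum_congr rfl fun j _ => ?_
      simp [real_inner_smul_right]
  simp only [hpt] at key
  obtain ⟨C₁, hC₁⟩ := h.exists_bound
  obtain ⟨C₂, hC₂⟩ := h.bounded
  obtain ⟨C₃, hC₃⟩ := h.exists_bound_deriv
  rw [integral_add (hf.1.integrableOn_mul_dirPairing hn hΩ (X := fun y => y - x₁) (by fun_prop)
    h.continuous hC₃ hC₂) (integrable_mul_of_bounded (hf.1.integrableOn_energyDensity hn hΩ)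
    h.contDiff.continuous hC₁)] at key
  linarith

/-- The inner variation with `φ(y) = η(y) (y - x₁)`. -/
lemma IsDirStationary.inner_identity (hn : 0 < n) (hΩ : IsOpen Ω) (hf : IsDirStationary Ω f)
    (h : IsRadialTest Ω x₁ η c) :
    ((n : ℝ) - 2) * ∫ y in Ω, η y * energyDensity f y =
      2 * (∫ y in Ω, c y * dirEnergy f y (y - x₁)) -
        ∫ y in Ω, c y * ‖y - x₁‖ ^ 2 * energyDensity f y := by
  set φ : Euc n → Euc n := fun y => η y • (y - x₁) with hφ
  have hφd : ∀ y, HasFDerivAt φ (η y • ContinuousLinearMap.id ℝ (Euc n) +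
      (fderiv ℝ η y).smulRight (y - x₁)) y := fun y =>
    (h.contDiff.differentiable (by simp) y).hasFDerivAt.smul ((hasFDerivAt_id y).sub_const x₁)
  have key := hf.2.2 φ (h.contDiff.smul (contDiff_id.sub contDiff_const))
    (h.hasCompactSupport.smul_right) ((tsupport_smul_subset_left _ _).trans h.tsupport_subset)
  rw [innerVariation] at key
  have hpt1 : ∀ x, jetSum f x (fun p => hs p.2 (p.2.comp (fderiv ℝ φ x))) =
      η x * energyDensity f x + c x * dirEnergy f x (x - x₁) := by
    intro x
    rw [energyDensity, dirEnergy, ← jetSum_const_mul, ← jetSum_const_mul, ← jetSum_add]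
    congr 1
    ext p
    rw [(hφd x).fderiv, hs, hs, ← real_inner_self_eq_norm_sq, ← sum_mul_inner_single,
      Finset.mul_sum, Finset.mul_sum, ← Finset.sum_add_distrib]
    refine Finset.sum_congr rfl fun j _ => ?_
    simp only [ContinuousLinearMap.comp_apply, add_apply, smul_apply,
      ContinuousLinearMap.id_apply, ContinuousLinearMap.smulRight_apply, map_add, map_smul,
      inner_add_right, real_inner_smul_right, h.fderiv_eq, inner_single_right]
    ring
  have hpt2 : ∀ x, divergence φ x = n * η x + c x * ‖x - x₁‖ ^ 2 := by
    intro x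
    rw [divergence, (hφd x).fderiv, EuclideanSpace.norm_sq_eq, Finset.mul_sum]
    have : (n : ℝ) * η x = ∑ _j : Fin n, η x := by simp
    rw [this, ← Finset.sum_add_distrib]
    refine Finset.sum_congr rfl fun j _ => ?_
    simp only [add_apply, smul_apply,
      ContinuousLinearMap.id_apply, ContinuousLinearMap.smulRight_apply, h.fderiv_eq,
      inner_single_right]
    simp
    ring
  obtain ⟨C₁, hC₁⟩ := h.exists_bound
  obtain ⟨C₃, hC₃⟩ := h.exists_bound_deriv
  have hE := hf.1.integrableOn_energyDensity hn hΩ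
  have i1 : IntegrableOn (fun y => η y * energyDensity f y) Ω :=
    integrable_mul_of_bounded hE h.contDiff.continuous hC₁
  have i2 : IntegrableOn (fun y => c y * dirEnergy f y (y - x₁)) Ω :=
    hf.1.integrableOn_mul_dirEnergy hn hΩ (X := fun y => y - x₁) (by fun_prop) h.continuous hC₃
  have i3 : IntegrableOn (fun y => c y * ‖y - x₁‖ ^ 2 * energyDensity f y) Ω := by
    refine integrable_mul_of_bounded hE (h.continuous.mul (by fun_prop)) (C := C₃) fun y => ?_
    rw [abs_mul, abs_of_nonneg (sq_nonneg ‖y - x₁‖)]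
    exact hC₃ y
  have e1 : ∫ x in Ω, jetSum f x (fun p => hs p.2 p.2) * divergence φ x =
      n * (∫ y in Ω, η y * energyDensity f y) +
        ∫ y in Ω, c y * ‖y - x₁‖ ^ 2 * energyDensity f y := by
    rw [← integral_const_mul, ← integral_add (i1.const_mul _) i3]
    refine integral_congr_ae (ae_of_all _ fun x => ?_)
    simp only [hpt2]
    rw [← energyDensity]
    ring
  simp only [hpt1] at key
  rw [integral_add i1 i2, e1] at key
  linarith

/-- The weak derivative of `|f|²`, tested with `y ↦ η(y) (y - x₁)`. -/
lemma MemW12.radial_identity (hn : 0 < n) (hΩ : IsOpen Ω) (hf : MemW12 Ω f)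
    (h : IsRadialTest Ω x₁ η c) :
    n * (∫ y in Ω, η y * normSq (f y)) + ∫ y in Ω, c y * ‖y - x₁‖ ^ 2 * normSq (f y) =
      - 2 * ∫ y in Ω, η y * dirPairing f y (y - x₁) := by
  obtain ⟨C₁, hC₁⟩ := h.exists_bound
  obtain ⟨C₃, hC₃⟩ := h.exists_bound_deriv
  have hN := hf.integrableOn_normSq
  -- These are the components of the field η (y - x₁). Summing the identities for ∂_j|f|² over j
  -- assembles its divergence on one side and the radial pairing on the other.
  set χ : Fin n → Euc n → ℝ := fun j y => η y * (y j - x₁ j) with hχdef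
  have hχ : ∀ j, ContDiff ℝ (⊤ : ℕ∞) (χ j) := fun j => h.contDiff.mul (by fun_prop)
  have hχc : ∀ j, HasCompactSupport (χ j) := fun j => h.hasCompactSupport.mul_right
  have hχd : ∀ j y, fderiv ℝ (χ j) y (EuclideanSpace.single j 1) =
      η y + c y * (y j - x₁ j) ^ 2 := by
    intro j y
    have h1 : HasFDerivAt (fun y : Euc n => y j - x₁ j)
        (EuclideanSpace.proj j : Euc n →L[ℝ] ℝ) y :=
      (EuclideanSpace.proj j : Euc n →L[ℝ] ℝ).hasFDerivAt.sub_const (x₁ j)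
    have h2 : HasFDerivAt (χ j) _ y := (h.contDiff.differentiable (by simp) y).hasFDerivAt.mul h1
    rw [h2.fderiv]
    simp only [add_apply, smul_apply, h.fderiv_eq, inner_single_right]
    simp
    ring
  have hd : ∀ j, ∃ C, ∀ y, |fderiv ℝ (χ j) y (EuclideanSpace.single j 1)| ≤ C := fun j =>
    (hasCompactSupport_fderiv_apply (hχc j) _).exists_bound_of_continuous
      (continuous_fderiv_apply (hχ j) _)
  have iA : ∀ j, IntegrableOn (fun y => normSq (f y) *
      fderiv ℝ (χ j) y (EuclideanSpace.single j 1)) Ω := by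
    intro j
    obtain ⟨C, hC⟩ := hd j
    simpa only [mul_comm] using integrable_mul_of_bounded hN (continuous_fderiv_apply (hχ j) _) hC
  have iB : ∀ j, IntegrableOn (fun y => 2 * χ j y * dirPairing f y (EuclideanSpace.single j 1))
      Ω := by
    intro j
    obtain ⟨C, hC⟩ := (hχc j).exists_bound_of_continuous (hχ j).continuous
    refine hf.integrableOn_mul_dirPairing hn hΩ (X := fun _ => EuclideanSpace.single j 1)
      measurable_const (continuous_const.mul (hχ j).continuous) (C := 2 * C) (C' := 2 * C)
      (fun y => ?_) (fun y => ?_)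
    · have := hC y
      rw [Real.norm_eq_abs] at this
      simp [abs_mul]
      linarith
    · have := hC y
      rw [Real.norm_eq_abs] at this
      rw [abs_mul]
      simp
      linarith
  have key : ∑ j, ∫ y in Ω, normSq (f y) * fderiv ℝ (χ j) y (EuclideanSpace.single j 1) =
      ∑ j, - ∫ y in Ω, 2 * χ j y * dirPairing f y (EuclideanSpace.single j 1) :=
    Finset.sum_congr rfl fun j _ => hf.integral_normSq_mul_fderiv hn hΩ j (hχ j) (hχc j)
      ((tsupport_mul_subset_left).trans h.tsupport_subset)
  rw [← integral_finsetSum _ fun j _ => iA j, Finset.sum_neg_distrib,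
    ← integral_finsetSum _ fun j _ => iB j] at key
  have e1 : ∀ y, ∑ j, normSq (f y) * fderiv ℝ (χ j) y (EuclideanSpace.single j 1) =
      n * (η y * normSq (f y)) + c y * ‖y - x₁‖ ^ 2 * normSq (f y) := by
    intro y
    simp only [hχd]
    rw [← Finset.mul_sum, Finset.sum_add_distrib, ← Finset.mul_sum, EuclideanSpace.norm_sq_eq]
    simp
    ring
  have e2 : ∀ y, ∑ j, 2 * χ j y * dirPairing f y (EuclideanSpace.single j 1) =
      2 * (η y * dirPairing f y (y - x₁)) := by
    intro y
    obtain ⟨p, hp⟩ := exists_ofLabel (jet f y)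
    simp only [dirPairing, jetSum_ofLabel hp, Finset.mul_sum]
    rw [Finset.sum_comm]
    refine Finset.sum_congr rfl fun i _ => ?_
    rw [← sum_mul_inner_single (p i).2 (y - x₁), Finset.mul_sum, Finset.mul_sum]
    refine Finset.sum_congr rfl fun j _ => ?_
    rw [real_inner_comm ((p i).2 (EuclideanSpace.single j 1)) (p i).1]
    simp [hχdef]
    ring
  simp only [e1, e2] at key
  have i1 : IntegrableOn (fun y => η y * normSq (f y)) Ω :=
    integrable_mul_of_bounded hN h.contDiff.continuous hC₁
  have i3 : IntegrableOn (fun y => c y * ‖y - x₁‖ ^ 2 * normSq (f y)) Ω := by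
    refine integrable_mul_of_bounded hN (h.continuous.mul (by fun_prop)) (C := C₃) fun y => ?_
    rw [abs_mul, abs_of_nonneg (sq_nonneg ‖y - x₁‖)]
    exact hC₃ y
  rw [integral_add (i1.const_mul _) i3, integral_const_mul, integral_const_mul] at key
  linarith

end QValued

/-! ### Smoothed height and energy, and Almgren's differential relations -/

namespace QValued

open MeasureTheory Filter Topology Metric ApproxCalc
open scoped ENNReal

variable {n m Q : ℕ}

/-- A smooth cutoff: `1` on `(-∞, 1]`, `0` on `[2, ∞)`. -/
noncomputable def cutoffProfile (s : ℝ) : ℝ := Real.smoothTransition (2 - s)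

/-- The primitive of `-cutoffProfile` vanishing on `[2, ∞)`. -/
noncomputable def cutoffPrimitive (s : ℝ) : ℝ := - ∫ t in (2 : ℝ)..s, cutoffProfile t

lemma contDiff_cutoffProfile : ContDiff ℝ (⊤ : ℕ∞) cutoffProfile :=
  Real.smoothTransition.contDiff.comp (by fun_prop)

lemma cutoffProfile_eq_one {s : ℝ} (hs : s ≤ 1) : cutoffProfile s = 1 :=
  Real.smoothTransition.one_of_one_le (by linarith)

lemma cutoffProfile_eq_zero {s : ℝ} (hs : 2 ≤ s) : cutoffProfile s = 0 :=
  Real.smoothTransition.zero_of_nonpos (by linarith)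

lemma cutoffProfile_nonneg (s : ℝ) : 0 ≤ cutoffProfile s := Real.smoothTransition.nonneg _

lemma cutoffProfile_le_one (s : ℝ) : cutoffProfile s ≤ 1 := Real.smoothTransition.le_one _

lemma hasDerivAt_cutoffPrimitive (s : ℝ) :
    HasDerivAt cutoffPrimitive (-cutoffProfile s) s := by
  have hc := contDiff_cutoffProfile.continuous
  exact (intervalIntegral.integral_hasDerivAt_right (hc.intervalIntegrable _ _)
    hc.aestronglyMeasurable.stronglyMeasurableAtFilter hc.continuousAt).neg

lemma deriv_cutoffPrimitive : deriv cutoffPrimitive = fun s => -cutoffProfile s :=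
  funext fun s => (hasDerivAt_cutoffPrimitive s).deriv

lemma contDiff_cutoffPrimitive : ContDiff ℝ (⊤ : ℕ∞) cutoffPrimitive := by
  rw [contDiff_infty_iff_deriv, deriv_cutoffPrimitive]
  exact ⟨fun s => (hasDerivAt_cutoffPrimitive s).differentiableAt, contDiff_cutoffProfile.neg⟩

lemma cutoffPrimitive_eq_zero {s : ℝ} (hs : 2 ≤ s) : cutoffPrimitive s = 0 := by
  have h : ∫ t in (2 : ℝ)..s, cutoffProfile t = ∫ _t in (2 : ℝ)..s, (0 : ℝ) := by
    refine intervalIntegral.integral_congr fun t ht => ?_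
    rw [Set.uIcc_of_le hs] at ht
    exact cutoffProfile_eq_zero ht.1
  rw [cutoffPrimitive, h]
  simp

lemma cutoffPrimitive_nonneg (s : ℝ) : 0 ≤ cutoffPrimitive s := by
  rcases le_total 2 s with h | h
  · exact (cutoffPrimitive_eq_zero h).ge
  · rw [cutoffPrimitive, intervalIntegral.integral_symm, neg_neg]
    exact intervalIntegral.integral_nonneg h fun t _ => cutoffProfile_nonneg t

section Profile

variable {θ : ℝ → ℝ}

lemma deriv_eq_zero_of_profile (h0 : ∀ s, 2 ≤ s → θ s = 0) {s : ℝ} (hs : 2 < s) :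
    deriv θ s = 0 := by
  have : θ =ᶠ[𝓝 s] fun _ => 0 := by
    filter_upwards [lt_mem_nhds hs] with t ht using h0 t ht.le
  rw [this.deriv_eq]; simp

lemma exists_bound_of_profile {θ : ℝ → ℝ} (hθ : Continuous θ) (h0 : ∀ s, 2 < s → θ s = 0) :
    ∃ C, ∀ s, 0 ≤ s → |θ s| ≤ C := by
  obtain ⟨C, hC⟩ := (isCompact_Icc (a := (0:ℝ)) (b := 2)).exists_bound_of_continuousOn
    hθ.continuousOn
  refine ⟨C, fun s hs => ?_⟩
  rcases le_or_gt s 2 with h | h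
  · exact hC s ⟨hs, h⟩
  · rw [h0 s h, abs_zero]
    exact (norm_nonneg _).trans (hC 0 (by simp))

/-- Composing θ with the squared distance keeps the function smooth at the centre and makes its
gradient a continuous multiple of y - x. -/
lemma isRadialTest_profile (hθ : ContDiff ℝ (⊤ : ℕ∞) θ) (h0 : ∀ s, 2 ≤ s → θ s = 0)
    {Ω : Set (Euc n)} {x : Euc n} {r : ℝ} (hr : 0 < r) (hB : closedBall x (2 * r) ⊆ Ω) :
    IsRadialTest Ω x (fun y => θ (‖y - x‖ ^ 2 / r ^ 2))
      (fun y => deriv θ (‖y - x‖ ^ 2 / r ^ 2) * (2 / r ^ 2)) := by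
  have hρ : ContDiff ℝ (⊤ : ℕ∞) fun y : Euc n => ‖y - x‖ ^ 2 / r ^ 2 :=
    ((contDiff_id.sub contDiff_const).norm_sq ℝ).div_const _
  have hsupp : tsupport (fun y : Euc n => θ (‖y - x‖ ^ 2 / r ^ 2)) ⊆ closedBall x (2 * r) := by
    refine closure_minimal ?_ isClosed_closedBall
    intro y hy
    by_contra hcon
    apply hy
    refine h0 _ ?_
    rw [mem_closedBall, dist_eq_norm, not_le] at hcon
    rw [le_div_iff₀ (by positivity)]
    nlinarith
  have hdc : Continuous (deriv θ) := hθ.continuous_deriv (by simp)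
  obtain ⟨C, hC⟩ := exists_bound_of_profile hdc fun s hs => deriv_eq_zero_of_profile h0 hs
  refine ⟨hθ.comp hρ, (isCompact_closedBall x (2 * r)).of_isClosed_subset
    (isClosed_tsupport _) hsupp, hsupp.trans hB, (hdc.comp hρ.continuous).mul continuous_const,
    ⟨C * (2 / r ^ 2), fun y => ?_⟩, fun y z => ?_⟩
  · rw [abs_mul, abs_of_pos (by positivity : 0 < 2 / r ^ 2)]
    gcongr
    exact hC _ (by positivity)
  · have h1 : HasFDerivAt (fun y : Euc n => ‖y - x‖ ^ 2) _ y :=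
      ((hasFDerivAt_id y).sub_const x).norm_sq
    have h2 : HasFDerivAt (fun y : Euc n => ‖y - x‖ ^ 2 / r ^ 2) _ y := h1.mul_const (r ^ 2)⁻¹
    have h3 := ((hθ.differentiable (by simp) (‖y - x‖ ^ 2 / r ^ 2)).hasDerivAt.comp_hasFDerivAt
      y h2).fderiv
    change fderiv ℝ (θ ∘ fun y : Euc n => ‖y - x‖ ^ 2 / r ^ 2) y z = _
    rw [h3]
    simp [inner_sub_left]
    ring

variable {Ω : Set (Euc n)} {b : Euc n → ℝ}

/-- Differentiating the profile in r gives -1/r times its derivative along y - x. The result is thus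
an integral that occurs in the variation identities, which express the r-derivatives of height and
energy. -/
lemma hasDerivAt_profile_integral (hθ : ContDiff ℝ (⊤ : ℕ∞) θ) (h0 : ∀ s, 2 ≤ s → θ s = 0)
    (hb : IntegrableOn b Ω) (x : Euc n) {r : ℝ} (hr : 0 < r) :
    HasDerivAt (fun r : ℝ => ∫ y in Ω, θ (‖y - x‖ ^ 2 / r ^ 2) * b y)
      (- r⁻¹ * ∫ y in Ω, deriv θ (‖y - x‖ ^ 2 / r ^ 2) * (2 / r ^ 2) * ‖y - x‖ ^ 2 * b y) r := by
  have hdc : Continuous (deriv θ) := hθ.continuous_deriv (by simp)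
  obtain ⟨C, hC⟩ := exists_bound_of_profile hθ.continuous fun s hs => h0 s hs.le
  obtain ⟨C', hC'⟩ := exists_bound_of_profile (hdc.mul continuous_id) (θ := fun s => deriv θ s * s)
    fun s hs => by rw [deriv_eq_zero_of_profile h0 hs, zero_mul]
  have hC'0 : 0 ≤ C' := (abs_nonneg _).trans (hC' 0 le_rfl)
  set F' : ℝ → Euc n → ℝ := fun s y =>
    (deriv θ (‖y - x‖ ^ 2 / s ^ 2) * (‖y - x‖ ^ 2 / s ^ 2) * (-2 / s)) * b y with hF'
  have hcont : ∀ s : ℝ, Continuous fun y : Euc n => θ (‖y - x‖ ^ 2 / s ^ 2) := fun s =>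
    hθ.continuous.comp (by fun_prop)
  -- For s > r / 2 the factor 2 / s is below 4 / r, and θ'(σ)σ is bounded because θ vanishes beyond
  -- 2.
  have key := hasDerivAt_integral_of_dominated_loc_of_deriv_le (μ := volume.restrict Ω)
    (F := fun (s : ℝ) y => θ (‖y - x‖ ^ 2 / s ^ 2) * b y) (F' := F') (x₀ := r)
    (s := Set.Ioi (r / 2)) (bound := fun y => (C' * (4 / r)) * ‖b y‖)
    (Ioi_mem_nhds (by linarith))
    (Eventually.of_forall fun s => (hcont s).aestronglyMeasurable.mul hb.1)
    (integrable_mul_of_bounded hb (hcont r) fun y => hC _ (by positivity))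
    (((hdc.comp (by fun_prop)).mul (by fun_prop) |>.mul
      continuous_const).aestronglyMeasurable.mul hb.1)
    (ae_of_all _ fun y s hs => ?_) (hb.norm.const_mul _) (ae_of_all _ fun y s hs => ?_)
  · refine key.2.congr_deriv ?_
    rw [← integral_const_mul]
    congr 1
    ext y
    simp only [hF']
    field_simp
  · have hs : r / 2 < s := hs
    have hs0 : 0 < s := by linarith
    simp only [hF']
    rw [norm_mul, norm_mul]
    refine mul_le_mul_of_nonneg_right ?_ (norm_nonneg _)
    refine mul_le_mul (hC' _ (by positivity)) ?_ (norm_nonneg _) hC'0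
    rw [Real.norm_eq_abs, abs_div, abs_neg, abs_two, abs_of_pos hs0,
      div_le_div_iff₀ hs0 hr]
    linarith
  · have hs : r / 2 < s := hs
    have hs0 : 0 < s := by linarith
    have h1 : HasDerivAt (fun s : ℝ => ‖y - x‖ ^ 2 / s ^ 2)
        (‖y - x‖ ^ 2 / s ^ 2 * (-2 / s)) s := by
      have h2 := ((hasDerivAt_pow 2 s).inv (by positivity)).const_mul (‖y - x‖ ^ 2)
      have h3 : HasDerivAt (fun s : ℝ => ‖y - x‖ ^ 2 / s ^ 2) _ s := h2
      refine h3.congr_deriv ?_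
      field_simp
      simp
      ring
    have h4 := ((hθ.differentiable (by simp) (‖y - x‖ ^ 2 / s ^ 2)).hasDerivAt.comp s h1).mul_const
      (b y)
    refine h4.congr_deriv ?_
    simp only [hF']
    ring

lemma continuous_profile_integral (hθ : Continuous θ) (h0 : ∀ s, 2 ≤ s → θ s = 0)
    (hb : IntegrableOn b Ω) (r : ℝ) :
    Continuous fun x : Euc n => ∫ y in Ω, θ (‖y - x‖ ^ 2 / r ^ 2) * b y := by
  obtain ⟨C, hC⟩ := exists_bound_of_profile hθ fun s hs => h0 s hs.le
  refine continuous_of_dominated (bound := fun y => C * ‖b y‖) (fun x => ?_) (fun x => ?_)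
    (hb.norm.const_mul _) (ae_of_all _ fun y => ?_)
  · exact (hθ.comp (by fun_prop)).aestronglyMeasurable.mul hb.1
  · refine ae_of_all _ fun y => ?_
    rw [norm_mul]
    gcongr
    exact hC _ (by positivity)
  · exact (hθ.comp (by fun_prop)).mul continuous_const

end Profile

/-- The weighted `L²` height of `f` at scale `r` around `x`. -/
noncomputable def height (Ω : Set (Euc n)) (f : Euc n → AQ Q m) (x : Euc n) (r : ℝ) : ℝ :=
  ∫ y in Ω, cutoffProfile (‖y - x‖ ^ 2 / r ^ 2) * normSq (f y)

/-- The weighted Dirichlet energy of `f` at scale `r` around `x`. -/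
noncomputable def energy (Ω : Set (Euc n)) (f : Euc n → AQ Q m) (x : Euc n) (r : ℝ) : ℝ :=
  ∫ y in Ω, cutoffPrimitive (‖y - x‖ ^ 2 / r ^ 2) * energyDensity f y

variable {Ω : Set (Euc n)} {f : Euc n → AQ Q m}

lemma height_nonneg (x : Euc n) (r : ℝ) : 0 ≤ height Ω f x r :=
  integral_nonneg fun _ => mul_nonneg (cutoffProfile_nonneg _) (normSq_nonneg _)

lemma energy_nonneg (x : Euc n) (r : ℝ) : 0 ≤ energy Ω f x r :=
  integral_nonneg fun _ => mul_nonneg (cutoffPrimitive_nonneg _) (energyDensity_nonneg _ _)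

/-- Almgren's differential relations between height and energy. -/
theorem IsDirStationary.hasDerivAt_height_and_energy (hn : 0 < n) (hΩ : IsOpen Ω)
    (hf : IsDirStationary Ω f) {x : Euc n} {r : ℝ} (hr : 0 < r) (hB : closedBall x (2 * r) ⊆ Ω) :
    HasDerivAt (height Ω f x) (n * height Ω f x r / r + r * energy Ω f x r) r ∧
    ∃ D', HasDerivAt (energy Ω f x) D' r ∧
      ((n : ℝ) - 2) * energy Ω f x r * height Ω f x r + (r * energy Ω f x r) ^ 2 ≤
        r * D' * height Ω f x r := by
  have hw := isRadialTest_profile contDiff_cutoffProfile (fun s => cutoffProfile_eq_zero) hr hB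
  have hh := isRadialTest_profile contDiff_cutoffPrimitive (fun s => cutoffPrimitive_eq_zero) hr hB
  rw [deriv_cutoffPrimitive] at hh
  have hH := hasDerivAt_profile_integral contDiff_cutoffProfile (fun s => cutoffProfile_eq_zero)
    hf.1.integrableOn_normSq x hr
  have hD := hasDerivAt_profile_integral contDiff_cutoffPrimitive (fun s => cutoffPrimitive_eq_zero)
    (hf.1.integrableOn_energyDensity hn hΩ) x hr
  rw [deriv_cutoffPrimitive] at hD
  beta_reduce at hh hD
  have e1 := hf.1.radial_identity hn hΩ hw
  have e2 := hf.outer_identity hn hΩ hh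
  have e3 := hf.inner_identity hn hΩ hh
  set A := ∫ y in Ω, cutoffProfile (‖y - x‖ ^ 2 / r ^ 2) * dirPairing f y (y - x) with hA
  set G := ∫ y in Ω, cutoffProfile (‖y - x‖ ^ 2 / r ^ 2) * dirEnergy f y (y - x) with hG
  have e4 : ∫ y in Ω, -cutoffProfile (‖y - x‖ ^ 2 / r ^ 2) * (2 / r ^ 2) *
      dirPairing f y (y - x) = - (2 / r ^ 2) * A := by
    rw [hA, ← integral_const_mul]
    congr 1; ext y; ring
  have e5 : ∫ y in Ω, -cutoffProfile (‖y - x‖ ^ 2 / r ^ 2) * (2 / r ^ 2) *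
      dirEnergy f y (y - x) = - (2 / r ^ 2) * G := by
    rw [hG, ← integral_const_mul]
    congr 1; ext y; ring
  rw [e4] at e2
  rw [e5] at e3
  change ((n : ℝ) - 2) * energy Ω f x r = _ at e3
  change energy Ω f x r = _ at e2
  change n * height Ω f x r + _ = _ at e1
  -- The outer variation expresses the energy by the radial pairing A. Through it the energy appears
  -- in the derivative of the height.
  have hAD : A = r ^ 2 * energy Ω f x r / 2 := by
    rw [e2]; field_simp
  obtain ⟨C₁, hC₁⟩ := hw.exists_bound
  obtain ⟨C₂, hC₂⟩ := hw.exists_bound_mul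
  have iu := integrable_mul_of_bounded hf.1.integrableOn_normSq hw.contDiff.continuous hC₁
  have iB := hf.1.integrableOn_mul_dirPairing hn hΩ (X := fun y => y - x) (by fun_prop)
    hw.contDiff.continuous hC₂ hC₁
  have iW := hf.1.integrableOn_mul_dirEnergy hn hΩ (X := fun y => y - x) (by fun_prop)
    hw.contDiff.continuous hC₂
  have hCS : A ^ 2 ≤ height Ω f x r * G := by
    -- The quadratic polynomial is the weighted integral of ∑ |t f_i + Df_i·(y - x)|², so its
    -- discriminant is nonpositive.
    have h1 : ∀ t : ℝ, 0 ≤ height Ω f x r * (t * t) + (2 * A) * t + G := by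
      intro t
      have h2 : height Ω f x r * (t * t) + (2 * A) * t + G =
          ∫ y in Ω, cutoffProfile (‖y - x‖ ^ 2 / r ^ 2) *
            (normSq (f y) * (t * t) + 2 * dirPairing f y (y - x) * t + dirEnergy f y (y - x)) := by
        rw [height, hA, hG, ← integral_mul_const, ← integral_const_mul, ← integral_mul_const]
        have i1 := iu.mul_const (t * t)
        have i2 := (iB.const_mul 2).mul_const t
        have i12 := i1.add i2
        simp only [Pi.add_def] at i12
        rw [← integral_add i1 i2, ← integral_add i12 iW]
        congr 1; ext y; ring
      rw [h2]
      refine integral_nonneg fun y => mul_nonneg (cutoffProfile_nonneg _) ?_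
      have h3 := dirPairing_sq_le f y (y - x)
      have h4 := dirEnergy_nonneg f y (y - x)
      have h5 := normSq_nonneg (f y)
      rcases h5.eq_or_lt with h6 | h6
      · rw [← h6, zero_mul] at h3
        have : dirPairing f y (y - x) = 0 := by nlinarith [sq_nonneg (dirPairing f y (y - x))]
        rw [this, ← h6]; linarith
      · have h7 : 0 ≤ normSq (f y) * (normSq (f y) * (t * t) + 2 * dirPairing f y (y - x) * t +
            dirEnergy f y (y - x)) := by
          nlinarith [sq_nonneg (normSq (f y) * t + dirPairing f y (y - x))]
        exact nonneg_of_mul_nonneg_right h7 h6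
    have h2 := discrim_le_zero h1
    rw [discrim] at h2
    nlinarith
  refine ⟨hH.congr_deriv ?_, _, hD, ?_⟩
  · have h1 : ∫ y in Ω, deriv cutoffProfile (‖y - x‖ ^ 2 / r ^ 2) * (2 / r ^ 2) * ‖y - x‖ ^ 2 *
        normSq (f y) = -2 * A - n * height Ω f x r := by linarith
    rw [h1, hAD]
    field_simp
    ring
  -- The inner variation gives rD' = (n - 2)D + 4G / r², and (rD)² = 4A² / r² ≤ (4 / r²) H G by the
  -- Cauchy-Schwarz bound.
  · have h1 : ∫ y in Ω, -cutoffProfile (‖y - x‖ ^ 2 / r ^ 2) * (2 / r ^ 2) * ‖y - x‖ ^ 2 *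
        energyDensity f y = - (4 / r ^ 2) * G - ((n : ℝ) - 2) * energy Ω f x r := by
      linear_combination e3
    rw [h1]
    have h2 : r * (-r⁻¹ * (-(4 / r ^ 2) * G - ((n : ℝ) - 2) * energy Ω f x r)) * height Ω f x r =
        ((n : ℝ) - 2) * energy Ω f x r * height Ω f x r + 4 / r ^ 2 * (height Ω f x r * G) := by
      field_simp
      ring
    rw [h2]
    have h3 : (r * energy Ω f x r) ^ 2 = 4 / r ^ 2 * A ^ 2 := by
      rw [hAD]; field_simp; ring
    rw [h3]
    gcongr

end QValued

/-! ### Monotonicity of the frequency -/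

namespace QValued

open MeasureTheory Filter Topology Metric ApproxCalc
open scoped ENNReal

/-- The differential relations between height and energy that make the frequency `r² D / H`
monotone on `(0, R)`. -/
structure FrequencyRelations (d : ℕ) (R : ℝ) (H D : ℝ → ℝ) : Prop where
  height_nonneg : ∀ r, 0 ≤ H r
  energy_nonneg : ∀ r, 0 ≤ D r
  hasDerivAt_height : ∀ r, 0 < r → r < R → HasDerivAt H (d * H r / r + r * D r) r
  exists_hasDerivAt_energy : ∀ r, 0 < r → r < R → ∃ D', HasDerivAt D D' r ∧
    ((d : ℝ) - 2) * D r * H r + (r * D r) ^ 2 ≤ r * D' * H r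

/-- Almgren's frequency function. -/
noncomputable def frequency (H D : ℝ → ℝ) (r : ℝ) : ℝ := r ^ 2 * D r / H r

namespace FrequencyRelations

variable {d : ℕ} {R : ℝ} {H D : ℝ → ℝ}

lemma frequency_nonneg (h : FrequencyRelations d R H D) (r : ℝ) : 0 ≤ frequency H D r :=
  div_nonneg (mul_nonneg (sq_nonneg _) (h.energy_nonneg r)) (h.height_nonneg r)

lemma hasDerivAt_scaled (h : FrequencyRelations d R H D) {r : ℝ} (hr : 0 < r) (hrR : r < R) :
    HasDerivAt (fun r => H r / r ^ d) (r * D r / r ^ d) r := by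
  have h1 := (h.hasDerivAt_height r hr hrR).div (hasDerivAt_pow d r) (pow_ne_zero d hr.ne')
  refine h1.congr_deriv ?_
  -- The derivative of r ^ d involves the truncated exponent d - 1, so d = 0 is separate.
  rcases d with _ | d
  · simp
  · rw [Nat.add_sub_cancel]
    push_cast
    field_simp
    ring

lemma scaled_mono (h : FrequencyRelations d R H D) {a b : ℝ} (ha : 0 < a) (hab : a ≤ b)
    (hb : b < R) : H a / a ^ d ≤ H b / b ^ d := by
  have key : MonotoneOn (fun r => H r / r ^ d) (Set.Icc a b) := by
    refine monotoneOn_of_deriv_nonneg (convex_Icc a b) (fun r hr => ?_) (fun r hr => ?_)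
      (fun r hr => ?_)
    · exact (h.hasDerivAt_scaled (ha.trans_le hr.1)
        (hr.2.trans_lt hb)).continuousAt.continuousWithinAt
    · rw [interior_Icc] at hr
      exact (h.hasDerivAt_scaled (ha.trans hr.1)
        (hr.2.trans hb)).differentiableAt.differentiableWithinAt
    · rw [interior_Icc] at hr
      have hr0 := ha.trans hr.1
      rw [(h.hasDerivAt_scaled hr0 (hr.2.trans hb)).deriv]
      have := h.energy_nonneg r
      positivity
  exact key (Set.left_mem_Icc.2 hab) (Set.right_mem_Icc.2 hab) hab

lemma height_pos_of_le (h : FrequencyRelations d R H D) {a b : ℝ} (ha : 0 < a) (hab : a ≤ b)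
    (hb : b < R) (hHa : 0 < H a) : 0 < H b := by
  have h1 := h.scaled_mono ha hab hb
  have h2 : 0 < H a / a ^ d := by positivity
  exact (div_pos_iff_of_pos_right (pow_pos (ha.trans_le hab) d)).1 (h2.trans_le h1)

lemma exists_hasDerivAt_frequency (h : FrequencyRelations d R H D) {r : ℝ} (hr : 0 < r)
    (hrR : r < R) (hH : 0 < H r) : ∃ N', HasDerivAt (frequency H D) N' r ∧ 0 ≤ N' := by
  obtain ⟨D', hD', hle⟩ := h.exists_hasDerivAt_energy r hr hrR
  refine ⟨_, ((hasDerivAt_pow 2 r).mul hD').div (h.hasDerivAt_height r hr hrR) hH.ne', ?_⟩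
  refine div_nonneg ?_ (sq_nonneg _)
  -- The numerator of the quotient rule is r times the slack in the energy inequality.
  have h1 : (((2 : ℕ) * r ^ (2 - 1) * D r + r ^ 2 * D') * H r -
      r ^ 2 * D r * (d * H r / r + r * D r)) =
      r * (r * D' * H r - (((d : ℝ) - 2) * D r * H r + (r * D r) ^ 2)) := by
    field_simp
    push_cast
    ring
  exact h1 ▸ mul_nonneg hr.le (sub_nonneg.2 hle)

lemma frequency_mono (h : FrequencyRelations d R H D) {a b : ℝ} (ha : 0 < a) (hab : a ≤ b)
    (hb : b < R) (hHa : 0 < H a) : frequency H D a ≤ frequency H D b := by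
  have hd : ∀ r ∈ Set.Icc a b, ∃ N', HasDerivAt (frequency H D) N' r ∧ 0 ≤ N' := fun r hr =>
    h.exists_hasDerivAt_frequency (ha.trans_le hr.1) (hr.2.trans_lt hb)
      (h.height_pos_of_le ha hr.1 (hr.2.trans_lt hb) hHa)
  have key : MonotoneOn (frequency H D) (Set.Icc a b) := by
    refine monotoneOn_of_deriv_nonneg (convex_Icc a b) (fun r hr => ?_) (fun r hr => ?_)
      (fun r hr => ?_)
    · obtain ⟨N', hN', -⟩ := hd r hr
      exact hN'.continuousAt.continuousWithinAt
    · obtain ⟨N', hN', -⟩ := hd r (interior_subset hr)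
      exact hN'.differentiableAt.differentiableWithinAt
    · obtain ⟨N', hN', h0⟩ := hd r (interior_subset hr)
      rwa [hN'.deriv]
  exact key (Set.left_mem_Icc.2 hab) (Set.right_mem_Icc.2 hab) hab

/-- Since (H / r^d)' = rD / r^d, the frequency is the logarithmic growth rate of the scaled height.
Bounds on it integrate to power laws. -/
lemma hasDerivAt_log_scaled (h : FrequencyRelations d R H D) {r : ℝ} (hr : 0 < r)
    (hrR : r < R) (hH : 0 < H r) :
    HasDerivAt (fun r => Real.log (H r / r ^ d)) (frequency H D r / r) r := by
  refine ((h.hasDerivAt_scaled hr hrR).log (by positivity)).congr_deriv ?_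
  rw [frequency]
  field_simp

/-- Integration of N(r) / r over [a, b], where monotonicity bounds N(r) by N(b). -/
lemma log_scaled_sub_le (h : FrequencyRelations d R H D) {a b : ℝ} (ha : 0 < a) (hab : a ≤ b)
    (hb : b < R) (hHa : 0 < H a) :
    Real.log (H b / b ^ d) - Real.log (H a / a ^ d) ≤
      frequency H D b * (Real.log b - Real.log a) := by
  have hd : ∀ r ∈ Set.Icc a b, HasDerivAt
      (fun r => frequency H D b * Real.log r - Real.log (H r / r ^ d))
      (frequency H D b * r⁻¹ - frequency H D r / r) r := fun r hr =>
    ((Real.hasDerivAt_log (ha.trans_le hr.1).ne').const_mul _).sub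
      (h.hasDerivAt_log_scaled (ha.trans_le hr.1) (hr.2.trans_lt hb)
        (h.height_pos_of_le ha hr.1 (hr.2.trans_lt hb) hHa))
  have key : MonotoneOn (fun r => frequency H D b * Real.log r - Real.log (H r / r ^ d))
      (Set.Icc a b) := by
    refine monotoneOn_of_deriv_nonneg (convex_Icc a b)
      (fun r hr => (hd r hr).continuousAt.continuousWithinAt)
      (fun r hr => (hd r (interior_subset hr)).differentiableAt.differentiableWithinAt)
      (fun r hr => ?_)
    have hr' := interior_subset hr
    have hr0 := ha.trans_le hr'.1
    rw [(hd r hr').deriv, ← div_eq_mul_inv, ← sub_div]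
    exact div_nonneg (sub_nonneg.2 (h.frequency_mono hr0 hr'.2 hb
      (h.height_pos_of_le ha hr'.1 (hr'.2.trans_lt hb) hHa))) hr0.le
  have := key (Set.left_mem_Icc.2 hab) (Set.right_mem_Icc.2 hab) hab
  simp only at this
  linarith

/-- The reverse estimate, from N(r) ≥ N(a) on [a, b]. -/
lemma le_log_scaled_sub (h : FrequencyRelations d R H D) {a b : ℝ} (ha : 0 < a) (hab : a ≤ b)
    (hb : b < R) (hHa : 0 < H a) :
    frequency H D a * (Real.log b - Real.log a) ≤
      Real.log (H b / b ^ d) - Real.log (H a / a ^ d) := by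
  have hd : ∀ r ∈ Set.Icc a b, HasDerivAt
      (fun r => Real.log (H r / r ^ d) - frequency H D a * Real.log r)
      (frequency H D r / r - frequency H D a * r⁻¹) r := fun r hr =>
    (h.hasDerivAt_log_scaled (ha.trans_le hr.1) (hr.2.trans_lt hb)
        (h.height_pos_of_le ha hr.1 (hr.2.trans_lt hb) hHa)).sub
      ((Real.hasDerivAt_log (ha.trans_le hr.1).ne').const_mul _)
  have key : MonotoneOn (fun r => Real.log (H r / r ^ d) - frequency H D a * Real.log r)
      (Set.Icc a b) := by
    refine monotoneOn_of_deriv_nonneg (convex_Icc a b)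
      (fun r hr => (hd r hr).continuousAt.continuousWithinAt)
      (fun r hr => (hd r (interior_subset hr)).differentiableAt.differentiableWithinAt)
      (fun r hr => ?_)
    have hr' := interior_subset hr
    have hr0 := ha.trans_le hr'.1
    rw [(hd r hr').deriv, ← div_eq_mul_inv, ← sub_div]
    exact div_nonneg (sub_nonneg.2 (h.frequency_mono ha hr'.1 (hr'.2.trans_lt hb) hHa)) hr0.le
  have := key (Set.left_mem_Icc.2 hab) (Set.right_mem_Icc.2 hab) hab
  simp only at this
  linarith

/-- Unique continuation at a point: the height cannot vanish below a scale where it is positive. -/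
lemma height_pos_of_ge (h : FrequencyRelations d R H D) {a b : ℝ} (ha : 0 < a) (hab : a ≤ b)
    (hb : b < R) (hHb : 0 < H b) : 0 < H a := by
  by_contra hcon
  have ha0 : H a = 0 := le_antisymm (not_lt.1 hcon) (h.height_nonneg a)
  have hcont : ContinuousOn H (Set.Icc a b) := fun r hr =>
    (h.hasDerivAt_height r (ha.trans_le hr.1) (hr.2.trans_lt hb)).continuousAt.continuousWithinAt
  have hclosed : IsClosed (Set.Icc a b ∩ H ⁻¹' {0}) :=
    hcont.preimage_isClosed_of_isClosed isClosed_Icc isClosed_singleton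
  -- At the largest zero c the height is positive just above, where the growth estimate applies and
  -- bounds H / r^d from below uniformly as r decreases to c. Continuity at c is contradicted.
  obtain ⟨c, ⟨hc, hc0⟩, hmax⟩ := (isCompact_Icc.of_isClosed_subset hclosed
    Set.inter_subset_left).exists_isGreatest ⟨a, Set.left_mem_Icc.2 hab, ha0⟩
  have hc0 : H c = 0 := hc0
  have hcb : c < b := lt_of_le_of_ne hc.2 (by rintro rfl; linarith)
  have hcpos := ha.trans_le hc.1
  set N := frequency H D b
  have hlow : ∀ᶠ r in 𝓝[>] c,
      Real.exp (Real.log (H b / b ^ d) - N * (Real.log b - Real.log c)) ≤ H r / r ^ d := by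
    filter_upwards [Ioo_mem_nhdsGT hcb] with r hr
    have hr0 := hcpos.trans hr.1
    have hHr : 0 < H r := by
      refine (h.height_nonneg r).lt_of_ne fun h0 => ?_
      exact hr.1.not_ge (hmax ⟨⟨hc.1.trans hr.1.le, hr.2.le⟩, h0.symm⟩)
    have h1 := h.log_scaled_sub_le hr0 hr.2.le hb hHr
    rw [← Real.le_log_iff_exp_le (by positivity)]
    have h2 : N * Real.log c ≤ N * Real.log r :=
      mul_le_mul_of_nonneg_left (Real.log_le_log hcpos hr.1.le) (h.frequency_nonneg b)
    linarith
  have hlim : Tendsto (fun r => H r / r ^ d) (𝓝[>] c) (𝓝 (H c / c ^ d)) :=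
    (h.hasDerivAt_scaled hcpos (hcb.trans hb)).continuousAt.tendsto.mono_left nhdsWithin_le_nhds
  have := ge_of_tendsto hlim hlow
  rw [hc0, zero_div] at this
  exact (Real.exp_pos _).not_ge this

end FrequencyRelations

lemma IsDirStationary.frequencyRelations {n m Q : ℕ} {Ω : Set (Euc n)} {f : Euc n → AQ Q m}
    (hn : 0 < n) (hΩ : IsOpen Ω) (hf : IsDirStationary Ω f) {x : Euc n} {R : ℝ}
    (hB : closedBall x (2 * R) ⊆ Ω) :
    FrequencyRelations n R (height Ω f x) (energy Ω f x) where
  height_nonneg := height_nonneg x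
  energy_nonneg := energy_nonneg x
  hasDerivAt_height r hr hrR := (hf.hasDerivAt_height_and_energy hn hΩ hr
    ((closedBall_subset_closedBall (by linarith)).trans hB)).1
  exists_hasDerivAt_energy r hr hrR := (hf.hasDerivAt_height_and_energy hn hΩ hr
    ((closedBall_subset_closedBall (by linarith)).trans hB)).2

end QValued

/-! ### Vanishing order and frequency -/

namespace QValued

open MeasureTheory Filter Topology Metric ApproxCalc
open scoped ENNReal

variable {n m Q : ℕ} {Ω : Set (Euc n)} {f : Euc n → AQ Q m}

/-- The mean of `|f|²` over the annulus `B_{2r}(x) \ B_r(x)`. -/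
noncomputable def annulusMean (f : Euc n → AQ Q m) (x : Euc n) (r : ℝ) : ℝ :=
  (∫ y in ball x (2 * r) \ ball x r, normSq (f y)) / volume.real (ball x (2 * r) \ ball x r)

lemma volume_real_annulus (x : Euc n) {r : ℝ} (hr : 0 < r) :
    volume.real (ball x (2 * r) \ ball x r) =
      (2 ^ n - 1) * volume.real (ball (0 : Euc n) 1) * r ^ n := by
  rw [measureReal_sdiff (ball_subset_ball (by linarith)) measurableSet_ball measure_ball_lt_top.ne,
    measureReal_def, measureReal_def, Measure.addHaar_ball_of_pos _ _ (by linarith : 0 < 2 * r),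
    Measure.addHaar_ball_of_pos _ _ hr, finrank_euclideanSpace_fin, ENNReal.toReal_mul,
    ENNReal.toReal_mul, ENNReal.toReal_ofReal (by positivity), ENNReal.toReal_ofReal (by positivity),
    ← measureReal_def]
  ring

lemma volume_real_unitBall_pos : 0 < volume.real (ball (0 : Euc n) 1) :=
  ENNReal.toReal_pos (measure_ball_pos _ _ one_pos).ne' measure_ball_lt_top.ne

lemma laverage_annulus (hn : 0 < n) (hf : IntegrableOn (fun y => normSq (f y)) Ω) {x : Euc n}
    {r : ℝ} (hr : 0 < r) (hB : ball x (2 * r) ⊆ Ω) :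
    laverage (volume.restrict (ball x (2 * r) \ ball x r)) (fun y => ENNReal.ofReal (normSq (f y))) =
      ENNReal.ofReal (annulusMean f x r) := by
  have h2 : (1 : ℝ) < 2 ^ n := one_lt_pow₀ (by norm_num) hn.ne'
  have hv : 0 < volume.real (ball x (2 * r) \ ball x r) := by
    rw [volume_real_annulus x hr]
    have := volume_real_unitBall_pos (n := n)
    have h3 : (0 : ℝ) < 2 ^ n - 1 := by linarith
    positivity
  rw [laverage_eq, annulusMean, ENNReal.ofReal_div_of_pos hv,
    ofReal_integral_eq_lintegral_ofReal (hf.mono_set (Set.sdiff_subset.trans hB))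
      (ae_of_all _ fun y => normSq_nonneg _), Measure.restrict_apply_univ, measureReal_def,
    ENNReal.ofReal_toReal]
  exact ((measure_mono Set.sdiff_subset).trans_lt measure_ball_lt_top).ne

lemma sq_dist_div_le_one {x y : Euc n} {r : ℝ} (hr : 0 < r) (hy : y ∈ ball x r) :
    ‖y - x‖ ^ 2 / r ^ 2 ≤ 1 := by
  rw [mem_ball, dist_eq_norm] at hy
  rw [div_le_one (by positivity)]
  gcongr

lemma integrableOn_cutoff_mul (hf : IntegrableOn (fun y => normSq (f y)) Ω) (x : Euc n) (r : ℝ) :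
    IntegrableOn (fun y => cutoffProfile (‖y - x‖ ^ 2 / r ^ 2) * normSq (f y)) Ω :=
  integrable_mul_of_bounded hf (contDiff_cutoffProfile.continuous.comp (by fun_prop))
    (C := 1) fun y => by
      rw [abs_of_nonneg (cutoffProfile_nonneg _)]; exact cutoffProfile_le_one _

lemma setIntegral_annulus_eq {x : Euc n} {r : ℝ} (hB : ball x (2 * r) ⊆ Ω) :
    ∫ y in ball x (2 * r) \ ball x r, normSq (f y) =
      ∫ y in Ω, (ball x (2 * r) \ ball x r).indicator (fun y => normSq (f y)) y := by
  rw [setIntegral_indicator (measurableSet_ball.diff measurableSet_ball),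
    Set.inter_eq_self_of_subset_right (Set.sdiff_subset.trans hB)]

lemma setIntegral_annulus_le_height
    (hf : IntegrableOn (fun y => normSq (f y)) Ω) {x : Euc n} {r : ℝ} (hr : 0 < r)
    (hB : ball x (2 * r) ⊆ Ω) :
    ∫ y in ball x (2 * r) \ ball x r, normSq (f y) ≤ height Ω f x (2 * r) := by
  rw [setIntegral_annulus_eq hB, height]
  refine integral_mono (hf.indicator (measurableSet_ball.diff measurableSet_ball))
    (integrableOn_cutoff_mul hf x _) fun y => ?_
  simp only [Set.indicator]
  split_ifs with h
  · rw [cutoffProfile_eq_one (sq_dist_div_le_one (by positivity) h.1), one_mul]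
  · exact mul_nonneg (cutoffProfile_nonneg _) (normSq_nonneg _)

/-- Both cutoffs equal 1 on the inner ball and cancel there. The factor √2 is the largest for which
the outer cutoff, whose argument is the squared distance, vanishes outside the ball of radius 2r; in
between the difference is at most 1. -/
lemma height_sub_height_le_setIntegral_annulus
    (hf : IntegrableOn (fun y => normSq (f y)) Ω) {x : Euc n} {r : ℝ} (hr : 0 < r)
    (hB : ball x (2 * r) ⊆ Ω) :
    height Ω f x (√2 * r) - height Ω f x r ≤
      ∫ y in ball x (2 * r) \ ball x r, normSq (f y) := by
  have i1 := integrableOn_cutoff_mul hf x (√2 * r)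
  have i2 := integrableOn_cutoff_mul hf x r
  have hs2 : √2 ^ 2 = (2 : ℝ) := Real.sq_sqrt (by norm_num)
  rw [setIntegral_annulus_eq hB, height, height, ← integral_sub i1 i2]
  refine integral_mono (i1.sub i2) (hf.indicator (measurableSet_ball.diff measurableSet_ball))
    fun y => ?_
  have hnn := normSq_nonneg (f y)
  simp only [Set.indicator, ← sub_mul]
  split_ifs with h
  · have h1 := cutoffProfile_le_one (‖y - x‖ ^ 2 / (√2 * r) ^ 2)
    have h2 := cutoffProfile_nonneg (‖y - x‖ ^ 2 / r ^ 2)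
    nlinarith
  · by_cases hy : y ∈ ball x r
    · have h1 : y ∈ ball x (√2 * r) :=
        ball_subset_ball (by nlinarith [Real.one_lt_sqrt_two]) hy
      rw [cutoffProfile_eq_one (sq_dist_div_le_one hr hy),
        cutoffProfile_eq_one (sq_dist_div_le_one (by positivity) h1)]
      simp
    · have hy2 : 2 * r ≤ ‖y - x‖ := by
        by_contra hcon
        exact h ⟨by rw [mem_ball, dist_eq_norm]; linarith, hy⟩
      have h1 : 2 ≤ ‖y - x‖ ^ 2 / (√2 * r) ^ 2 := by
        rw [le_div_iff₀ (by positivity), mul_pow, hs2]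
        nlinarith
      rw [cutoffProfile_eq_zero h1]
      have := mul_nonneg (cutoffProfile_nonneg (‖y - x‖ ^ 2 / r ^ 2)) hnn
      linarith

/-- The means over annuli are comparable to the scaled height. -/
lemma exists_annulusMean_bounds (hn : 0 < n) (hΩ : IsOpen Ω) (hf : IsDirStationary Ω f) {x : Euc n}
    {R : ℝ} (hB : closedBall x (2 * R) ⊆ Ω) :
    ∃ c C : ℝ, 0 < c ∧ 0 < C ∧ ∀ r, 0 < r → 2 * r < R →
      c * (height Ω f x r / r ^ n) ≤ annulusMean f x r ∧
      annulusMean f x r ≤ C * (height Ω f x (2 * r) / (2 * r) ^ n) := by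
  have hfi := hf.1.integrableOn_normSq
  have hfr := hf.frequencyRelations hn hΩ hB
  set ω := volume.real (ball (0 : Euc n) 1)
  have hω : 0 < ω := volume_real_unitBall_pos
  have h2 : (0 : ℝ) < 2 ^ n - 1 := sub_pos.2 (one_lt_pow₀ (by norm_num) hn.ne')
  have hs2 : (0 : ℝ) < √2 ^ n - 1 := sub_pos.2 (one_lt_pow₀ Real.one_lt_sqrt_two hn.ne')
  refine ⟨(√2 ^ n - 1) / ((2 ^ n - 1) * ω), 2 ^ n / ((2 ^ n - 1) * ω), by positivity,
    by positivity, fun r hr hrR => ?_⟩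
  have hsub : ball x (2 * r) ⊆ Ω := fun y hy => hB (mem_closedBall.2 (by
    have := mem_ball.1 hy; linarith))
  have hV := volume_real_annulus x hr
  rw [annulusMean, hV]
  constructor
  · have h3 := height_sub_height_le_setIntegral_annulus hfi hr hsub
    have hle : √2 * r < R := by
      have : √2 ≤ 2 := by rw [Real.sqrt_le_left (by norm_num)]; norm_num
      nlinarith
    have h4 := hfr.scaled_mono hr (by nlinarith [Real.one_lt_sqrt_two] : r ≤ √2 * r) hle
    rw [mul_pow, div_le_div_iff₀ (by positivity) (by positivity)] at h4
    -- Monotonicity of H / rⁿ yields H(√2 r) ≥ √2ⁿ H(r), so the difference of heights dominates (√2ⁿ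
    -- - 1) H(r): the annulus carries a fixed share of the mass.
    have h5 : √2 ^ n * height Ω f x r ≤ height Ω f x (√2 * r) := by
      have hrn : 0 < r ^ n := by positivity
      refine le_of_mul_le_mul_right ?_ hrn
      linarith
    rw [div_mul_div_comm]
    refine div_le_div_of_nonneg_right ?_ (by positivity)
    linarith
  · have h3 := setIntegral_annulus_le_height hfi hr hsub
    rw [mul_pow, div_mul_div_comm]
    calc _ ≤ height Ω f x (2 * r) / ((2 ^ n - 1) * ω * r ^ n) :=
          div_le_div_of_nonneg_right h3 (by positivity)
      _ = _ := by field_simp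

lemma tendsto_affine_log_div (K N : ℝ) :
    Tendsto (fun r : ℝ => (K + N * Real.log r) / (2 * Real.log r)) (𝓝[>] 0) (𝓝 (N / 2)) := by
  have h1 : Tendsto (fun r : ℝ => K / 2 * (Real.log r)⁻¹ + N / 2) (𝓝[>] 0)
      (𝓝 (K / 2 * 0 + N / 2)) :=
    ((tendsto_inv_atBot_zero.comp Real.tendsto_log_nhdsGT_zero).const_mul _).add_const _
  rw [mul_zero, zero_add] at h1
  refine h1.congr' ?_
  filter_upwards [Ioo_mem_nhdsGT one_pos] with r hr
  have := (Real.log_neg hr.1 hr.2).ne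
  field_simp

lemma vanishingOrder_eq_limsup (hn : 0 < n) (hΩ : IsOpen Ω)
    (hf : IntegrableOn (fun y => normSq (f y)) Ω) {x : Euc n} (hx : x ∈ Ω) :
    vanishingOrder f x = limsup (fun r : ℝ => ENNReal.log (ENNReal.ofReal (annulusMean f x r)) /
      ((2 * Real.log r : ℝ) : EReal)) (𝓝[>] 0) := by
  obtain ⟨ε, hε, hball⟩ := Metric.isOpen_iff.1 hΩ x hx
  refine limsup_congr ?_
  filter_upwards [Ioo_mem_nhdsGT (half_pos hε)] with r hr
  rw [laverage_annulus hn hf hr.1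
    ((ball_subset_ball (by linarith [hr.2])).trans hball)]

lemma log_div_eq {a r : ℝ} (ha : 0 < a) :
    ENNReal.log (ENNReal.ofReal a) / ((2 * Real.log r : ℝ) : EReal) =
      ((Real.log a / (2 * Real.log r) : ℝ) : EReal) := by
  rw [ENNReal.log_ofReal_of_pos ha, EReal.coe_div]

/-- The vanishing order is at most half the frequency at any scale. -/
lemma vanishingOrder_le_frequency (hn : 0 < n) (hΩ : IsOpen Ω) (hf : IsDirStationary Ω f)
    {x : Euc n} {R s : ℝ} (hB : closedBall x (2 * R) ⊆ Ω) (hs : 0 < s) (hsR : s < R)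
    (hH : 0 < height Ω f x s) :
    vanishingOrder f x ≤ ((frequency (height Ω f x) (energy Ω f x) s / 2 : ℝ) : EReal) := by
  have hfr := hf.frequencyRelations hn hΩ hB
  obtain ⟨c, _, hc, _, hbd⟩ := exists_annulusMean_bounds hn hΩ hf hB
  have hx : x ∈ Ω := hB (mem_closedBall_self (by linarith))
  set N := frequency (height Ω f x) (energy Ω f x) s
  set K := Real.log c + Real.log (height Ω f x s / s ^ n) - N * Real.log s
  have hlim : Tendsto (fun r : ℝ => (((K + N * Real.log r) / (2 * Real.log r) : ℝ) : EReal))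
      (𝓝[>] 0) (𝓝 ((N / 2 : ℝ) : EReal)) :=
    (continuous_coe_real_ereal.tendsto _).comp (tendsto_affine_log_div K N)
  rw [vanishingOrder_eq_limsup hn hΩ hf.1.integrableOn_normSq hx, ← hlim.limsup_eq]
  refine limsup_le_limsup ?_
  filter_upwards [Ioo_mem_nhdsGT one_pos, Ioo_mem_nhdsGT hs,
    Ioo_mem_nhdsGT (by linarith : 0 < R / 2)] with r hr1 hrs hrR
  have hr := hr1.1
  have hHr := hfr.height_pos_of_ge hr hrs.2.le hsR hH
  have hM : 0 < height Ω f x r / r ^ n := by positivity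
  have h1 := (hbd r hr (by linarith [hrR.2])).1
  have hpos : 0 < annulusMean f x r := (mul_pos hc hM).trans_le h1
  rw [log_div_eq hpos]
  -- Dividing by 2 log r < 0 reverses inequalities, so a lower bound on the mean bounds the quotient
  -- from above.
  refine EReal.coe_le_coe_iff.2 (div_le_div_of_nonpos_of_le ?_ ?_)
  · linarith [Real.log_neg hr hr1.2]
  · have h2 := Real.log_le_log (mul_pos hc hM) h1
    rw [Real.log_mul hc.ne' hM.ne'] at h2
    have h3 := hfr.log_scaled_sub_le hr hrs.2.le hsR hHr
    simp only [K]
    linarith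

/-- A lower bound for the frequency at all scales bounds the vanishing order from below. -/
lemma le_vanishingOrder_of_le_frequency (hn : 0 < n) (hΩ : IsOpen Ω) (hf : IsDirStationary Ω f)
    {x : Euc n} {R N : ℝ} (hR : 0 < R) (hB : closedBall x (2 * R) ⊆ Ω)
    (hH : ∀ s, 0 < s → s < R → 0 < height Ω f x s)
    (hN : ∀ s, 0 < s → s < R → N ≤ frequency (height Ω f x) (energy Ω f x) s) :
    ((N / 2 : ℝ) : EReal) ≤ vanishingOrder f x := by
  have hfr := hf.frequencyRelations hn hΩ hB
  obtain ⟨c, C, hc, hC, hbd⟩ := exists_annulusMean_bounds hn hΩ hf hB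
  have hx : x ∈ Ω := hB (mem_closedBall_self (by linarith))
  set b := R / 2 with hb
  have hb0 : 0 < b := by positivity
  have hbR : b < R := by linarith
  -- The mean at r is compared with the height at 2r, whence the term N log 2; the growth estimate
  -- then runs from 2r to b.
  set K := Real.log C + Real.log (height Ω f x b / b ^ n) - N * Real.log b + N * Real.log 2
  have hlim : Tendsto (fun r : ℝ => (((K + N * Real.log r) / (2 * Real.log r) : ℝ) : EReal))
      (𝓝[>] 0) (𝓝 ((N / 2 : ℝ) : EReal)) :=
    (continuous_coe_real_ereal.tendsto _).comp (tendsto_affine_log_div K N)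
  rw [vanishingOrder_eq_limsup hn hΩ hf.1.integrableOn_normSq hx, ← hlim.limsup_eq]
  refine limsup_le_limsup ?_
  filter_upwards [Ioo_mem_nhdsGT one_pos, Ioo_mem_nhdsGT (by linarith : 0 < b / 2)] with r hr1 hrb
  have hr := hr1.1
  have h2rb : 2 * r < b := by linarith [hrb.2]
  have h2r : 0 < 2 * r := by linarith
  have hM : 0 < height Ω f x r / r ^ n := div_pos (hH r hr (by linarith)) (by positivity)
  have hM2 : 0 < height Ω f x (2 * r) / (2 * r) ^ n :=
    div_pos (hH _ h2r (by linarith)) (by positivity)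
  have h1 := hbd r hr (by linarith)
  have hpos : 0 < annulusMean f x r := (mul_pos hc hM).trans_le h1.1
  rw [log_div_eq hpos]
  refine EReal.coe_le_coe_iff.2 (div_le_div_of_nonpos_of_le ?_ ?_)
  · linarith [Real.log_neg hr hr1.2]
  · have h2 := Real.log_le_log hpos h1.2
    rw [Real.log_mul hC.ne' hM2.ne'] at h2
    have h3 := hfr.le_log_scaled_sub h2r h2rb.le hbR (hH _ h2r (by linarith))
    have h4 : N * (Real.log b - Real.log (2 * r)) ≤
        frequency (height Ω f x) (energy Ω f x) (2 * r) * (Real.log b - Real.log (2 * r)) :=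
      mul_le_mul_of_nonneg_right (hN _ h2r (by linarith))
        (sub_nonneg.2 (Real.log_le_log h2r h2rb.le))
    rw [Real.log_mul (by norm_num) hr.ne'] at h3 h4
    simp only [K]
    linarith

lemma ae_normSq_eq_zero_of_height_eq_zero
    (hf : IntegrableOn (fun y => normSq (f y)) Ω) {x : Euc n} {r : ℝ} (hr : 0 < r)
    (hB : ball x r ⊆ Ω) (h : height Ω f x r = 0) :
    ∀ᵐ y ∂volume.restrict (ball x r), normSq (f y) = 0 := by
  have h1 := (integral_eq_zero_iff_of_nonneg
    (fun y => mul_nonneg (cutoffProfile_nonneg _) (normSq_nonneg _))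
    (integrableOn_cutoff_mul hf x r)).1 h
  filter_upwards [ae_restrict_of_ae_restrict_of_subset hB h1, ae_restrict_mem measurableSet_ball]
    with y hy hyB
  simpa [cutoffProfile_eq_one (sq_dist_div_le_one hr hyB)] using hy

/-- The vanishing order is infinite where `f` vanishes locally. -/
lemma vanishingOrder_eq_top (hn : 0 < n) (hΩ : IsOpen Ω)
    (hf : IntegrableOn (fun y => normSq (f y)) Ω) {x : Euc n} {s : ℝ} (hs : 0 < s)
    (hx : x ∈ Ω) (h : ∀ᵐ y ∂volume.restrict (ball x s), normSq (f y) = 0) :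
    vanishingOrder f x = ⊤ := by
  rw [vanishingOrder_eq_limsup hn hΩ hf hx]
  have h1 : (fun r : ℝ => ENNReal.log (ENNReal.ofReal (annulusMean f x r)) /
      ((2 * Real.log r : ℝ) : EReal)) =ᶠ[𝓝[>] 0] fun _ => ⊤ := by
    filter_upwards [Ioo_mem_nhdsGT one_pos, Ioo_mem_nhdsGT (half_pos hs)] with r hr hrs
    have h2 : annulusMean f x r = 0 := by
      rw [annulusMean, integral_eq_zero_of_ae (ae_restrict_of_ae_restrict_of_subset
        (Set.sdiff_subset.trans (ball_subset_ball (by linarith [hrs.2]))) h), zero_div]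
    rw [h2, ENNReal.ofReal_zero, ENNReal.log_zero]
    -- Here log 0 = ⊥ is divided by a finite negative number, giving ⊤.
    refine EReal.bot_div_of_neg_ne_bot ?_ (EReal.coe_ne_bot _)
    exact_mod_cast (by linarith [Real.log_neg hr.1 hr.2] : 2 * Real.log r < 0)
  rw [limsup_congr h1, limsup_const]

end QValued

/-! ### Semicontinuity and unique continuation -/

namespace QValued

open MeasureTheory Filter Topology Metric ApproxCalc
open scoped ENNReal

variable {n m Q : ℕ} {Ω : Set (Euc n)} {f : Euc n → AQ Q m}

/-- The radius 4R leaves room for the scales below R around every centre in the ball of radius R,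
since heights at scale s involve points up to distance 2s. -/
lemma exists_closedBall_subset (hΩ : IsOpen Ω) {x : Euc n} (hx : x ∈ Ω) :
    ∃ R, 0 < R ∧ closedBall x (4 * R) ⊆ Ω := by
  obtain ⟨ε, hε, hball⟩ := Metric.nhds_basis_closedBall.mem_iff.1 (hΩ.mem_nhds hx)
  exact ⟨ε / 4, by positivity, by rwa [mul_div_cancel₀ _ (by norm_num)]⟩

lemma closedBall_subset_of_mem_ball {x y : Euc n} {R : ℝ} (hB : closedBall x (4 * R) ⊆ Ω)
    (hy : y ∈ ball x R) : closedBall y (2 * R) ⊆ Ω :=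
  (closedBall_subset_closedBall' (by
    have := mem_ball.1 hy; have := _root_.dist_nonneg (x := y) (y := x); linarith)).trans hB

/-- If the height vanishes at some scale, the vanishing order is infinite on the ball of that
scale. -/
lemma IsDirStationary.vanishingOrder_eq_top_of_height_eq_zero (hn : 0 < n) (hΩ : IsOpen Ω)
    (hf : IsDirStationary Ω f) {x : Euc n} {s : ℝ} (hs : 0 < s) (hB : closedBall x s ⊆ Ω)
    (h : height Ω f x s = 0) {y : Euc n} (hy : y ∈ ball x s) : vanishingOrder f y = ⊤ := by
  have h1 := ae_normSq_eq_zero_of_height_eq_zero hf.1.integrableOn_normSq hs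
    (ball_subset_closedBall.trans hB) h
  have h2 := mem_ball.1 hy
  exact vanishingOrder_eq_top hn hΩ hf.1.integrableOn_normSq (s := s - Dist.dist y x)
    (by linarith) (hB (ball_subset_closedBall hy))
    (ae_restrict_of_ae_restrict_of_subset (ball_subset_ball' (by linarith)) h1)

lemma IsDirStationary.height_pos_of_vanishingOrder_lt_top (hn : 0 < n) (hΩ : IsOpen Ω)
    (hf : IsDirStationary Ω f) {x : Euc n} (hx : vanishingOrder f x < ⊤) {s : ℝ} (hs : 0 < s)
    (hB : closedBall x s ⊆ Ω) : 0 < height Ω f x s :=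
  (height_nonneg x s).lt_of_ne fun h => hx.ne
    (hf.vanishingOrder_eq_top_of_height_eq_zero hn hΩ hs hB h.symm (mem_ball_self hs))

/-- When the order is finite the height is positive at all small scales, and the lower bound applies
with N = 0 because frequencies are nonnegative. -/
lemma IsDirStationary.vanishingOrder_nonneg (hn : 0 < n) (hΩ : IsOpen Ω)
    (hf : IsDirStationary Ω f) {x : Euc n} (hx : x ∈ Ω) : 0 ≤ vanishingOrder f x := by
  rcases eq_or_ne (vanishingOrder f x) ⊤ with h | h
  · simp [h]
  · obtain ⟨R, hR, hB⟩ := exists_closedBall_subset hΩ hx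
    have hB2 := closedBall_subset_of_mem_ball hB (mem_ball_self hR)
    have := le_vanishingOrder_of_le_frequency hn hΩ hf (N := 0) hR hB2
      (fun s hs hsR => hf.height_pos_of_vanishingOrder_lt_top hn hΩ h.lt_top hs
        ((closedBall_subset_closedBall (by linarith)).trans hB2))
      (fun s _ _ => (hf.frequencyRelations hn hΩ hB2).frequency_nonneg s)
    simpa using this

lemma continuous_height (hf : MemW12 Ω f) (s : ℝ) : Continuous fun x => height Ω f x s :=
  continuous_profile_integral contDiff_cutoffProfile.continuous (fun _ => cutoffProfile_eq_zero)
    hf.integrableOn_normSq s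

lemma continuous_energy (hn : 0 < n) (hΩ : IsOpen Ω) (hf : MemW12 Ω f) (s : ℝ) :
    Continuous fun x => energy Ω f x s :=
  continuous_profile_integral contDiff_cutoffPrimitive.continuous
    (fun _ => cutoffPrimitive_eq_zero) (hf.integrableOn_energyDensity hn hΩ) s

/-- Some scale s has frequency at x below 2c' with c' < c, otherwise the order at x would be at
least c'. At this fixed s height and energy are continuous in the centre, so the frequency stays
below 2c' nearby, and half of it bounds the order at each nearby point. -/
theorem IsDirStationary.eventually_vanishingOrder_lt (hn : 0 < n) (hΩ : IsOpen Ω)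
    (hf : IsDirStationary Ω f) {x : Euc n} (hx : x ∈ Ω) {c : EReal} (hc : vanishingOrder f x < c) :
    ∀ᶠ y in 𝓝 x, vanishingOrder f y < c := by
  obtain ⟨R, hR, hB⟩ := exists_closedBall_subset hΩ hx
  have hB2 := closedBall_subset_of_mem_ball hB (mem_ball_self hR)
  have hH : ∀ s, 0 < s → s < R → 0 < height Ω f x s := fun s hs hsR =>
    hf.height_pos_of_vanishingOrder_lt_top hn hΩ (hc.trans_le le_top) hs
      ((closedBall_subset_closedBall (by linarith)).trans hB2)
  obtain ⟨c', hc1, hc2⟩ := EReal.lt_iff_exists_real_btwn.1 hc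
  obtain ⟨s, hs, hsR, hN⟩ : ∃ s, 0 < s ∧ s < R ∧
      frequency (height Ω f x) (energy Ω f x) s < 2 * c' := by
    by_contra! hcon
    have := le_vanishingOrder_of_le_frequency hn hΩ hf hR hB2 hH hcon
    rw [mul_div_cancel_left₀ _ two_ne_zero] at this
    exact this.not_gt hc1
  have hcont : ContinuousAt (fun y => frequency (height Ω f y) (energy Ω f y) s) x :=
    (((continuous_energy hn hΩ hf.1 s).continuousAt).const_mul _).div
      (continuous_height hf.1 s).continuousAt (hH s hs hsR).ne'
  filter_upwards [hcont.eventually_lt continuousAt_const hN, ball_mem_nhds x hR,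
    (continuous_height hf.1 s).continuousAt.eventually_const_lt (hH s hs hsR)] with y hy1 hy2 hy3
  refine (vanishingOrder_le_frequency hn hΩ hf (closedBall_subset_of_mem_ball hB hy2) hs hsR
    hy3).trans_lt (lt_of_le_of_lt ?_ hc2)
  exact EReal.coe_le_coe_iff.2 (by linarith)

/-- A positive height at one scale would bound the order by a finite frequency. Hence the height is
zero, and f vanishes a.e. on the corresponding ball. -/
theorem IsDirStationary.eventually_vanishingOrder_eq_top (hn : 0 < n) (hΩ : IsOpen Ω)
    (hf : IsDirStationary Ω f) {x : Euc n} (hx : x ∈ Ω) (h : vanishingOrder f x = ⊤) :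
    ∃ r > 0, (∀ y ∈ ball x r, vanishingOrder f y = ⊤) ∧
      ∀ᵐ y ∂volume.restrict (ball x r), normSq (f y) = 0 := by
  obtain ⟨R, hR, hB⟩ := exists_closedBall_subset hΩ hx
  have hB2 := closedBall_subset_of_mem_ball hB (mem_ball_self hR)
  have hs : 0 < R / 2 := by positivity
  have hBs : closedBall x (R / 2) ⊆ Ω := (closedBall_subset_closedBall (by linarith)).trans hB2
  have h0 : height Ω f x (R / 2) = 0 := by
    by_contra hne
    have := vanishingOrder_le_frequency hn hΩ hf hB2 hs (by linarith)
      ((height_nonneg x _).lt_of_ne' hne)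
    rw [h] at this
    exact (EReal.coe_lt_top _).not_ge this
  exact ⟨R / 2, hs, fun y hy => hf.vanishingOrder_eq_top_of_height_eq_zero hn hΩ hs hBs h0 hy,
    ae_normSq_eq_zero_of_height_eq_zero hf.1.integrableOn_normSq hs
      (ball_subset_closedBall.trans hBs) h0⟩

lemma eq_zeroQ_of_normSq_eq_zero {T : AQ Q m} (h : normSq T = 0) : T = zeroQ Q m := by
  rw [← dist_zeroQ_sq] at h
  exact eq_of_dist_eq_zero (pow_eq_zero_iff two_ne_zero |>.1 h)

/-- Unique continuation: on a connected domain the vanishing order is finite, unless `f` vanishes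
identically. -/
theorem IsDirStationary.vanishingOrder_lt_top (hn : 0 < n) (hΩ : IsOpen Ω)
    (hf : IsDirStationary Ω f) (hconn : IsPreconnected Ω)
    (hne : ¬ ∀ᵐ x ∂volume.restrict Ω, f x = zeroQ Q m) {x : Euc n} (hx : x ∈ Ω) :
    vanishingOrder f x < ⊤ := by
  by_contra hcon
  have hu : IsOpen (Ω ∩ {x | vanishingOrder f x = ⊤}) := isOpen_iff_mem_nhds.2 fun y hy => by
    obtain ⟨r, hr, h, -⟩ := hf.eventually_vanishingOrder_eq_top hn hΩ hy.1 hy.2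
    filter_upwards [hΩ.mem_nhds hy.1, ball_mem_nhds y hr] with z hz hz' using ⟨hz, h z hz'⟩
  have hv : IsOpen (Ω ∩ {x | vanishingOrder f x < ⊤}) := isOpen_iff_mem_nhds.2 fun y hy => by
    filter_upwards [hΩ.mem_nhds hy.1, hf.eventually_vanishingOrder_lt hn hΩ hy.1 hy.2] with z hz hz'
      using ⟨hz, hz'⟩
  -- Finite and infinite order split Ω into two disjoint open sets; connectedness leaves only the
  -- one containing x.
  have hsub : Ω ⊆ Ω ∩ {x | vanishingOrder f x = ⊤} := by
    refine hconn.subset_left_of_subset_union hu hv (Set.disjoint_left.2 fun y hy hy' =>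
      hy'.2.ne hy.2) (fun y hy => ?_) ⟨x, hx, hx, not_lt_top_iff.1 hcon⟩
    rcases eq_or_ne (vanishingOrder f y) ⊤ with h | h
    exacts [Or.inl ⟨hy, h⟩, Or.inr ⟨hy, h.lt_top⟩]
  apply hne
  have hnull : volume.restrict Ω {y | ¬ f y = zeroQ Q m} = 0 := by
    rw [Measure.restrict_apply' hΩ.measurableSet]
    refine measure_null_of_locally_null _ fun y hy => ?_
    obtain ⟨r, hr, -, h⟩ := hf.eventually_vanishingOrder_eq_top hn hΩ hy.2 (hsub hy.2).2
    refine ⟨{z | ¬ f z = zeroQ Q m} ∩ ball y r,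
      inter_mem (mem_of_superset self_mem_nhdsWithin Set.inter_subset_left)
        (mem_nhdsWithin_of_mem_nhds (ball_mem_nhds y hr)), ?_⟩
    rw [← Measure.restrict_apply' measurableSet_ball]
    exact h.mono fun z hz => eq_zeroQ_of_normSq_eq_zero hz
  exact hnull

end QValued

/-! ### The theorem -/

theorem lemma3p5 {n m Q : ℕ} (hn : 0 < n) (hQ : 0 < Q)
    (Ω : Set (QValued.Euc n)) (hΩ : IsOpen Ω)
    (f : QValued.Euc n → QValued.AQ Q m)
    (hf : QValued.IsDirStationary Ω f)
    (havg : ∀ᵐ x ∂(MeasureTheory.volume.restrict Ω), QValued.average (f x) = 0) :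
    UpperSemicontinuousOn (QValued.vanishingOrder f) Ω ∧
    (IsPreconnected Ω →
      ¬ (∀ᵐ x ∂(MeasureTheory.volume.restrict Ω), f x = QValued.zeroQ Q m) →
      ∀ K : Set (QValued.Euc n), IsCompact K → K ⊆ Ω →
        ∃ C : ℝ, ∀ x ∈ K,
          ((-C : ℝ) : EReal) ≤ QValued.vanishingOrder f x ∧
          QValued.vanishingOrder f x ≤ (C : EReal)) := by
  have husc : UpperSemicontinuousOn (QValued.vanishingOrder f) Ω := fun x hx c hc =>
    (hf.eventually_vanishingOrder_lt hn hΩ hx hc).filter_mono nhdsWithin_le_nhds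
  refine ⟨husc, fun hconn hne K hK hKΩ => ?_⟩
  rcases K.eq_empty_or_nonempty with rfl | hKne
  · exact ⟨0, by simp⟩
  -- An upper semicontinuous function attains its maximum on a nonempty compact set. The maximum is
  -- finite by unique continuation and serves as C; nonnegativity of the order gives the lower
  -- bound.
  obtain ⟨a, ha, hmax⟩ := (husc.mono hKΩ).exists_isMaxOn hKne hK
  have ha0 := hf.vanishingOrder_nonneg hn hΩ (hKΩ ha)
  have hatop := hf.vanishingOrder_lt_top hn hΩ hconn hne (hKΩ ha)
  have hC := EReal.coe_toReal hatop.ne (ne_bot_of_le_ne_bot EReal.zero_ne_bot ha0)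
  refine ⟨(QValued.vanishingOrder f a).toReal, fun x hx => ⟨?_, ?_⟩⟩
  · refine le_trans ?_ (hf.vanishingOrder_nonneg hn hΩ (hKΩ hx))
    exact_mod_cast neg_nonpos.2 (EReal.toReal_nonneg ha0)
  · rw [hC]
    exact hmax hx
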